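/- Let $(G,\pi_G)$ be a Poisson Lie group with Lie algebra $\mathfrak g$, and let $(G^*,\pi_{G^*})$ be its dual Poisson Lie group: the connected and simply connected Poisson Lie group with Lie algebra $\mathfrak g^\star$, where the bracket of $\mathfrak g^\star$ is the linearization of $\pi_G$ at the unit, $\langle[\xi,\eta],X\rangle=\frac{d}{dt}\big|_{0}\langle r_{g_t^{-1}}\pi_G(g_t),\xi\wedge\eta\rangle$ for $g_0=e$, $\dot g_0=X$, and likewise the bracket of $\mathfrak g$ is the linearization of $\pi_{G^*}$. Write $\langle\pi^\sharp(\omega),\nu\rangle=\langle\pi,\nu\wedge\omega\rangle$, and define the (infinitesimal) left dressing action of $\mathfrak g$ on $G^*$ and right dressing action of $\mathfrak g^\star$ on $G$ by the dressing vector fields $$\mathcal S_X(\gamma)=\pi_{G^*}^\sharp(r_{\gamma^{-1}}^*X),\qquad \mathcal S_\xi(g)=-\pi_G^\sharp(l_{g^{-1}}^*\xi),\qquad X\in\mathfrak g,\ \xi\in\mathfrak g^\star .$$ Let $H\subset G$ be a connected closed Lie subgroup, with Lie algebra $\mathfrak h$, that is a coisotropic submanifold ($\pi_G^\sharp(N^*H)\subset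 TH$). Assume that $\mathfrak h^\perp=\{\xi\in\mathfrak g^\star:\langle\xi,X\rangle=0\ \forall X\in\mathfrak h\}$ is the Lie algebra of a connected closed Lie subgroup $H^\perp\subset G^*$. Then: 1. $H^\perp$ is a coisotropic submanifold of $G^*$ and is invariant under the dressing action of $\mathfrak h$: for every $X\in\mathfrak h$ the field $\mathcal S_X$ is tangent to $H^\perp$, and every integral curve of $\mathcal S_X$ on an interval that meets $H^\perp$ lies in $H^\perp$. 2. For every $\gamma\in H^\perp$ one has $\{\mathcal S_X(\gamma):X\in\mathfrak h\}=\pi_{G^*}^\sharp(N_\gamma^*H^\perp)$, and the orbit of $\gamma$ under the dressing action of $\mathfrak h$ (the points reached from $\gamma$ by finitely many integral curves of fields $\mathcal S_X$, $X\in\mathfrak h$) is the coisotropic leaf of $H^\perp$ through $\gamma$, i.e. the leaf of the generalized distribution $\pi_{G^*}^\sharp(N^*H^\perp)$ (the points reached from $\gamma$ by finitely many integral curves, in $H^\perp$, of the fields $\pi_{G^*}^\sharp(\alpha)$ with $\alpha$ a smooth local section of $N^*H^\perp$). 3. If moreover $H$ is a Poisson subgroup, i.e. a Poisson submanifold ($\pi_G(h)\in\Lambda^2T_hH$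 for all $h\in H$), then the infinitesimal dressing action of $H^\perp$ on $H$ is trivial: $\mathcal S_\xi(h)=0$ for all $\xi\in\mathfrak h^\perp$ and $h\in H$, and every integral curve of $\mathcal S_\xi$ that meets $H$ is constant. -/

import Mathlib

open Set Filter Topology Manifold
open scoped ContDiff

noncomputable section

namespace PoissonLie

section Manifolds

/-- The cotangent space `T*ₓM`. -/
abbrev Cotangent (E : Type*) [NormedAddCommGroup E] [NormedSpace ℝ E]
    {M : Type*} [TopologicalSpace M] [ChartedSpace E M] (x : M) : Type _ :=
  TangentSpace 𝓘(ℝ, E) x →L[ℝ] ℝ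

/-- `S` is an embedded (smooth) submanifold of `M`: around each of its points there is a smooth
chart of `M` that carries `S` to a linear subspace of the model space. -/
def IsEmbeddedSubmanifold (E : Type*) [NormedAddCommGroup E] [NormedSpace ℝ E]
    {M : Type*} [TopologicalSpace M] [ChartedSpace E M] (S : Set M) : Prop :=
  ∀ x ∈ S, ∃ φ ∈ IsManifold.maximalAtlas 𝓘(ℝ, E) ∞ M, x ∈ φ.source ∧
    ∃ W : Submodule ℝ E, ∀ y ∈ φ.source, y ∈ S ↔ φ y ∈ W

/-- The tangent space `TₓS` of a submanifold `S ⊆ M`, as a subset of `TₓM`: the velocities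
at `x` of the smooth curves in `S` through `x`. -/
def tangentSet (E : Type*) [NormedAddCommGroup E] [NormedSpace ℝ E]
    {M : Type*} [TopologicalSpace M] [ChartedSpace E M] (S : Set M) (x : M) :
    Set (TangentSpace 𝓘(ℝ, E) x) :=
  {v | ∃ c : ℝ → M, ContMDiffAt 𝓘(ℝ, ℝ) 𝓘(ℝ, E) ∞ c 0 ∧ (∀ᶠ t in 𝓝 (0 : ℝ), c t ∈ S) ∧
    (⟨c 0, mfderiv 𝓘(ℝ, ℝ) 𝓘(ℝ, E) c 0 (1 : ℝ)⟩ : TangentBundle 𝓘(ℝ, E) M) = ⟨x, v⟩}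

variable {E : Type*} [NormedAddCommGroup E] [NormedSpace ℝ E]
  {M : Type*} [TopologicalSpace M] [ChartedSpace E M]

/-- The conormal space `N*ₓS = {α ∈ T*ₓM : ⟨α, v⟩ = 0 for all v ∈ TₓS}`. -/
def conormalSet (S : Set M) (x : M) : Set (Cotangent E x) :=
  {α | ∀ v ∈ tangentSet E S x, α v = 0}

/-- Smoothness on `U` of a differential 1-form. -/
def SmoothFormOn (α : ∀ x : M, Cotangent E x) (U : Set M) [IsManifold 𝓘(ℝ, E) ∞ M] : Prop :=
  ContMDiffOn 𝓘(ℝ, E) (𝓘(ℝ, E).prod 𝓘(ℝ, E →L[ℝ] ℝ)) ∞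
    (fun x : M ↦ Bundle.TotalSpace.mk' (E →L[ℝ] ℝ)
      (E := fun x : M ↦ TangentSpace 𝓘(ℝ, E) x →L[ℝ] ℝ) x (α x)) U

/-- A smooth bivector field `π` on a finite-dimensional manifold, given by its bundle map
`π♯ : T*M → TM`, where `⟨π♯ α, β⟩ = ⟨π, β ∧ α⟩`. -/
structure Bivector (E : Type*) [NormedAddCommGroup E] [NormedSpace ℝ E]
    (M : Type*) [TopologicalSpace M] [ChartedSpace E M] [IsManifold 𝓘(ℝ, E) ∞ M] where
  /-- the map `π♯` at a point -/
  sharp : ∀ x : M, Cotangent E x →L[ℝ] TangentSpace 𝓘(ℝ, E) x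
  alternating : ∀ (x : M) (α : Cotangent E x), α (sharp x α) = 0
  smooth : ContMDiff 𝓘(ℝ, E) (𝓘(ℝ, E).prod 𝓘(ℝ, (E →L[ℝ] ℝ) →L[ℝ] E)) ∞
    (fun x : M ↦ Bundle.TotalSpace.mk' ((E →L[ℝ] ℝ) →L[ℝ] E)
      (E := fun x : M ↦ (TangentSpace 𝓘(ℝ, E) x →L[ℝ] ℝ) →L[ℝ] TangentSpace 𝓘(ℝ, E) x)
      x (sharp x))

variable [IsManifold 𝓘(ℝ, E) ∞ M]

/-- The bracket `{f, g} = ⟨P, df ∧ dg⟩` of two functions. -/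
def Bivector.bracket (P : Bivector E M) (f g : M → ℝ) : M → ℝ := fun x ↦
  mvfderiv 𝓘(ℝ, E) f x (P.sharp x (mvfderiv 𝓘(ℝ, E) g x))

/-- `P` is a Poisson bivector field, `[P, P] = 0`: its bracket satisfies the Jacobi identity. -/
def Bivector.IsPoisson (P : Bivector E M) : Prop :=
  ∀ f g h : M → ℝ, ContMDiff 𝓘(ℝ, E) 𝓘(ℝ, ℝ) ∞ f → ContMDiff 𝓘(ℝ, E) 𝓘(ℝ, ℝ) ∞ g →
    ContMDiff 𝓘(ℝ, E) 𝓘(ℝ, ℝ) ∞ h → ∀ x : M,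
    P.bracket f (P.bracket g h) x + P.bracket g (P.bracket h f) x
      + P.bracket h (P.bracket f g) x = 0

/-- `S` is a coisotropic submanifold: `π♯(N*S) ⊆ TS`. -/
structure Bivector.IsCoisotropic (P : Bivector E M) (S : Set M) : Prop where
  isEmbeddedSubmanifold : IsEmbeddedSubmanifold E S
  sharp_mem : ∀ x ∈ S, ∀ α ∈ conormalSet (E := E) S x, P.sharp x α ∈ tangentSet E S x

/-- `S` is a Poisson submanifold: `π(x) ∈ Λ² TₓS` for all `x ∈ S`; for a bivector this says that
the image of `π♯` at `x` lies in `TₓS`. -/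
structure Bivector.IsPoissonSubmanifold (P : Bivector E M) (S : Set M) : Prop where
  isEmbeddedSubmanifold : IsEmbeddedSubmanifold E S
  sharp_mem : ∀ x ∈ S, ∀ α : Cotangent E x, P.sharp x α ∈ tangentSet E S x

/-- The coisotropic distribution `π♯(N*S)` of `S` at the point `x`. -/
def Bivector.coisotropicDistribution (P : Bivector E M) (S : Set M) (x : M) :
    Set (TangentSpace 𝓘(ℝ, E) x) :=
  P.sharp x '' conormalSet (E := E) S x

/-- The points `x` and `y` are joined by a trajectory of the vector field `v` over a compact
interval, running in the set `S`. -/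
def JoinedByTrajectory (v : ∀ x : M, TangentSpace 𝓘(ℝ, E) x) (S : Set M) (x y : M) : Prop :=
  ∃ (c : ℝ → M) (a b : ℝ), a ≤ b ∧ IsMIntegralCurveOn c v (Icc a b) ∧
    (∀ t ∈ Icc a b, c t ∈ S) ∧ c a = x ∧ c b = y

/-- The coisotropic leaf of `S` through `x`, that is, the leaf of the generalized distribution
`π♯(N*S)`: all points reached from `x` by finitely many trajectories in `S` of locally defined
vector fields `π♯ α`, where `α` is a smooth local section of the conormal bundle `N*S`. -/
def Bivector.coisotropicLeaf (P : Bivector E M) (S : Set M) (x : M) : Set M :=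
  {y | Relation.EqvGen (fun p q ↦ ∃ (U : Set M) (α : ∀ z : M, Cotangent E z),
    IsOpen U ∧ SmoothFormOn α U ∧ (∀ z ∈ U ∩ S, α z ∈ conormalSet (E := E) S z) ∧
    JoinedByTrajectory (fun z ↦ P.sharp z (α z)) (U ∩ S) p q) x y}

/-- The orbit of `x` under the infinitesimal action whose fundamental vector fields are the
members of the family `V`: all points reached from `x` by finitely many trajectories of
fields in `V`. -/
def orbit (V : Set (∀ x : M, TangentSpace 𝓘(ℝ, E) x)) (x : M) : Set M :=
  {y | Relation.EqvGen (fun p q ↦ ∃ v ∈ V, JoinedByTrajectory v univ p q) x y}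

end Manifolds

section Groups

variable {E : Type*} [NormedAddCommGroup E] [NormedSpace ℝ E]
  {G : Type*} [TopologicalSpace G] [ChartedSpace E G] [Group G] [LieGroup 𝓘(ℝ, E) ∞ G]

/-- The tangent map `TₕG → T_{gh}G` of the left translation by `g`. -/
def leftT (E : Type*) [NormedAddCommGroup E] [NormedSpace ℝ E]
    {G : Type*} [TopologicalSpace G] [ChartedSpace E G] [Group G] (g h : G) :
    TangentSpace 𝓘(ℝ, E) h →L[ℝ] TangentSpace 𝓘(ℝ, E) (g * h) :=
  mfderiv 𝓘(ℝ, E) 𝓘(ℝ, E) (fun x ↦ g * x) h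

/-- The tangent map `T_gG → T_{gh}G` of the right translation by `h`. -/
def rightT (E : Type*) [NormedAddCommGroup E] [NormedSpace ℝ E]
    {G : Type*} [TopologicalSpace G] [ChartedSpace E G] [Group G] (g h : G) :
    TangentSpace 𝓘(ℝ, E) g →L[ℝ] TangentSpace 𝓘(ℝ, E) (g * h) :=
  mfderiv 𝓘(ℝ, E) 𝓘(ℝ, E) (fun x ↦ x * h) g

/-- The tangent map `T_gG → T_eG` of the right translation by `g⁻¹`. -/
def rightToOne (E : Type*) [NormedAddCommGroup E] [NormedSpace ℝ E]
    {G : Type*} [TopologicalSpace G] [ChartedSpace E G] [Group G] (g : G) :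
    TangentSpace 𝓘(ℝ, E) g →L[ℝ] TangentSpace 𝓘(ℝ, E) (1 : G) :=
  mfderiv 𝓘(ℝ, E) 𝓘(ℝ, E) (fun x ↦ x * g⁻¹) g

/-- The tangent map `T_gG → T_eG` of the left translation by `g⁻¹`. -/
def leftToOne (E : Type*) [NormedAddCommGroup E] [NormedSpace ℝ E]
    {G : Type*} [TopologicalSpace G] [ChartedSpace E G] [Group G] (g : G) :
    TangentSpace 𝓘(ℝ, E) g →L[ℝ] TangentSpace 𝓘(ℝ, E) (1 : G) :=
  mfderiv 𝓘(ℝ, E) 𝓘(ℝ, E) (fun x ↦ g⁻¹ * x) g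

/-- The covector `r*_{g⁻¹} ξ` at `g`, for `ξ` in the dual of the Lie algebra. -/
def rightCovector (ξ : Cotangent E (1 : G)) (g : G) : Cotangent E g :=
  ContinuousLinearMap.comp ξ (rightToOne E g)

/-- The covector `l*_{g⁻¹} ξ` at `g`, for `ξ` in the dual of the Lie algebra. -/
def leftCovector (ξ : Cotangent E (1 : G)) (g : G) : Cotangent E g :=
  ContinuousLinearMap.comp ξ (leftToOne E g)

/-- `(G, P)` is a Poisson Lie group: `P` is Poisson, and it is multiplicative,
`P(gh) = l_g P(h) + r_h P(g)`. -/
structure Bivector.IsPoissonLie (P : Bivector E G) : Prop where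
  isPoisson : P.IsPoisson
  multiplicative : ∀ (g h : G) (α : Cotangent E (g * h)),
    P.sharp (g * h) α = leftT E g h (P.sharp h (α.comp (leftT E g h)))
      + rightT E g h (P.sharp g (α.comp (rightT E g h)))

/-- The function `g ↦ ⟨r_{g⁻¹} P(g), ξ ∧ η⟩` on `G`, for `ξ`, `η` in the dual of the Lie
algebra. -/
def Bivector.rightTrivialized (P : Bivector E G) (ξ η : Cotangent E (1 : G)) (g : G) : ℝ :=
  rightCovector ξ g (P.sharp g (rightCovector η g))

/-- An element of the Lie algebra of a Lie group `Gs`, read as a linear form on `Lie G` through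
an identification `e` of `Lie Gs` with the dual of `Lie G`, and evaluated at `X`: it gives the
linear form on `Lie Gs` defined by `X ∈ Lie G`. -/
def evalAt {E' : Type*} [NormedAddCommGroup E'] [NormedSpace ℝ E']
    {Gs : Type*} [TopologicalSpace Gs] [ChartedSpace E' Gs] [Group Gs]
    (e : GroupLieAlgebra 𝓘(ℝ, E') Gs ≃L[ℝ] Cotangent E (1 : G)) (X : GroupLieAlgebra 𝓘(ℝ, E) G) :
    Cotangent E' (1 : Gs) where
  toFun ξ := e ξ X
  map_add' := by intro a b; simp
  map_smul' := by intro a b; simp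
  cont := by fun_prop

variable {E' : Type*} [NormedAddCommGroup E'] [NormedSpace ℝ E']
  {Gs : Type*} [TopologicalSpace Gs] [ChartedSpace E' Gs] [Group Gs] [LieGroup 𝓘(ℝ, E') ∞ Gs]

/-- The Poisson Lie group `(Gs, Ps)` is dual to `(G, P)` under the identification `e` of `Lie Gs`
with the dual of `Lie G`: the bracket of `Lie Gs` is the linearization of `P` at the unit of `G`,
and the bracket of `Lie G` is the linearization of `Ps` at the unit of `Gs`. -/
structure IsDual (P : Bivector E G) (Ps : Bivector E' Gs)
    (e : GroupLieAlgebra 𝓘(ℝ, E') Gs ≃L[ℝ] Cotangent E (1 : G)) : Prop where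
  bracket_dual : ∀ (ξ η : GroupLieAlgebra 𝓘(ℝ, E') Gs) (X : GroupLieAlgebra 𝓘(ℝ, E) G),
    e ⁅ξ, η⁆ X = mvfderiv 𝓘(ℝ, E) (P.rightTrivialized (e ξ) (e η)) 1 X
  bracket : ∀ (X Y : GroupLieAlgebra 𝓘(ℝ, E) G) (ξ : GroupLieAlgebra 𝓘(ℝ, E') Gs),
    e ξ ⁅X, Y⁆ = mvfderiv 𝓘(ℝ, E') (Ps.rightTrivialized (evalAt e X) (evalAt e Y)) 1 ξ

/-- The dressing vector field `S_X(γ) = Ps♯ (r*_{γ⁻¹} X)` on `Gs`, for `X ∈ Lie G`. -/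
def leftDressing (Ps : Bivector E' Gs)
    (e : GroupLieAlgebra 𝓘(ℝ, E') Gs ≃L[ℝ] Cotangent E (1 : G))
    (X : GroupLieAlgebra 𝓘(ℝ, E) G) (γ : Gs) : TangentSpace 𝓘(ℝ, E') γ :=
  Ps.sharp γ (rightCovector (evalAt e X) γ)

/-- The dressing vector field `S_ξ(g) = - P♯ (l*_{g⁻¹} ξ)` on `G`, for `ξ ∈ Lie Gs`. -/
def rightDressing (P : Bivector E G)
    (e : GroupLieAlgebra 𝓘(ℝ, E') Gs ≃L[ℝ] Cotangent E (1 : G))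
    (ξ : GroupLieAlgebra 𝓘(ℝ, E') Gs) (g : G) : TangentSpace 𝓘(ℝ, E) g :=
  -P.sharp g (leftCovector (e ξ) g)

/-- The Lie algebra of a subgroup that is an embedded submanifold: its tangent space at `1`. -/
def lieAlg (E : Type*) [NormedAddCommGroup E] [NormedSpace ℝ E]
    {G : Type*} [TopologicalSpace G] [ChartedSpace E G] [Group G] (H : Subgroup G) :
    Set (GroupLieAlgebra 𝓘(ℝ, E) G) :=
  tangentSet E (H : Set G) 1

/-- The annihilator `𝔥^⊥` in `Lie Gs` of a subset `𝔥` of `Lie G`. -/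
def annihilator (e : GroupLieAlgebra 𝓘(ℝ, E') Gs ≃L[ℝ] Cotangent E (1 : G))
    (𝔥 : Set (GroupLieAlgebra 𝓘(ℝ, E) G)) : Set (GroupLieAlgebra 𝓘(ℝ, E') Gs) :=
  {ξ | ∀ X ∈ 𝔥, e ξ X = 0}

/-- A connected closed Lie subgroup. -/
structure IsConnectedClosedLieSubgroup (E : Type*) [NormedAddCommGroup E] [NormedSpace ℝ E]
    {G : Type*} [TopologicalSpace G] [ChartedSpace E G] [Group G] (H : Subgroup G) : Prop where
  isEmbeddedSubmanifold : IsEmbeddedSubmanifold E (H : Set G)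
  isClosed : IsClosed (H : Set G)
  isConnected : IsConnected (H : Set G)

end Groups

end PoissonLie

end

open PoissonLie

namespace PoissonLie

noncomputable section

/-! Right translation identifies `T_γ H^⊥` with `𝔥^⊥`, so biduality in finite dimension shows that
`N*_γ H^⊥` consists of the covectors `r*_{γ⁻¹} X` with `X ∈ 𝔥`
(`DualSubgroups.mem_conormalSet_iff`). Hence the dressing fields of `𝔥` span `π♯(N*H^⊥)`, and
coisotropy and tangency both amount to the vanishing of `F_{X,Y}(γ) = ⟨X, r_{γ⁻¹} π♯(r*_{γ⁻¹} Y)⟩`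
for `X, Y ∈ 𝔥` and `γ ∈ H^⊥` (`DualSubgroups.rtriv_eq_zero`).

Multiplicativity makes `F` a cocycle, `F_{X,Y}(δx) = F_{X',Y'}(x) + F_{X,Y}(δ)` with `X' = X ∘
Ad_δ`, `Y' = Y ∘ Ad_δ`. By duality the differential of `F_{X,Y}` at the unit is `ξ ↦ ⟨ξ, [X, Y]⟩`,
which kills `𝔥^⊥` because `𝔥` is a subalgebra. For `δ ∈ H^⊥` the map `Ad_δ` preserves `𝔥^⊥`, so `X'`
and `Y'` are again in `𝔥`. Thus `F_{X,Y}` has zero differential along the connected `H^⊥`, and it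
vanishes at the unit. Invariance under integral curves is a Grönwall estimate on the coordinates
transverse to `H^⊥`, together with closedness (`IsEmbeddedSubmanifold.integralCurve_mem`).

Each `S_X` with `X ∈ 𝔥` is `π♯` of a conormal section, so orbits lie in leaves. Conversely, a
trajectory of `π♯ α` in `H^⊥` solves `c' = S_{f(t)}(c)` with `f` continuous in `𝔥`. The Jacobi
identity and multiplicativity give `[S_X, S_Y] = -S_{[X,Y]}`
(`DualSubgroups.mlieBracket_leftDressing`), so these fields form a finite-dimensional Lie algebra.
Near each time, `c(t)` is then the time-one point of an integral curve of a single field `S_{U(t)}`,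
where `U` solves a differential equation that inverts the derivative of the exponential
(`eventually_exists_integralCurve`). The argument is local and needs no completeness of the dressing
fields; connectedness of the time interval chains the pieces.

For a Poisson subgroup, skew-symmetry moves `π♯` onto the other covector: `⟨β, π♯(l*_{h⁻¹} ξ)⟩ =
-⟨ξ, l_{h⁻¹} π♯ β⟩`, which is zero since `π♯ β` is tangent to `H`. Integral curves are constant by
the invariance theorem applied to a point. -/

lemma three_le_infty : (3 : WithTop ℕ∞) ≤ ∞ :=
  WithTop.coe_le_coe.2 (le_top : (3 : ℕ∞) ≤ ⊤)

lemma two_le_infty : (2 : WithTop ℕ∞) ≤ ∞ :=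
  WithTop.coe_le_coe.2 (le_top : (2 : ℕ∞) ≤ ⊤)

/-! ### Tangent maps read in the model space. -/

section TangentMaps

variable {E : Type*} [NormedAddCommGroup E] [NormedSpace ℝ E]
  {M : Type*} [TopologicalSpace M] [ChartedSpace E M]
  {E' : Type*} [NormedAddCommGroup E'] [NormedSpace ℝ E']
  {M' : Type*} [TopologicalSpace M'] [ChartedSpace E' M']
  {E'' : Type*} [NormedAddCommGroup E''] [NormedSpace ℝ E'']
  {M'' : Type*} [TopologicalSpace M''] [ChartedSpace E'' M'']

/-- The tangent map of `f` at `x`, as a map between the model spaces. -/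
def tmap (E E' : Type*) [NormedAddCommGroup E] [NormedSpace ℝ E] [NormedAddCommGroup E']
    [NormedSpace ℝ E'] {M M' : Type*} [TopologicalSpace M] [ChartedSpace E M]
    [TopologicalSpace M'] [ChartedSpace E' M'] (f : M → M') (x : M) : E →L[ℝ] E' :=
  mfderiv 𝓘(ℝ, E) 𝓘(ℝ, E') f x

/-- Smoothness at a point of a map between manifolds. -/
abbrev SmoothAt (E E' : Type*) [NormedAddCommGroup E] [NormedSpace ℝ E] [NormedAddCommGroup E']
    [NormedSpace ℝ E'] {M M' : Type*} [TopologicalSpace M] [ChartedSpace E M]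
    [TopologicalSpace M'] [ChartedSpace E' M'] (f : M → M') (x : M) : Prop :=
  ContMDiffAt 𝓘(ℝ, E) 𝓘(ℝ, E') ∞ f x

lemma SmoothAt.mdiff {f : M → M'} {x : M} (h : SmoothAt E E' f x) :
    MDifferentiableAt 𝓘(ℝ, E) 𝓘(ℝ, E') f x :=
  h.mdifferentiableAt (by simp)

lemma SmoothAt.hasMFDerivAt {f : M → M'} {x : M} (h : SmoothAt E E' f x) :
    HasMFDerivAt 𝓘(ℝ, E) 𝓘(ℝ, E') f x (tmap E E' f x) :=
  h.mdiff.hasMFDerivAt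

lemma tmap_comp {g : M' → M''} {f : M → M'} {x : M} (hg : SmoothAt E' E'' g (f x))
    (hf : SmoothAt E E' f x) :
    tmap E E'' (g ∘ f) x = (tmap E' E'' g (f x)).comp (tmap E E' f x) :=
  mfderiv_comp x hg.mdiff hf.mdiff

lemma tmap_comp_apply {g : M' → M''} {f : M → M'} {x : M} (hg : SmoothAt E' E'' g (f x))
    (hf : SmoothAt E E' f x) (v : E) :
    tmap E E'' (fun y ↦ g (f y)) x v = tmap E' E'' g (f x) (tmap E E' f x v) := by
  have := tmap_comp hg hf
  exact congrArg (fun T : E →L[ℝ] E'' ↦ T v) this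

lemma tmap_congr {f g : M → M'} {x : M} (h : f =ᶠ[𝓝 x] g) :
    tmap E E' f x = tmap E E' g x :=
  h.mfderiv_eq

lemma tmap_id {x : M} : tmap E E (fun y : M ↦ y) x = ContinuousLinearMap.id ℝ E :=
  mfderiv_id

lemma tmap_eq_fderiv {f : E → E'} {x : E} : tmap E E' f x = fderiv ℝ f x :=
  mfderiv_eq_fderiv

end TangentMaps

/-! ### Vector fields and their brackets in charts. -/

section Charts

variable {E : Type*} [NormedAddCommGroup E] [NormedSpace ℝ E]
  {M : Type*} [TopologicalSpace M] [ChartedSpace E M]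
  {φ : OpenPartialHomeomorph M E}

lemma smoothAt_chart (hφ : φ ∈ IsManifold.maximalAtlas 𝓘(ℝ, E) ∞ M) {x : M} (hx : x ∈ φ.source) :
    SmoothAt E E φ x :=
  contMDiffAt_of_mem_maximalAtlas hφ hx

lemma smoothAt_chart_symm (hφ : φ ∈ IsManifold.maximalAtlas 𝓘(ℝ, E) ∞ M) {x : E}
    (hx : x ∈ φ.target) : SmoothAt E E φ.symm x :=
  contMDiffAt_symm_of_mem_maximalAtlas hφ hx

lemma tmap_symm_tmap (hφ : φ ∈ IsManifold.maximalAtlas 𝓘(ℝ, E) ∞ M) {x : M}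
    (hx : x ∈ φ.source) (v : E) : tmap E E φ.symm (φ x) (tmap E E φ x v) = v := by
  rw [← tmap_comp_apply (smoothAt_chart_symm hφ (φ.map_source hx)) (smoothAt_chart hφ hx),
    tmap_congr (g := fun y ↦ y), tmap_id]
  · rfl
  · filter_upwards [φ.open_source.mem_nhds hx] with y hy using φ.left_inv hy

lemma tmap_tmap_symm (hφ : φ ∈ IsManifold.maximalAtlas 𝓘(ℝ, E) ∞ M) {x : E}
    (hx : x ∈ φ.target) (v : E) : tmap E E φ (φ.symm x) (tmap E E φ.symm x v) = v := by
  rw [← tmap_comp_apply (smoothAt_chart hφ (φ.map_target hx)) (smoothAt_chart_symm hφ hx),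
    tmap_congr (g := fun y ↦ y), tmap_id]
  · rfl
  · filter_upwards [φ.open_target.mem_nhds hx] with y hy using φ.right_inv hy

lemma isInvertible_tmap_symm (hφ : φ ∈ IsManifold.maximalAtlas 𝓘(ℝ, E) ∞ M) {x : E}
    (hx : x ∈ φ.target) :
    (tmap E E φ.symm x).inverse = tmap E E φ (φ.symm x) ∧ (tmap E E φ.symm x).IsInvertible := by
  have h1 : (tmap E E φ.symm x).comp (tmap E E φ (φ.symm x)) = .id ℝ E := by
    ext v
    have := tmap_symm_tmap hφ (φ.map_target hx) v
    rw [φ.right_inv hx] at this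
    exact this
  have h2 : (tmap E E φ (φ.symm x)).comp (tmap E E φ.symm x) = .id ℝ E := by
    ext v; exact tmap_tmap_symm hφ hx v
  exact ⟨ContinuousLinearMap.inverse_eq h1 h2, ContinuousLinearMap.IsInvertible.of_inverse h1 h2⟩

/-- The expression of a vector field in a chart. -/
def chartField (φ : OpenPartialHomeomorph M E) (v : M → E) (x : E) : E :=
  tmap E E φ (φ.symm x) (v (φ.symm x))

/-- Smoothness at a point of a vector field. -/
def SmoothFieldAt (v : ∀ x : M, TangentSpace 𝓘(ℝ, E) x) (x : M) [IsManifold 𝓘(ℝ, E) ∞ M] : Prop :=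
  ContMDiffAt 𝓘(ℝ, E) (𝓘(ℝ, E).prod 𝓘(ℝ, E)) ∞
    (fun x : M ↦ (⟨x, v x⟩ : TangentBundle 𝓘(ℝ, E) M)) x

lemma chartField_eq_mpullback (hφ : φ ∈ IsManifold.maximalAtlas 𝓘(ℝ, E) ∞ M)
    (v : ∀ x : M, TangentSpace 𝓘(ℝ, E) x) {x : E} (hx : x ∈ φ.target) :
    chartField φ v x = VectorField.mpullback 𝓘(ℝ, E) 𝓘(ℝ, E) φ.symm v x := by
  rw [VectorField.mpullback_apply]
  exact congrArg (fun T : E →L[ℝ] E ↦ T (v (φ.symm x))) (isInvertible_tmap_symm hφ hx).1.symm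

variable [IsManifold 𝓘(ℝ, E) ∞ M]

/-- The order `m` is left free because left-invariant fields enter with smoothness `minSmoothness ℝ
2` only. -/
lemma contDiffAt_chartField [CompleteSpace E]
    (hφ : φ ∈ IsManifold.maximalAtlas 𝓘(ℝ, E) ∞ M)
    {v : ∀ x : M, TangentSpace 𝓘(ℝ, E) x} {x : E} (hx : x ∈ φ.target) {m : WithTop ℕ∞}
    (hm : m + 1 ≤ ∞) (hv : ContMDiffAt 𝓘(ℝ, E) (𝓘(ℝ, E).prod 𝓘(ℝ, E)) m
      (fun x : M ↦ (⟨x, v x⟩ : TangentBundle 𝓘(ℝ, E) M)) (φ.symm x)) :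
    ContDiffAt ℝ m (chartField φ v) x := by
  have h1 := ContMDiffAt.mpullback_vectorField_preimage (n := ∞) (m := m) hv
    (smoothAt_chart_symm hφ hx) (isInvertible_tmap_symm hφ hx).2 hm
  have h2 := contMDiffAt_vectorSpace_iff_contDiffAt.1 h1
  refine h2.congr_of_eventuallyEq ?_
  filter_upwards [φ.open_target.mem_nhds hx] with y hy using chartField_eq_mpullback hφ v hy

lemma SmoothFieldAt.contDiffAt_chartField [CompleteSpace E]
    (hφ : φ ∈ IsManifold.maximalAtlas 𝓘(ℝ, E) ∞ M)
    {v : ∀ x : M, TangentSpace 𝓘(ℝ, E) x} {x : E} (hx : x ∈ φ.target)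
    (hv : SmoothFieldAt v (φ.symm x)) : ContDiffAt ℝ ∞ (chartField φ v) x :=
  PoissonLie.contDiffAt_chartField hφ hx (by simp) hv

/-- Naturality of the bracket under pullback along `φ.symm`. It reduces brackets on the manifold to
differential calculus in the model space. -/
lemma lieBracket_chartField [CompleteSpace E]
    (hφ : φ ∈ IsManifold.maximalAtlas 𝓘(ℝ, E) ∞ M)
    {v w : ∀ x : M, TangentSpace 𝓘(ℝ, E) x} {x : E} (hx : x ∈ φ.target)
    (hv : MDifferentiableAt 𝓘(ℝ, E) 𝓘(ℝ, E).tangent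
      (fun x : M ↦ (⟨x, v x⟩ : TangentBundle 𝓘(ℝ, E) M)) (φ.symm x))
    (hw : MDifferentiableAt 𝓘(ℝ, E) 𝓘(ℝ, E).tangent
      (fun x : M ↦ (⟨x, w x⟩ : TangentBundle 𝓘(ℝ, E) M)) (φ.symm x)) :
    VectorField.lieBracket ℝ (chartField φ v) (chartField φ w) x =
      chartField φ (VectorField.mlieBracket 𝓘(ℝ, E) v w) x := by
  have hev : ∀ v : ∀ x : M, TangentSpace 𝓘(ℝ, E) x,
      chartField φ v =ᶠ[𝓝 x] VectorField.mpullback 𝓘(ℝ, E) 𝓘(ℝ, E) φ.symm v := fun v ↦ by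
    filter_upwards [φ.open_target.mem_nhds hx] with y hy using chartField_eq_mpullback hφ v hy
  have h3 : IsManifold 𝓘(ℝ, E) (minSmoothness ℝ 3) M :=
    IsManifold.of_le (n := ∞) (by simpa using three_le_infty)
  rw [chartField_eq_mpullback hφ _ hx,
    VectorField.mpullback_mlieBracket (n := ∞) hv hw (smoothAt_chart_symm hφ hx)
      (by simpa using two_le_infty),
    ← VectorField.mlieBracketWithin_univ, VectorField.mlieBracketWithin_eq_lieBracketWithin]
  refine ((hev v).lieBracket_vectorField_eq (hev w)).trans ?_
  exact (congrFun VectorField.lieBracketWithin_univ x).symm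

lemma SmoothFieldAt.mdifferentiableAt {v : ∀ x : M, TangentSpace 𝓘(ℝ, E) x} {x : M}
    (hv : SmoothFieldAt v x) : MDifferentiableAt 𝓘(ℝ, E) 𝓘(ℝ, E).tangent
      (fun x : M ↦ (⟨x, v x⟩ : TangentBundle 𝓘(ℝ, E) M)) x :=
  ContMDiffAt.mdifferentiableAt hv (by simp)

end Charts

/-! ### Tangent spaces of embedded submanifolds. -/

section Submanifolds

variable {E : Type*} [NormedAddCommGroup E] [NormedSpace ℝ E]
  {M : Type*} [TopologicalSpace M] [ChartedSpace E M]
  {E' : Type*} [NormedAddCommGroup E'] [NormedSpace ℝ E']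
  {M' : Type*} [TopologicalSpace M'] [ChartedSpace E' M']
  {φ : OpenPartialHomeomorph M E}

/-- The tangent space of a submanifold, as a subset of the model space. -/
def tanSet (E : Type*) [NormedAddCommGroup E] [NormedSpace ℝ E]
    {M : Type*} [TopologicalSpace M] [ChartedSpace E M] (S : Set M) (x : M) : Set E :=
  tangentSet E S x

lemma mem_tanSet_iff_exists {S : Set M} {x : M} {v : E} :
    v ∈ tanSet E S x ↔ ∃ c : ℝ → M, SmoothAt ℝ E c 0 ∧ (∀ᶠ t in 𝓝 (0 : ℝ), c t ∈ S) ∧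
      c 0 = x ∧ tmap ℝ E c 0 1 = v := by
  constructor
  · rintro ⟨c, h1, h2, h3⟩
    have h4 := (Bundle.TotalSpace.mk.injEq (F := E) (E := TangentSpace 𝓘(ℝ, E) (M := M)) ..).mp h3
    exact ⟨c, h1, h2, h4.1, eq_of_heq (α := E) h4.2⟩
  · rintro ⟨c, h1, h2, rfl, h4⟩
    refine ⟨c, h1, h2, ?_⟩
    rw [← h4]
    rfl

lemma tmap_mem_tanSet {S : Set M} {S' : Set M'} {f : M → M'} {x : M}
    (hf : SmoothAt E E' f x) (hS : ∀ᶠ y in 𝓝 x, y ∈ S → f y ∈ S')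
    {v : E} (hv : v ∈ tanSet E S x) : tmap E E' f x v ∈ tanSet E' S' (f x) := by
  obtain ⟨c, h1, h2, rfl, h4⟩ := mem_tanSet_iff_exists.1 hv
  refine mem_tanSet_iff_exists.2 ⟨fun t ↦ f (c t), ContMDiffAt.comp 0 hf h1, ?_, rfl, ?_⟩
  · filter_upwards [h2, h1.continuousAt.eventually hS] with t ht ht' using ht' ht
  · rw [tmap_comp_apply hf h1, h4]

/-- A linear projection along a subspace of a finite-dimensional space. -/
lemma exists_ker_eq_of_finiteDimensional [FiniteDimensional ℝ E] (W : Submodule ℝ E) :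
    ∃ q : E →L[ℝ] E, (∀ x, q x = 0 ↔ x ∈ W) ∧ ∀ x, x - q x ∈ W := by
  obtain ⟨p, hp⟩ := W.subtype.exists_leftInverse_of_injective W.ker_subtype
  have hp' : ∀ w : W, p w = w := fun w ↦ LinearMap.congr_fun hp w
  refine ⟨LinearMap.toContinuousLinearMap (LinearMap.id - W.subtype ∘ₗ p), fun x ↦ ?_, fun x ↦ ?_⟩
  · constructor
    · intro h
      have : x = p x := by simpa [sub_eq_zero] using h
      rw [this]; exact (p x).2
    · intro h
      have := hp' ⟨x, h⟩
      simp at this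
      simp [this]
  · simp

lemma HasDerivWithinAt.mem_submodule [FiniteDimensional ℝ E] {W : Submodule ℝ E} {g : ℝ → E}
    {g' : E} {t : ℝ} (h : HasDerivAt g g' t) (hW : ∀ᶠ s in 𝓝 t, g s ∈ W) : g' ∈ W := by
  obtain ⟨q, hq, -⟩ := exists_ker_eq_of_finiteDimensional W
  have h1 : HasDerivAt (fun s ↦ q (g s)) (q g') t := q.hasFDerivAt.comp_hasDerivAt t h
  have h2 : HasDerivAt (fun s ↦ q (g s)) 0 t :=
    (hasDerivAt_const t (0 : E)).congr_of_eventuallyEq (by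
      filter_upwards [hW] with s hs using (hq _).2 hs)
  exact (hq _).1 (h1.unique h2)

lemma hasDerivAt_tmap {c : ℝ → E} {t : ℝ} (h : SmoothAt ℝ E c t) :
    HasDerivAt c (tmap ℝ E c t 1) t := by
  rw [tmap_eq_fderiv]
  exact (h.mdiff.differentiableAt).hasFDerivAt.hasDerivAt

/-- A curve in `S` has its chart image in `W`, and a finite-dimensional `W` contains the velocities
of such curves. Conversely, a direction in `W` is the velocity of a straight line in the chart. -/
lemma mem_tanSet_iff [FiniteDimensional ℝ E] (hφ : φ ∈ IsManifold.maximalAtlas 𝓘(ℝ, E) ∞ M)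
    {S : Set M} {W : Submodule ℝ E} (hW : ∀ y ∈ φ.source, y ∈ S ↔ φ y ∈ W) {x : M}
    (hx : x ∈ φ.source) (hxS : x ∈ S) {v : E} :
    v ∈ tanSet E S x ↔ tmap E E φ x v ∈ W := by
  constructor
  · intro hv
    obtain ⟨c, h1, h2, rfl, h4⟩ := mem_tanSet_iff_exists.1 hv
    have h5 : SmoothAt ℝ E (fun t ↦ φ (c t)) 0 := ContMDiffAt.comp 0 (smoothAt_chart hφ hx) h1
    have h6 := hasDerivAt_tmap h5
    rw [tmap_comp_apply (smoothAt_chart hφ hx) h1, h4] at h6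
    refine HasDerivWithinAt.mem_submodule h6 ?_
    filter_upwards [h2, h1.continuousAt.preimage_mem_nhds (φ.open_source.mem_nhds hx)] with t ht ht'
    exact (hW _ ht').1 ht
  · intro hv
    set w := tmap E E φ x v with hw
    have h0 : φ x + (0 : ℝ) • w = φ x := by simp
    have hc : SmoothAt ℝ E (fun t : ℝ ↦ φ x + t • w) 0 :=
      ContDiffAt.contMDiffAt (by fun_prop)
    have ht : φ x + (0 : ℝ) • w ∈ φ.target := by rw [h0]; exact φ.map_source hx
    refine mem_tanSet_iff_exists.2 ⟨fun t ↦ φ.symm (φ x + t • w),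
      ContMDiffAt.comp (0 : ℝ) (smoothAt_chart_symm hφ ht) hc, ?_, ?_, ?_⟩
    · filter_upwards [hc.continuousAt.preimage_mem_nhds (φ.open_target.mem_nhds ht)] with t ht
      rw [hW _ (φ.map_target ht), φ.right_inv ht]
      exact W.add_mem ((hW _ hx).1 hxS) (W.smul_mem _ hv)
    · simp [φ.left_inv hx]
    · rw [tmap_comp_apply (f := fun t : ℝ ↦ φ x + t • w) (smoothAt_chart_symm hφ ht) hc]
      have h1 : tmap ℝ E (fun t : ℝ ↦ φ x + t • w) 0 1 = w := by
        rw [tmap_eq_fderiv]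
        have : HasDerivAt (fun t : ℝ ↦ φ x + t • w) w 0 := by
          simpa using ((hasDerivAt_id (0 : ℝ)).smul_const w).const_add (φ x)
        simpa using this.deriv
      rw [h1, h0, hw, tmap_symm_tmap hφ hx]

/-- The tangent space of an embedded submanifold is a linear subspace. -/
lemma exists_submodule_eq_tanSet [FiniteDimensional ℝ E] {S : Set M}
    (hS : IsEmbeddedSubmanifold E S) {x : M} (hx : x ∈ S) :
    ∃ T : Submodule ℝ E, ∀ v : E, v ∈ tanSet E S x ↔ v ∈ T := by
  obtain ⟨φ, hφ, hxφ, W, hW⟩ := hS x hx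
  refine ⟨W.comap (tmap E E φ x).toLinearMap, fun v ↦ ?_⟩
  rw [mem_tanSet_iff hφ hW hxφ hx]
  rfl

/-- A smooth function whose differential vanishes on the tangent spaces of a connected embedded
submanifold is constant on it. -/
lemma eq_of_tmap_eq_zero_of_isPreconnected [FiniteDimensional ℝ E] {S : Set M}
    (hS : IsEmbeddedSubmanifold E S) (hSc : IsPreconnected S) {F : M → ℝ}
    (hF : ∀ x ∈ S, SmoothAt E ℝ F x)
    (hd : ∀ x ∈ S, ∀ v ∈ tanSet E S x, tmap E ℝ F x v = 0)
    {x y : M} (hx : x ∈ S) (hy : y ∈ S) : F x = F y := by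
  have hloc : IsLocallyConstant (fun z : S ↦ F z) := by
    rw [IsLocallyConstant.iff_eventually_eq]
    rintro ⟨z, hz⟩
    obtain ⟨φ, hφ, hzφ, W, hW⟩ := hS z hz
    obtain ⟨r, hr, hball⟩ := Metric.isOpen_iff.1 φ.open_target (φ z) (φ.map_source hzφ)
    have hev : ∀ᶠ y in 𝓝 z, y ∈ φ.source ∧ φ y ∈ Metric.ball (φ z) r := by
      filter_upwards [φ.open_source.mem_nhds hzφ,
        (φ.continuousAt hzφ).preimage_mem_nhds (Metric.ball_mem_nhds _ hr)] with y h1 h2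
      exact ⟨h1, h2⟩
    filter_upwards [continuous_subtype_val.continuousAt.eventually hev] with y hy
    obtain ⟨hyφ, hyb⟩ := hy
    have hyW := (hW _ hyφ).1 y.2
    have hzW := (hW _ hzφ).1 hz
    set w := φ y - φ z with hw
    have hwW : w ∈ W := W.sub_mem hyW hzW
    -- The ball keeps the segment from `φ z` to `φ y` inside the chart, and `W` keeps it inside `S`,
    -- so `F` has zero derivative along it.
    have key : ∀ t ∈ Icc (0 : ℝ) 1,
        HasDerivAt (fun t : ℝ ↦ F (φ.symm (φ z + t • w))) 0 t := by
      intro t ht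
      have h1 : φ z + t • w ∈ Metric.ball (φ z) r := by
        rw [mem_ball_iff_norm] at hyb ⊢
        rw [add_sub_cancel_left, norm_smul, Real.norm_of_nonneg ht.1]
        calc t * ‖w‖ ≤ 1 * ‖w‖ := by gcongr; exact ht.2
          _ < r := by rwa [one_mul]
      have h2 := hball h1
      have h3 : φ.symm (φ z + t • w) ∈ S := by
        rw [hW _ (φ.map_target h2), φ.right_inv h2]
        exact W.add_mem hzW (W.smul_mem _ hwW)
      have hc : HasDerivAt (fun t : ℝ ↦ φ z + t • w) w t := by
        simpa using ((hasDerivAt_id t).smul_const w).const_add (φ z)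
      have h4 : SmoothAt E ℝ (fun y ↦ F (φ.symm y)) (φ z + t • w) :=
        ContMDiffAt.comp _ (hF _ h3) (smoothAt_chart_symm hφ h2)
      have h5 := (h4.mdiff.differentiableAt).hasFDerivAt.comp_hasDerivAt t hc
      rw [← tmap_eq_fderiv, tmap_comp_apply (hF _ h3) (smoothAt_chart_symm hφ h2), hd _ h3] at h5
      · exact h5
      · rw [mem_tanSet_iff hφ hW (φ.map_target h2) h3, tmap_tmap_symm hφ h2]
        exact hwW
    have h6 : ∀ t ∈ Icc (0 : ℝ) 1, F (φ.symm (φ z + t • w)) = F (φ.symm (φ z + (0 : ℝ) • w)) :=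
      constant_of_has_deriv_right_zero
        (fun t ht ↦ (key t ht).continuousAt.continuousWithinAt)
        (fun t ht ↦ (key t (Ico_subset_Icc_self ht)).hasDerivWithinAt)
    have := h6 1 (by simp)
    simpa [hw, φ.left_inv hyφ, φ.left_inv hzφ] using this
  have := Subtype.preconnectedSpace hSc
  exact hloc.apply_eq_of_preconnectedSpace ⟨x, hx⟩ ⟨y, hy⟩

end Submanifolds

/-! ### Integral curves of fields tangent to a closed submanifold. -/

section Invariance

lemma eq_zero_of_norm_deriv_le_mul_norm_aux {F : Type*} [NormedAddCommGroup F] [NormedSpace ℝ F]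
    {J : Set ℝ} (hJ : J.OrdConnected) {g g' : ℝ → F} {K : ℝ}
    (hg : ∀ s ∈ J, HasDerivWithinAt g (g' s) J s) (bound : ∀ s ∈ J, ‖g' s‖ ≤ K * ‖g s‖)
    {t : ℝ} (ht : t ∈ J) (h0 : g t = 0) {s : ℝ} (hs : s ∈ J) (hts : t ≤ s) : g s = 0 := by
  have hsub : Icc t s ⊆ J := hJ.out ht hs
  refine eq_zero_of_abs_deriv_le_mul_abs_self_of_eq_zero_right (f := g) (f' := g') (K := K)
    (a := t) (b := s) (fun x hx ↦ ((hg x (hsub hx)).continuousWithinAt).mono hsub)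
    (fun x hx ↦ ?_) h0 (fun x hx ↦ bound x (hsub (Ico_subset_Icc_self hx))) s ⟨hts, le_rfl⟩
  refine (hg x (hsub (Ico_subset_Icc_self hx))).mono_of_mem_nhdsWithin ?_
  exact mem_of_superset (Icc_mem_nhdsGE hx.2) ((Icc_subset_Icc_left hx.1).trans hsub)

/-- Grönwall forward in time; the backward half follows by reversing time. -/
lemma eq_zero_of_norm_deriv_le_mul_norm {F : Type*} [NormedAddCommGroup F] [NormedSpace ℝ F]
    {J : Set ℝ} (hJ : J.OrdConnected) {g g' : ℝ → F} {K : ℝ}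
    (hg : ∀ s ∈ J, HasDerivWithinAt g (g' s) J s) (bound : ∀ s ∈ J, ‖g' s‖ ≤ K * ‖g s‖)
    {t : ℝ} (ht : t ∈ J) (h0 : g t = 0) {s : ℝ} (hs : s ∈ J) : g s = 0 := by
  rcases le_total t s with h | h
  · exact eq_zero_of_norm_deriv_le_mul_norm_aux hJ hg bound ht h0 hs h
  · have hJ' : (Neg.neg ⁻¹' J).OrdConnected :=
      ⟨fun x hx y hy z hz ↦ hJ.out hy hx ⟨neg_le_neg hz.2, neg_le_neg hz.1⟩⟩
    have := eq_zero_of_norm_deriv_le_mul_norm_aux (K := K) hJ' (g := fun x ↦ g (-x))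
      (g' := fun x ↦ -g' (-x)) (t := -t) (s := -s) (fun x hx ↦ ?_)
      (fun x hx ↦ by simpa using bound (-x) hx) (by simpa using ht) (by simpa using h0)
      (by simpa using hs) (neg_le_neg h)
    · simpa using this
    · have := (hg (-x) hx).scomp x ((hasDerivAt_neg x).hasDerivWithinAt (s := Neg.neg ⁻¹' J))
        (fun y hy ↦ hy)
      simpa [Function.comp_def] using this

variable {E : Type*} [NormedAddCommGroup E] [NormedSpace ℝ E]
  {M : Type*} [TopologicalSpace M] [ChartedSpace E M]

lemma IsMIntegralCurveOn.hasDerivWithinAt_chart {φ : OpenPartialHomeomorph M E}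
    (hφ : φ ∈ IsManifold.maximalAtlas 𝓘(ℝ, E) ∞ M) {v : ∀ x : M, TangentSpace 𝓘(ℝ, E) x}
    {c : ℝ → M} {J : Set ℝ} (hc : IsMIntegralCurveOn c v J) {t : ℝ} (ht : t ∈ J)
    (hct : c t ∈ φ.source) :
    HasDerivWithinAt (fun s ↦ φ (c s)) (chartField φ v (φ (c t))) J t := by
  have h1 := (smoothAt_chart hφ hct).hasMFDerivAt.comp_hasMFDerivWithinAt t (hc t ht)
  have h2 : HasFDerivWithinAt (fun s ↦ φ (c s)) ((tmap E E φ (c t)).comp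
      ((1 : ℝ →L[ℝ] ℝ).smulRight (v (c t) : E))) J t := h1.hasFDerivWithinAt
  have h3 : chartField φ v (φ (c t)) = (tmap E E φ (c t)).comp
      ((1 : ℝ →L[ℝ] ℝ).smulRight (v (c t) : E)) 1 := by
    have h4 : ∀ u : E, (1 : ℝ →L[ℝ] ℝ).smulRight u 1 = u := fun u ↦ by simp
    change tmap E E φ (φ.symm (φ (c t))) (v (φ.symm (φ (c t)))) = tmap E E φ (c t) _
    rw [φ.left_inv hct]
    exact congrArg (tmap E E φ (c t)) (h4 (v (c t))).symm
  rw [h3]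
  exact h2.hasDerivWithinAt

/-- An integral curve of a smooth vector field which is tangent to a closed embedded submanifold
stays in the submanifold. -/
theorem IsEmbeddedSubmanifold.integralCurve_mem [FiniteDimensional ℝ E] [IsManifold 𝓘(ℝ, E) ∞ M]
    {S : Set M} (hS : IsEmbeddedSubmanifold E S) (hScl : IsClosed S)
    {v : ∀ x : M, TangentSpace 𝓘(ℝ, E) x} (hv : ∀ x ∈ S, SmoothFieldAt v x)
    (hvS : ∀ x ∈ S, v x ∈ tangentSet E S x) {c : ℝ → M} {J : Set ℝ} (hJ : J.OrdConnected)
    (hc : IsMIntegralCurveOn c v J) {t₀ : ℝ} (ht₀ : t₀ ∈ J) (h0 : c t₀ ∈ S) {t : ℝ} (ht : t ∈ J) :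
    c t ∈ S := by
  have : CompleteSpace E := FiniteDimensional.complete ℝ E
  have hloc : ∀ t ∈ J, c t ∈ S → ∀ᶠ s in 𝓝[J] t, c s ∈ S := by
    intro t ht hct
    obtain ⟨φ, hφ, hxφ, W, hW⟩ := hS _ hct
    obtain ⟨q, hq, hq'⟩ := exists_ker_eq_of_finiteDimensional W
    have hy := φ.map_source hxφ
    have h1 : ContDiffAt ℝ ∞ (chartField φ v) (φ (c t)) :=
      SmoothFieldAt.contDiffAt_chartField hφ hy (by rw [φ.left_inv hxφ]; exact hv _ hct)
    obtain ⟨K, B, hB, hK⟩ := (h1.of_le (by simp : (1 : WithTop ℕ∞) ≤ ∞)).exists_lipschitzOnWith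
    -- The map `y ↦ y - q y` is a projection onto `W`. It fixes `φ (c t)`, so nearby points project
    -- to points where the Lipschitz bound still holds.
    have hproj : Tendsto (fun y ↦ y - q y) (𝓝 (φ (c t))) (𝓝 (φ (c t))) := by
      have : ContinuousAt (fun y ↦ y - q y) (φ (c t)) := by fun_prop
      simpa [ContinuousAt, (hq _).2 ((hW _ hxφ).1 hct)] using this
    have h2 : ∀ᶠ y in 𝓝 (φ (c t)), y ∈ B ∧ y - q y ∈ B ∧ y - q y ∈ φ.target := by
      filter_upwards [hB, hproj hB, hproj (φ.open_target.mem_nhds hy)] with y h1 h2 h3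
      exact ⟨h1, h2, h3⟩
    have h3 : ∀ᶠ s in 𝓝[J] t, c s ∈ φ.source ∧ φ (c s) ∈ B ∧ φ (c s) - q (φ (c s)) ∈ B ∧
        φ (c s) - q (φ (c s)) ∈ φ.target := by
      have h4 : ContinuousWithinAt c J t := hc.continuousWithinAt ht
      filter_upwards [h4 (φ.open_source.mem_nhds hxφ),
        ((φ.continuousAt hxφ).comp_continuousWithinAt h4).eventually h2] with s h5 h6
      exact ⟨h5, h6⟩
    obtain ⟨δ, hδ, hball⟩ := Metric.mem_nhdsWithin_iff.1 h3
    set J' := Metric.ball t δ ∩ J with hJ'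
    have hJ'c : J'.OrdConnected := by
      rw [hJ', Real.ball_eq_Ioo]
      exact ordConnected_Ioo.inter hJ
    have h7 : ∀ s ∈ J', q (φ (c s)) = 0 := by
      intro s hs
      refine eq_zero_of_norm_deriv_le_mul_norm (K := ‖q‖ * K) hJ'c (g := fun s ↦ q (φ (c s)))
        (g' := fun s ↦ q (chartField φ v (φ (c s)))) (fun s hs ↦ ?_) (fun s hs ↦ ?_)
        (t := t) ⟨Metric.mem_ball_self hδ, ht⟩ ((hq _).2 ((hW _ hxφ).1 hct)) hs
      · exact q.hasFDerivAt.comp_hasDerivWithinAt s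
          ((hc.hasDerivWithinAt_chart hφ hs.2 (hball hs).1).mono inter_subset_right)
      · obtain ⟨h8, h9, h10, h11⟩ := hball hs
        have h12 : φ.symm (φ (c s) - q (φ (c s))) ∈ S := by
          rw [hW _ (φ.map_target h11), φ.right_inv h11]; exact hq' _
        have h13 : chartField φ v (φ (c s) - q (φ (c s))) ∈ W :=
          (mem_tanSet_iff hφ hW (φ.map_target h11) h12).1 (hvS _ h12)
        -- The field is tangent to `S` at the projected point, so `q` kills it there. Subtracting it
        -- bounds the transverse component of the field by the transverse distance `‖q (φ (c s))‖`.
        have h14 : q (chartField φ v (φ (c s))) =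
            q (chartField φ v (φ (c s)) - chartField φ v (φ (c s) - q (φ (c s)))) := by
          rw [map_sub, (hq _).2 h13, sub_zero]
        have h15 := hK.norm_sub_le h9 h10
        rw [sub_sub_cancel] at h15
        rw [h14, mul_assoc]
        exact (q.le_opNorm _).trans (by gcongr)
    filter_upwards [inter_mem_nhdsWithin J (Metric.ball_mem_nhds t hδ)] with s hs
    exact (hW _ (hball hs.symm).1).2 ((hq _).1 (h7 s hs.symm))
  have := Subtype.preconnectedSpace hJ.isPreconnected
  -- The times at which `c` is in `S` form a closed set because `S` is closed, and an open one by
  -- `hloc`; the time interval is connected.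
  have hclopen : IsClopen {s : J | c s ∈ S} := by
    refine ⟨hScl.preimage (continuousOn_iff_continuous_domRestrict.1 hc.continuousOn), ?_⟩
    rw [isOpen_iff_mem_nhds]
    rintro ⟨s, hs⟩ hsS
    rw [mem_nhds_subtype_iff_nhdsWithin]
    filter_upwards [hloc s hs hsS, self_mem_nhdsWithin] with r hr hrJ
    exact ⟨⟨r, hrJ⟩, hr, rfl⟩
  have := hclopen.eq_univ ⟨⟨t₀, ht₀⟩, h0⟩
  exact (this ▸ mem_univ (⟨t, ht⟩ : J) : (⟨t, ht⟩ : J) ∈ {s : J | c s ∈ S})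

/-- A chart recentred at the point carries it to the zero subspace. This makes uniqueness at a
stationary point a case of the invariance theorem. -/
lemma isEmbeddedSubmanifold_singleton [IsManifold 𝓘(ℝ, E) ∞ M] (p : M) :
    IsEmbeddedSubmanifold E ({p} : Set M) := by
  intro x hx
  obtain rfl : x = p := hx
  set ψ := chartAt E x with hψdef
  have hψ : ψ ∈ IsManifold.maximalAtlas 𝓘(ℝ, E) ∞ M := IsManifold.chart_mem_maximalAtlas x
  let τ := (Homeomorph.addRight (-ψ x)).toOpenPartialHomeomorph
  have hτ : ∀ z, (Homeomorph.addRight (-ψ x)).symm z = z + ψ x := fun z ↦ by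
    simp [Homeomorph.addRight]
  refine ⟨ψ.trans τ, ?_, by simp [τ, hψdef], ⊥, fun y hy ↦ ?_⟩
  · refine OpenPartialHomeomorph.mem_maximalAtlas_of_contMDiffOn _ (fun y hy ↦ ?_) (fun y hy ↦ ?_)
    · have hy' : y ∈ ψ.source := by simpa [τ] using hy
      have h1 : SmoothAt E E (fun z : E ↦ z + -ψ x) (ψ y) := ContDiffAt.contMDiffAt (by fun_prop)
      exact (ContMDiffAt.comp y h1 (smoothAt_chart hψ hy')).contMDiffWithinAt
    · have hy' : y + ψ x ∈ ψ.target := by simpa [τ, hτ] using hy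
      have h1 : SmoothAt E E (fun z : E ↦ z + ψ x) y := ContDiffAt.contMDiffAt (by fun_prop)
      have h2 : SmoothAt E E (fun z : E ↦ ψ.symm (z + ψ x)) y :=
        ContMDiffAt.comp y (smoothAt_chart_symm hψ hy') h1
      refine ContMDiffAt.contMDiffWithinAt (h2.congr_of_eventuallyEq (.of_eq ?_))
      funext z
      simp [τ, hτ]
  · have hy' : y ∈ ψ.source := by simpa [τ] using hy
    have : ψ y = ψ x ↔ y = x :=
      ψ.injOn.eq_iff hy' (mem_chart_source E x)
    simp [τ, ← this, add_neg_eq_zero]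

end Invariance

/-! ### Smooth forms, translations and multiplicative bivector fields. -/

section

variable {E : Type*} [NormedAddCommGroup E] [NormedSpace ℝ E]
  {M : Type*} [TopologicalSpace M] [ChartedSpace E M] [IsManifold 𝓘(ℝ, E) ∞ M]

/-- Smoothness at a point of a differential 1-form. -/
def SmoothFormAt (α : ∀ x : M, Cotangent E x) (x : M) : Prop :=
  ContMDiffAt 𝓘(ℝ, E) (𝓘(ℝ, E).prod 𝓘(ℝ, E →L[ℝ] ℝ)) ∞
    (fun x : M ↦ Bundle.TotalSpace.mk' (E →L[ℝ] ℝ)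
      (E := fun x : M ↦ TangentSpace 𝓘(ℝ, E) x →L[ℝ] ℝ) x (α x)) x

/-- Translated covectors are differentials of functions that themselves depend on the base point,
such as `y ↦ h (y * x⁻¹)` at `y = x`; joint smoothness in both variables then suffices. -/
lemma smoothFormAt_of_param {f : M → M → ℝ} {x₀ : M}
    (hf : ContMDiffAt (𝓘(ℝ, E).prod 𝓘(ℝ, E)) 𝓘(ℝ, ℝ) ∞ (Function.uncurry f) (x₀, x₀)) :
    SmoothFormAt (fun x ↦ (tmap E ℝ (f x) x : E →L[ℝ] ℝ)) x₀ := by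
  have h := ContMDiffAt.mfderiv (m := ∞) f id hf contMDiffAt_id (by simp)
  refine (contMDiffAt_hom_bundle _).2 ⟨contMDiffAt_id, ?_⟩
  refine h.congr_of_eventuallyEq (.of_eq ?_)
  funext x
  ext v
  simp only [inTangentCoordinates, ContinuousLinearMap.inCoordinates]
  have h1 : ∀ w : ℝ, (trivializationAt ℝ (fun _ : M ↦ ℝ) x₀).continuousLinearMapAt ℝ x w = w :=
    fun w ↦ congrArg (fun T : ℝ →L[ℝ] ℝ ↦ T w)
      (Bundle.Trivial.continuousLinearMapAt_trivialization ℝ M ℝ x)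
  have h2 : ∀ w : ℝ, (trivializationAt ℝ (TangentSpace 𝓘(ℝ, ℝ)) (f x₀ x₀)).continuousLinearMapAt ℝ
      (f x x) w = w :=
    fun w ↦ congrArg (fun T : ℝ →L[ℝ] ℝ ↦ T w)
      (TangentBundle.continuousLinearMapAt_model_space (f x₀ x₀) (f x x))
  exact (h1 _).trans (h2 _).symm

lemma Bivector.smoothFieldAt_sharp (P : Bivector E M) {α : ∀ x : M, Cotangent E x} {x : M}
    (hα : SmoothFormAt α x) : SmoothFieldAt (fun x ↦ P.sharp x (α x)) x :=
  ContMDiffAt.clm_bundle_apply (P.smooth x) hα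

lemma SmoothFormAt.apply {α : ∀ x : M, Cotangent E x} {v : ∀ x : M, TangentSpace 𝓘(ℝ, E) x} {x : M}
    (hα : SmoothFormAt α x) (hv : SmoothFieldAt v x) :
    SmoothAt E ℝ (fun x ↦ α x (v x)) x := by
  have := ContMDiffAt.clm_bundle_apply (F₁ := E) (F₂ := ℝ) (E₁ := fun x : M ↦ TangentSpace 𝓘(ℝ, E) x) (E₂ := Bundle.Trivial M ℝ) (b := fun x ↦ x) (ϕ := α) (v := v) hα hv
  have h2 := (Bundle.contMDiffAt_totalSpace.1 this).2
  exact h2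

section Groups

variable {G : Type*} [TopologicalSpace G] [ChartedSpace E G] [Group G] [LieGroup 𝓘(ℝ, E) ∞ G]

lemma smoothAt_mul_left (g h : G) : SmoothAt E E (fun x : G ↦ g * x) h :=
  contMDiff_mul_left.contMDiffAt

lemma smoothAt_mul_right (g h : G) : SmoothAt E E (fun x : G ↦ x * h) g :=
  contMDiff_mul_right.contMDiffAt

lemma smoothAt_conj (g h : G) : SmoothAt E E (fun x : G ↦ g * x * g⁻¹) h :=
  ContMDiffAt.comp h (smoothAt_mul_right (E := E) (g * h) g⁻¹) (smoothAt_mul_left g h)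

/-- Every covector at a point is the differential of a function. -/
lemma exists_smoothAt_tmap_eq (x : M) (ξ : E →L[ℝ] ℝ) :
    ∃ h : M → ℝ, SmoothAt E ℝ h x ∧ tmap E ℝ h x = ξ := by
  have hφ := IsManifold.chart_mem_maximalAtlas (I := 𝓘(ℝ, E)) (n := ∞) x
  have hx := mem_chart_source E x
  set φ := chartAt E x
  have h1 : SmoothAt E ℝ (fun y ↦ (ξ.comp (tmap E E φ.symm (φ x))) y) (φ x) :=
    ContDiffAt.contMDiffAt (ContinuousLinearMap.contDiff _).contDiffAt
  refine ⟨fun y ↦ (ξ.comp (tmap E E φ.symm (φ x))) (φ y),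
    ContMDiffAt.comp x h1 (smoothAt_chart hφ hx), ?_⟩
  ext v
  rw [tmap_comp_apply h1 (smoothAt_chart hφ hx), tmap_eq_fderiv, ContinuousLinearMap.fderiv,
    ContinuousLinearMap.comp_apply, tmap_symm_tmap hφ hx]

lemma smoothFormAt_rightCovector (ξ : Cotangent E (1 : G)) (g : G) :
    SmoothFormAt (rightCovector ξ) g := by
  obtain ⟨h, hh, hξ⟩ := exists_smoothAt_tmap_eq (E := E) (1 : G) ξ
  have h1 : rightCovector ξ = fun x ↦ tmap E ℝ (fun y ↦ h (y * x⁻¹)) x := by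
    funext x
    have h2 : ∀ v : E, tmap E ℝ (fun y ↦ h (y * x⁻¹)) x v =
        (tmap E ℝ h (x * x⁻¹)) (tmap E E (fun y ↦ y * x⁻¹) x v) :=
      tmap_comp_apply (by rw [mul_inv_cancel]; exact hh) (smoothAt_mul_right x x⁻¹)
    rw [mul_inv_cancel, hξ] at h2
    exact ContinuousLinearMap.ext fun v ↦ (h2 v).symm
  rw [h1]
  refine smoothFormAt_of_param (f := fun x y ↦ h (y * x⁻¹)) ?_
  have h2 : ContMDiffAt (𝓘(ℝ, E).prod 𝓘(ℝ, E)) 𝓘(ℝ, E) ∞ (fun p : G × G ↦ p.2 * p.1⁻¹) (g, g) :=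
    contMDiffAt_snd.mul contMDiffAt_fst.inv
  exact ContMDiffAt.comp_of_eq (x := (g, g)) hh h2 (by simp)

lemma smoothFormAt_leftCovector (ξ : Cotangent E (1 : G)) (g : G) :
    SmoothFormAt (leftCovector ξ) g := by
  obtain ⟨h, hh, hξ⟩ := exists_smoothAt_tmap_eq (E := E) (1 : G) ξ
  have h1 : leftCovector ξ = fun x ↦ tmap E ℝ (fun y ↦ h (x⁻¹ * y)) x := by
    funext x
    have h2 : ∀ v : E, tmap E ℝ (fun y ↦ h (x⁻¹ * y)) x v =
        (tmap E ℝ h (x⁻¹ * x)) (tmap E E (fun y ↦ x⁻¹ * y) x v) :=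
      tmap_comp_apply (by rw [inv_mul_cancel]; exact hh) (smoothAt_mul_left x⁻¹ x)
    rw [inv_mul_cancel, hξ] at h2
    exact ContinuousLinearMap.ext fun v ↦ (h2 v).symm
  rw [h1]
  refine smoothFormAt_of_param (f := fun x y ↦ h (x⁻¹ * y)) ?_
  have h2 : ContMDiffAt (𝓘(ℝ, E).prod 𝓘(ℝ, E)) 𝓘(ℝ, E) ∞ (fun p : G × G ↦ p.1⁻¹ * p.2) (g, g) :=
    contMDiffAt_fst.inv.mul contMDiffAt_snd
  exact ContMDiffAt.comp_of_eq (x := (g, g)) hh h2 (by simp)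

/-- The differential of the right translation by `g⁻¹` at `g`. -/
def rOne (E : Type*) [NormedAddCommGroup E] [NormedSpace ℝ E]
    {G : Type*} [TopologicalSpace G] [ChartedSpace E G] [Group G] (g : G) : E →L[ℝ] E :=
  tmap E E (fun x : G ↦ x * g⁻¹) g

/-- The adjoint action. -/
def adT (E : Type*) [NormedAddCommGroup E] [NormedSpace ℝ E]
    {G : Type*} [TopologicalSpace G] [ChartedSpace E G] [Group G] (g : G) : E →L[ℝ] E :=
  tmap E E (fun x : G ↦ g * x * g⁻¹) 1

lemma rOne_rightT (g h : G) (v : E) :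
    rOne E (g * h) (tmap E E (fun x ↦ x * h) g v) = rOne E g v := by
  rw [rOne, ← tmap_comp_apply (smoothAt_mul_right _ _) (smoothAt_mul_right _ _), rOne]
  congr 2
  funext x
  group

lemma rOne_leftT (g h : G) (v : E) :
    rOne E (g * h) (tmap E E (fun x ↦ g * x) h v) = adT E g (rOne E h v) := by
  have h1 : tmap E E (fun x ↦ g * (x * h⁻¹) * g⁻¹) h v =
      tmap E E (fun x ↦ g * x * g⁻¹) (h * h⁻¹) (rOne E h v) :=
    tmap_comp_apply (smoothAt_conj _ _) (smoothAt_mul_right _ _) v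
  rw [rOne, ← tmap_comp_apply (smoothAt_mul_right _ _) (smoothAt_mul_left _ _)]
  rw [mul_inv_cancel] at h1
  rw [adT, ← h1]
  congr 2
  funext x
  group

lemma rightT_rOne (g : G) (v : E) : tmap E E (fun x : G ↦ x * g) 1 (rOne E g v) = v := by
  have h1 : tmap E E (fun x ↦ x * g⁻¹ * g) g v =
      tmap E E (fun x ↦ x * g) (g * g⁻¹) (rOne E g v) :=
    tmap_comp_apply (smoothAt_mul_right _ _) (smoothAt_mul_right _ _) v
  rw [mul_inv_cancel] at h1
  rw [← h1]
  simp only [inv_mul_cancel_right]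
  rw [tmap_id]
  rfl

lemma rOne_rightT_one (g : G) (v : E) : rOne E g (tmap E E (fun x : G ↦ x * g) 1 v) = v := by
  have := rOne_rightT (1 : G) g v
  rw [one_mul] at this
  rw [this, rOne]
  simp only [inv_one, mul_one]
  rw [tmap_id]
  rfl

lemma leftT_leftToOne (g : G) (v : E) :
    tmap E E (fun x : G ↦ g * x) 1 (tmap E E (fun x : G ↦ g⁻¹ * x) g v) = v := by
  have h1 : tmap E E (fun x ↦ g * (g⁻¹ * x)) g v =
      tmap E E (fun x ↦ g * x) (g⁻¹ * g) (tmap E E (fun x : G ↦ g⁻¹ * x) g v) :=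
    tmap_comp_apply (smoothAt_mul_left _ _) (smoothAt_mul_left _ _) v
  rw [inv_mul_cancel] at h1
  rw [← h1]
  simp only [mul_inv_cancel_left]
  rw [tmap_id]
  rfl

/-- The bundle map of a bivector field at a point, as a map between the model spaces. -/
def Bivector.sh (P : Bivector E M) (x : M) : (E →L[ℝ] ℝ) →L[ℝ] E := P.sharp x

lemma Bivector.apply_sh_self (P : Bivector E M) (x : M) (α : E →L[ℝ] ℝ) : α (P.sh x α) = 0 :=
  P.alternating x α

lemma Bivector.apply_sh_comm (P : Bivector E M) (x : M) (α β : E →L[ℝ] ℝ) :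
    α (P.sh x β) = -β (P.sh x α) := by
  have := P.apply_sh_self x (α + β)
  simp only [map_add, add_apply, P.apply_sh_self] at this
  linarith

lemma Bivector.IsPoissonLie.sh_mul {P : Bivector E G} (hP : P.IsPoissonLie) (g h : G)
    (α : E →L[ℝ] ℝ) : P.sh (g * h) α =
      tmap E E (fun x ↦ g * x) h (P.sh h (α.comp (tmap E E (fun x ↦ g * x) h))) +
      tmap E E (fun x ↦ x * h) g (P.sh g (α.comp (tmap E E (fun x ↦ x * h) g))) :=
  hP.multiplicative g h α

/-- The right trivialization of a bivector field, in terms of the model space. -/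
def Bivector.rtriv (P : Bivector E G) (ξ η : E →L[ℝ] ℝ) (g : G) : ℝ := P.rightTrivialized ξ η g

lemma Bivector.rtriv_eq (P : Bivector E G) (ξ η : E →L[ℝ] ℝ) (g : G) :
    P.rtriv ξ η g = ξ (rOne E g (P.sh g (η.comp (rOne E g)))) := rfl

/-- The cocycle identity: after right trivialization, right translation disappears and left
translation by `g` becomes `Ad_g`. -/
lemma Bivector.IsPoissonLie.rtriv_mul {P : Bivector E G} (hP : P.IsPoissonLie)
    (ξ η : E →L[ℝ] ℝ) (g h : G) :
    P.rtriv ξ η (g * h) =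
      P.rtriv (ξ.comp (adT E g)) (η.comp (adT E g)) h + P.rtriv ξ η g := by
  have h1 : (η.comp (rOne E (g * h))).comp (tmap E E (fun x ↦ g * x) h) =
      (η.comp (adT E g)).comp (rOne E h) := by
    ext v; exact congrArg η (rOne_leftT g h v)
  have h2 : (η.comp (rOne E (g * h))).comp (tmap E E (fun x ↦ x * h) g) = η.comp (rOne E g) := by
    ext v; exact congrArg η (rOne_rightT g h v)
  simp only [Bivector.rtriv_eq]
  rw [hP.sh_mul, h1, h2, map_add, map_add, rOne_leftT, rOne_rightT]
  rfl

lemma Bivector.IsPoissonLie.sh_one {P : Bivector E G} (hP : P.IsPoissonLie) (α : E →L[ℝ] ℝ) :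
    P.sh (1 : G) α = 0 := by
  have h := hP.sh_mul 1 1 α
  simp only [one_mul, mul_one, tmap_id, ContinuousLinearMap.comp_id,
    ContinuousLinearMap.id_apply] at h
  simpa using h

lemma Bivector.smoothAt_rtriv (P : Bivector E G) (ξ η : E →L[ℝ] ℝ) (g : G) :
    SmoothAt E ℝ (P.rtriv ξ η) g :=
  SmoothFormAt.apply (smoothFormAt_rightCovector (E := E) ξ g)
    (P.smoothFieldAt_sharp (smoothFormAt_rightCovector (E := E) η g))

section Subgroups

variable {H : Subgroup G}

lemma rOne_mem_tanSet {g : G} (hg : g ∈ H) {v : E} (hv : v ∈ tanSet E (H : Set G) g) :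
    rOne E g v ∈ tanSet E (H : Set G) 1 := by
  have := tmap_mem_tanSet (smoothAt_mul_right (E := E) g g⁻¹) (S' := (H : Set G))
    (.of_forall fun y hy ↦ H.mul_mem hy (H.inv_mem hg)) hv
  rwa [mul_inv_cancel] at this

lemma leftToOne_mem_tanSet {g : G} (hg : g ∈ H) {v : E} (hv : v ∈ tanSet E (H : Set G) g) :
    tmap E E (fun x : G ↦ g⁻¹ * x) g v ∈ tanSet E (H : Set G) 1 := by
  have := tmap_mem_tanSet (smoothAt_mul_left (E := E) g⁻¹ g) (S' := (H : Set G))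
    (.of_forall fun y hy ↦ H.mul_mem (H.inv_mem hg) hy) hv
  rwa [inv_mul_cancel] at this

lemma leftT_mem_tanSet {g : G} (hg : g ∈ H) {v : E} (hv : v ∈ tanSet E (H : Set G) 1) :
    tmap E E (fun x : G ↦ g * x) 1 v ∈ tanSet E (H : Set G) g := by
  have := tmap_mem_tanSet (smoothAt_mul_left (E := E) g 1) (S' := (H : Set G))
    (.of_forall fun y hy ↦ H.mul_mem hg hy) hv
  rwa [mul_one] at this

lemma rightT_mem_tanSet {g : G} (hg : g ∈ H) {v : E} (hv : v ∈ tanSet E (H : Set G) 1) :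
    tmap E E (fun x : G ↦ x * g) 1 v ∈ tanSet E (H : Set G) g := by
  have := tmap_mem_tanSet (smoothAt_mul_right (E := E) 1 g) (S' := (H : Set G))
    (.of_forall fun y hy ↦ H.mul_mem hy hg) hv
  rwa [one_mul] at this

lemma adT_mem_tanSet {g : G} (hg : g ∈ H) {v : E} (hv : v ∈ tanSet E (H : Set G) 1) :
    adT E g v ∈ tanSet E (H : Set G) 1 := by
  have := tmap_mem_tanSet (smoothAt_conj (E := E) g 1) (S' := (H : Set G))
    (.of_forall fun y hy ↦ H.mul_mem (H.mul_mem hg hy) (H.inv_mem hg)) hv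
  rwa [mul_one, mul_inv_cancel] at this

lemma fderiv_mem_submodule [FiniteDimensional ℝ E] {W : Submodule ℝ E} {V : E → E} {x u : E}
    (hV : DifferentiableAt ℝ V x) (hW : ∀ᶠ y in 𝓝 x, y ∈ W → V y ∈ W) (hx : x ∈ W) (hu : u ∈ W) :
    fderiv ℝ V x u ∈ W := by
  have h0 : x + (0 : ℝ) • u = x := by simp
  have h1 : HasDerivAt (fun t : ℝ ↦ x + t • u) u 0 := by
    simpa using ((hasDerivAt_id (0 : ℝ)).smul_const u).const_add x
  have h2 : HasDerivAt (fun t : ℝ ↦ V (x + t • u)) (fderiv ℝ V x u) 0 := by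
    refine HasFDerivAt.comp_hasDerivAt (0 : ℝ) ?_ h1
    rw [h0]
    exact hV.hasFDerivAt
  refine HasDerivWithinAt.mem_submodule h2 ?_
  have h3 : Tendsto (fun t : ℝ ↦ x + t • u) (𝓝 0) (𝓝 x) := by
    simpa using h1.continuousAt.tendsto
  filter_upwards [h3.eventually hW] with t ht
  exact ht (W.add_mem hx (W.smul_mem _ hu))

instance lieGroup_minSmoothness : LieGroup 𝓘(ℝ, E) (minSmoothness ℝ 3) G :=
  LieGroup.of_le (n := ∞) (by simpa using three_le_infty)

/-- The tangent space at the unit of an embedded subgroup is closed under the Lie bracket. -/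
lemma lie_mem_tanSet [FiniteDimensional ℝ E] (hH : IsEmbeddedSubmanifold E (H : Set G))
    {X Y : GroupLieAlgebra 𝓘(ℝ, E) G} (hX : X ∈ lieAlg E H) (hY : Y ∈ lieAlg E H) :
    ⁅X, Y⁆ ∈ lieAlg E H := by
  have : CompleteSpace E := FiniteDimensional.complete ℝ E
  obtain ⟨φ, hφ, h1φ, W, hW⟩ := hH 1 H.one_mem
  have h1t := φ.map_source h1φ
  have hd : ∀ X : GroupLieAlgebra 𝓘(ℝ, E) G, MDifferentiableAt 𝓘(ℝ, E) 𝓘(ℝ, E).tangent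
      (fun x : G ↦ (⟨x, mulInvariantVectorField X x⟩ : TangentBundle 𝓘(ℝ, E) G))
      (φ.symm (φ 1)) := fun X ↦ mdifferentiableAt_mulInvariantVectorField X
  have hcd : ∀ X : GroupLieAlgebra 𝓘(ℝ, E) G,
      DifferentiableAt ℝ (chartField φ (mulInvariantVectorField X)) (φ 1) := by
    intro X
    have h2 : minSmoothness ℝ 2 + 1 ≤ (∞ : WithTop ℕ∞) := by
      simp only [minSmoothness_of_isRCLikeNormedField]
      norm_num
      exact three_le_infty
    refine (contDiffAt_chartField hφ h1t h2
      (contMDiffAt_mulInvariantVectorField X)).differentiableAt ?_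
    simp
  have hbr := lieBracket_chartField hφ h1t (hd X) (hd Y)
  -- A left-invariant field with value in the tangent space at `1` is tangent to `H` at all its
  -- points, so in the chart it maps `W` to `W`.
  have hmem : ∀ X ∈ lieAlg E H, ∀ y ∈ φ.target, y ∈ W →
      chartField φ (mulInvariantVectorField X) y ∈ W := by
    intro X hX y hy hyW
    have hyH : φ.symm y ∈ (H : Set G) := by
      rw [hW _ (φ.map_target hy), φ.right_inv hy]; exact hyW
    exact (mem_tanSet_iff hφ hW (φ.map_target hy) hyH).1 (leftT_mem_tanSet hyH hX)
  have h1W : φ 1 ∈ W := (hW _ h1φ).1 H.one_mem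
  have key : chartField φ (VectorField.mlieBracket 𝓘(ℝ, E) (mulInvariantVectorField X)
      (mulInvariantVectorField Y)) (φ 1) ∈ W := by
    rw [← hbr]
    -- The bracket is a difference of derivatives of such fields in directions of `W`, and these
    -- derivatives stay in `W`.
    refine W.sub_mem (fderiv_mem_submodule (hcd Y) ?_ h1W (hmem X hX _ h1t h1W))
      (fderiv_mem_submodule (hcd X) ?_ h1W (hmem Y hY _ h1t h1W))
    · filter_upwards [φ.open_target.mem_nhds h1t] with y hy hyW using hmem Y hY y hy hyW
    · filter_upwards [φ.open_target.mem_nhds h1t] with y hy hyW using hmem X hX y hy hyW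
  refine (mem_tanSet_iff hφ hW h1φ H.one_mem).2 ?_
  have h3 : tmap E E φ (φ.symm (φ 1)) (VectorField.mlieBracket 𝓘(ℝ, E) (mulInvariantVectorField X)
      (mulInvariantVectorField Y) (φ.symm (φ 1))) ∈ W := key
  rw [φ.left_inv h1φ] at h3
  exact h3

end Subgroups

end Groups

end

/-! ### Annihilating subgroups: conormal spaces, coisotropy and invariance. -/

section Duality

variable {E : Type*} [NormedAddCommGroup E] [NormedSpace ℝ E]
  {G : Type*} [TopologicalSpace G] [ChartedSpace E G] [Group G]
  {E' : Type*} [NormedAddCommGroup E'] [NormedSpace ℝ E']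
  {Gs : Type*} [TopologicalSpace Gs] [ChartedSpace E' Gs] [Group Gs]

/-- The linear form on `Lie Gs` defined by an element of `Lie G`, as a map between model spaces. -/
def evalForm (e : GroupLieAlgebra 𝓘(ℝ, E') Gs ≃L[ℝ] Cotangent E (1 : G)) (X : E) : E' →L[ℝ] ℝ :=
  evalAt e X

/-- The identification `e`, as a map between model spaces. -/
def dualMap (e : GroupLieAlgebra 𝓘(ℝ, E') Gs ≃L[ℝ] Cotangent E (1 : G)) :
    E' ≃L[ℝ] (E →L[ℝ] ℝ) := e

lemma evalForm_apply (e : GroupLieAlgebra 𝓘(ℝ, E') Gs ≃L[ℝ] Cotangent E (1 : G)) (X : E) (ξ : E') :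
    evalForm e X ξ = dualMap e ξ X := rfl

lemma exists_evalForm_eq [FiniteDimensional ℝ E]
    (e : GroupLieAlgebra 𝓘(ℝ, E') Gs ≃L[ℝ] Cotangent E (1 : G)) (ζ : E' →L[ℝ] ℝ) :
    ∃ X : E, evalForm e X = ζ := by
  let m : Module.Dual ℝ (Module.Dual ℝ E) :=
    { toFun := fun l ↦ ζ ((dualMap e).symm (LinearMap.toContinuousLinearMap l))
      map_add' := by intro a b; simp
      map_smul' := by intro a b; simp }
  refine ⟨(Module.evalEquiv ℝ E).symm m, ?_⟩
  ext ξ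
  have h1 : (Module.evalEquiv ℝ E ((Module.evalEquiv ℝ E).symm m)) (dualMap e ξ).toLinearMap =
      m (dualMap e ξ).toLinearMap := by rw [LinearEquiv.apply_symm_apply]
  rw [evalForm_apply]
  have h2 : LinearMap.toContinuousLinearMap (dualMap e ξ).toLinearMap = dualMap e ξ := rfl
  calc dualMap e ξ ((Module.evalEquiv ℝ E).symm m) = m (dualMap e ξ).toLinearMap := h1
    _ = ζ ((dualMap e).symm (LinearMap.toContinuousLinearMap (dualMap e ξ).toLinearMap)) := rfl
    _ = ζ ξ := by rw [h2, ContinuousLinearEquiv.symm_apply_apply]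

/-- This is `𝔥^⊥⊥ ⊆ 𝔥`: a vector outside the subspace `T` is detected by a linear form that vanishes
on `T`. Linearity of `𝔥` is essential and enters through `hT`. -/
lemma evalForm_mem_of_annihilator [FiniteDimensional ℝ E]
    (e : GroupLieAlgebra 𝓘(ℝ, E') Gs ≃L[ℝ] Cotangent E (1 : G)) {𝔥 : Set E} {T : Submodule ℝ E}
    (hT : ∀ v, v ∈ 𝔥 ↔ v ∈ T) {X : E} (hX : ∀ ξ ∈ annihilator e 𝔥, evalForm e X ξ = 0) : X ∈ 𝔥 := by
  rw [hT]
  by_contra hXT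
  obtain ⟨l, hl, hlT⟩ := Submodule.exists_le_ker_of_notMem hXT
  set l' : E →L[ℝ] ℝ := LinearMap.toContinuousLinearMap l with hl'
  have h1 : (dualMap e).symm l' ∈ annihilator e 𝔥 := by
    intro Y hY
    have h2 : dualMap e ((dualMap e).symm l') Y = 0 := by
      rw [ContinuousLinearEquiv.apply_symm_apply]
      exact hlT ((hT Y).1 hY)
    exact h2
  have h3 := hX _ h1
  rw [evalForm_apply, ContinuousLinearEquiv.apply_symm_apply] at h3
  exact hl h3

lemma smoothFieldAt_leftDressing [LieGroup 𝓘(ℝ, E') ∞ Gs] (Ps : Bivector E' Gs)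
    (e : GroupLieAlgebra 𝓘(ℝ, E') Gs ≃L[ℝ] Cotangent E (1 : G)) (X : E) (γ : Gs) :
    SmoothFieldAt (leftDressing Ps e X) γ :=
  Ps.smoothFieldAt_sharp (smoothFormAt_rightCovector (E := E') (evalAt e X) γ)

lemma smoothFieldAt_rightDressing [LieGroup 𝓘(ℝ, E) ∞ G] (P : Bivector E G)
    (e : GroupLieAlgebra 𝓘(ℝ, E') Gs ≃L[ℝ] Cotangent E (1 : G)) (ξ : E') (g : G) :
    SmoothFieldAt (rightDressing P e ξ) g := by
  have h1 := P.smoothFieldAt_sharp (smoothFormAt_leftCovector (E := E) (-(dualMap e ξ)) g)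
  have h2 : ∀ x, P.sh x ((-(dualMap e ξ)).comp (tmap E E (fun y : G ↦ x⁻¹ * y) x)) =
      -P.sh x ((dualMap e ξ).comp (tmap E E (fun y : G ↦ x⁻¹ * y) x)) := fun x ↦ by
    rw [ContinuousLinearMap.neg_comp, map_neg]
  have h3 : rightDressing P e ξ = fun x ↦ P.sharp x
      (leftCovector (E := E) (-(dualMap e ξ)) x) := funext fun x ↦ (h2 x).symm
  rw [h3]
  exact h1

variable [LieGroup 𝓘(ℝ, E) ∞ G] [LieGroup 𝓘(ℝ, E') ∞ Gs]

/-- The conormal space of a submanifold, in terms of the model space. -/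
def conSet (E : Type*) [NormedAddCommGroup E] [NormedSpace ℝ E]
    {M : Type*} [TopologicalSpace M] [ChartedSpace E M] (S : Set M) (x : M) : Set (E →L[ℝ] ℝ) :=
  conormalSet (E := E) S x

/-- The data of the theorem: dual Poisson Lie groups, and subgroups with annihilating tangent
spaces at the unit. -/
structure DualSubgroups [FiniteDimensional ℝ E] [FiniteDimensional ℝ E']
    (P : Bivector E G) (Ps : Bivector E' Gs)
    (e : GroupLieAlgebra 𝓘(ℝ, E') Gs ≃L[ℝ] Cotangent E (1 : G))
    (H : Subgroup G) (Hp : Subgroup Gs) : Prop where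
  poissonLie : Ps.IsPoissonLie
  dual : IsDual P Ps e
  sub : IsEmbeddedSubmanifold E (H : Set G)
  sub' : IsConnectedClosedLieSubgroup E' Hp
  lieAlg_eq : lieAlg E' Hp = annihilator e (lieAlg E H)

namespace DualSubgroups

variable [FiniteDimensional ℝ E] [FiniteDimensional ℝ E']
  {P : Bivector E G} {Ps : Bivector E' Gs}
  {e : GroupLieAlgebra 𝓘(ℝ, E') Gs ≃L[ℝ] Cotangent E (1 : G)}
  {H : Subgroup G} {Hp : Subgroup Gs}

lemma mem_tanSet_iff (D : DualSubgroups P Ps e H Hp) {ξ : E'} :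
    ξ ∈ tanSet E' (Hp : Set Gs) 1 ↔ ∀ X ∈ tanSet E (H : Set G) 1, dualMap e ξ X = 0 := by
  have := Set.ext_iff.1 D.lieAlg_eq ξ
  exact this

lemma exists_evalForm (D : DualSubgroups P Ps e H Hp) {ζ : E' →L[ℝ] ℝ} (hζ : ∀ ξ ∈ tanSet E' (Hp : Set Gs) 1, ζ ξ = 0) :
    ∃ X ∈ tanSet E (H : Set G) 1, evalForm e X = ζ := by
  obtain ⟨X, rfl⟩ := exists_evalForm_eq e ζ
  obtain ⟨T, hT⟩ := exists_submodule_eq_tanSet D.sub H.one_mem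
  refine ⟨X, evalForm_mem_of_annihilator e hT fun ξ hξ ↦ hζ ξ ?_, rfl⟩
  exact D.mem_tanSet_iff.2 hξ

lemma evalForm_eq_zero (D : DualSubgroups P Ps e H Hp) {X : E} (hX : X ∈ tanSet E (H : Set G) 1) {ξ : E'}
    (hξ : ξ ∈ tanSet E' (Hp : Set Gs) 1) : evalForm e X ξ = 0 :=
  D.mem_tanSet_iff.1 hξ X hX

/-- Right translation by `γ ∈ Hp` carries the tangent space at `1` onto that at `γ`. A conormal
covector, pulled back to `1`, therefore annihilates `𝔥^⊥` and comes from `𝔥`. -/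
lemma mem_conormalSet_iff (D : DualSubgroups P Ps e H Hp) {γ : Gs} (hγ : γ ∈ Hp) {α : E' →L[ℝ] ℝ} :
    α ∈ conSet E' (Hp : Set Gs) γ ↔
      ∃ X ∈ tanSet E (H : Set G) 1, (evalForm e X).comp (rOne E' γ) = α := by
  constructor
  · intro hα
    have h0 : ∀ v ∈ tanSet E' (Hp : Set Gs) γ, α v = 0 := hα
    obtain ⟨X, hX, hXα⟩ := D.exists_evalForm (ζ := α.comp (tmap E' E' (fun x : Gs ↦ x * γ) 1))
      (fun ξ hξ ↦ h0 _ (rightT_mem_tanSet hγ hξ))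
    refine ⟨X, hX, ?_⟩
    ext v
    rw [hXα]
    exact congrArg α (rightT_rOne γ v)
  · rintro ⟨X, hX, rfl⟩ v hv
    exact D.evalForm_eq_zero hX (rOne_mem_tanSet hγ hv)

/-- By duality the differential is the pairing of `ξ` with `[X, Y]`, and `[X, Y]` stays in `𝔥`. -/
lemma tmap_rtriv_one (D : DualSubgroups P Ps e H Hp) {X Y : E} (hX : X ∈ tanSet E (H : Set G) 1)
    (hY : Y ∈ tanSet E (H : Set G) 1) {ξ : E'} (hξ : ξ ∈ tanSet E' (Hp : Set Gs) 1) :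
    tmap E' ℝ (Ps.rtriv (evalForm e X) (evalForm e Y)) 1 ξ = 0 :=
  (D.dual.bracket X Y ξ).symm.trans
    (D.mem_tanSet_iff.1 hξ _ (lie_mem_tanSet D.sub hX hY))

/-- `Ad_γ` preserves `𝔥^⊥` for `γ ∈ Hp`, so its transpose preserves the annihilator `𝔥`. -/
lemma evalForm_comp_adT (D : DualSubgroups P Ps e H Hp) {X : E} (hX : X ∈ tanSet E (H : Set G) 1) {γ : Gs} (hγ : γ ∈ Hp) :
    ∃ X' ∈ tanSet E (H : Set G) 1, evalForm e X' = (evalForm e X).comp (adT E' γ) :=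
  D.exists_evalForm fun _ hξ ↦ D.evalForm_eq_zero hX (adT_mem_tanSet hγ hξ)

/-- The cocycle identity transports the differential at `δ ∈ Hp` to the differential at `1` of the
function attached to the transformed pair `X'`, `Y'`. The latter vanishes on `𝔥^⊥`, so the function
is constant on the connected `Hp`. -/
lemma rtriv_eq_zero (D : DualSubgroups P Ps e H Hp) {X Y : E} (hX : X ∈ tanSet E (H : Set G) 1)
    (hY : Y ∈ tanSet E (H : Set G) 1) {γ : Gs} (hγ : γ ∈ Hp) :
    Ps.rtriv (evalForm e X) (evalForm e Y) γ = 0 := by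
  have h1 : Ps.rtriv (evalForm e X) (evalForm e Y) (1 : Gs) = 0 := by
    rw [Bivector.rtriv_eq, D.poissonLie.sh_one, map_zero, map_zero]
  rw [← h1]
  refine eq_of_tmap_eq_zero_of_isPreconnected D.sub'.isEmbeddedSubmanifold
    D.sub'.isConnected.isPreconnected (fun x _ ↦ Ps.smoothAt_rtriv _ _ x) ?_ hγ Hp.one_mem
  intro δ hδ v hv
  obtain ⟨X', hX', hX'e⟩ := D.evalForm_comp_adT hX hδ
  obtain ⟨Y', hY', hY'e⟩ := D.evalForm_comp_adT hY hδ
  set F := Ps.rtriv (evalForm e X) (evalForm e Y) with hF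
  set F' := Ps.rtriv (evalForm e X') (evalForm e Y') with hF'
  have hmul : (fun x ↦ F (δ * x)) = fun x ↦ F' x + F δ := by
    funext x
    rw [hF, D.poissonLie.rtriv_mul, hF', hX'e, hY'e]
  have hs : ∀ x, SmoothAt E' ℝ F x := fun x ↦ Ps.smoothAt_rtriv _ _ x
  have hs' : ∀ x, SmoothAt E' ℝ F' x := fun x ↦ Ps.smoothAt_rtriv _ _ x
  have hw := leftToOne_mem_tanSet hδ hv
  set w := tmap E' E' (fun x : Gs ↦ δ⁻¹ * x) δ v with hwdef
  have h2 : tmap E' ℝ (fun x ↦ F (δ * x)) 1 w = tmap E' ℝ F (δ * 1)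
      (tmap E' E' (fun x ↦ δ * x) 1 w) := tmap_comp_apply (hs _) (smoothAt_mul_left _ _) w
  rw [mul_one, hwdef, leftT_leftToOne, ← hwdef, hmul] at h2
  rw [← h2]
  have h3 : tmap E' ℝ (fun x ↦ F' x + F δ) 1 w =
      tmap ℝ ℝ (fun y ↦ y + F δ) (F' 1) (tmap E' ℝ F' 1 w) :=
    tmap_comp_apply (ContDiffAt.contMDiffAt (contDiffAt_id.add contDiffAt_const)) (hs' 1) w
  rw [h3, D.tmap_rtriv_one hX' hY' hw, map_zero]

/-- Translated to `1`, the vector lies in `𝔥^⊥` exactly when its pairings with all `Y ∈ 𝔥` vanish,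
and those pairings are values of `Ps.rtriv`. -/
lemma sh_mem_tanSet (D : DualSubgroups P Ps e H Hp) {γ : Gs} (hγ : γ ∈ Hp) {X : E} (hX : X ∈ tanSet E (H : Set G) 1) :
    Ps.sh γ ((evalForm e X).comp (rOne E' γ)) ∈ tanSet E' (Hp : Set Gs) γ := by
  rw [← rightT_rOne γ (Ps.sh γ _)]
  refine rightT_mem_tanSet hγ (D.mem_tanSet_iff.2 fun Y hY ↦ ?_)
  exact D.rtriv_eq_zero hY hX hγ

lemma isCoisotropic (D : DualSubgroups P Ps e H Hp) : Ps.IsCoisotropic (Hp : Set Gs) where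
  isEmbeddedSubmanifold := D.sub'.isEmbeddedSubmanifold
  sharp_mem γ hγ α hα := by
    obtain ⟨X, hX, hXα⟩ := (D.mem_conormalSet_iff hγ).1 hα
    have := D.sh_mem_tanSet hγ hX
    rw [hXα] at this
    exact this

lemma leftDressing_mem_tangentSet (D : DualSubgroups P Ps e H Hp) {X : E} (hX : X ∈ tanSet E (H : Set G) 1) {γ : Gs}
    (hγ : γ ∈ Hp) : leftDressing Ps e X γ ∈ tangentSet E' (Hp : Set Gs) γ :=
  D.sh_mem_tanSet hγ hX

lemma integralCurve_mem (D : DualSubgroups P Ps e H Hp) {X : E} (hX : X ∈ tanSet E (H : Set G) 1) {c : ℝ → Gs} {J : Set ℝ}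
    (hJ : J.OrdConnected) (hc : IsMIntegralCurveOn c (leftDressing Ps e X) J) {t₀ : ℝ}
    (ht₀ : t₀ ∈ J) (h0 : c t₀ ∈ Hp) {t : ℝ} (ht : t ∈ J) : c t ∈ Hp :=
  D.sub'.isEmbeddedSubmanifold.integralCurve_mem D.sub'.isClosed
    (fun γ _ ↦ smoothFieldAt_leftDressing Ps e X γ)
    (fun _ hγ ↦ D.leftDressing_mem_tangentSet hX hγ) hJ hc ht₀ h0 ht

lemma image_leftDressing (D : DualSubgroups P Ps e H Hp) {γ : Gs} (hγ : γ ∈ Hp) :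
    (fun X ↦ leftDressing Ps e X γ) '' lieAlg E H =
      Ps.coisotropicDistribution (Hp : Set Gs) γ := by
  ext v
  constructor
  · rintro ⟨X, hX, rfl⟩
    exact ⟨(evalForm e X).comp (rOne E' γ), (D.mem_conormalSet_iff hγ).2 ⟨X, hX, rfl⟩, rfl⟩
  · rintro ⟨α, hα, rfl⟩
    obtain ⟨X, hX, hXα⟩ := (D.mem_conormalSet_iff hγ).1 hα
    exact ⟨X, hX, congrArg (Ps.sh γ) hXα⟩

/-- By skew-symmetry, pairing with any `β` gives, up to sign, `ξ` evaluated on the left translate of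
`π♯ β`. That translate lies in `𝔥`, because the image of `π♯` is tangent to a Poisson submanifold.
-/
lemma rightDressing_eq_zero (D : DualSubgroups P Ps e H Hp) (hHP : P.IsPoissonSubmanifold (H : Set G)) {ξ : E'}
    (hξ : ξ ∈ tanSet E' (Hp : Set Gs) 1) {h : G} (hh : h ∈ H) : rightDressing P e ξ h = 0 := by
  have key : P.sh h ((dualMap e ξ).comp (tmap E E (fun x : G ↦ h⁻¹ * x) h)) = 0 := by
    by_contra hne
    obtain ⟨β, hβ⟩ := SeparatingDual.exists_ne_zero (R := ℝ) hne
    refine hβ ?_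
    rw [Bivector.apply_sh_comm, neg_eq_zero]
    exact D.mem_tanSet_iff.1 hξ _ (leftToOne_mem_tanSet hh (hHP.sharp_mem h hh β))
  exact neg_eq_zero.2 key

/-- The field vanishes at `c t₀`, hence is tangent to the closed submanifold `{c t₀}`. -/
lemma rightDressing_integralCurve (D : DualSubgroups P Ps e H Hp) [T2Space G] (hHP : P.IsPoissonSubmanifold (H : Set G)) {ξ : E'}
    (hξ : ξ ∈ tanSet E' (Hp : Set Gs) 1) {c : ℝ → G} {J : Set ℝ}
    (hJ : J.OrdConnected) (hc : IsMIntegralCurveOn c (rightDressing P e ξ) J) {t₀ : ℝ}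
    (ht₀ : t₀ ∈ J) (h0 : c t₀ ∈ H) {t : ℝ} (ht : t ∈ J) : c t = c t₀ := by
  refine (isEmbeddedSubmanifold_singleton (E := E) (c t₀)).integralCurve_mem isClosed_singleton
    (fun γ _ ↦ smoothFieldAt_rightDressing P e ξ γ) ?_ hJ hc ht₀ rfl ht
  intro x hx
  obtain rfl : x = c t₀ := hx
  rw [D.rightDressing_eq_zero hHP hξ h0]
  obtain ⟨T, hT⟩ := exists_submodule_eq_tanSet (isEmbeddedSubmanifold_singleton (E := E) (c t₀))
    (mem_singleton (c t₀))
  exact (hT 0).2 T.zero_mem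

end DualSubgroups

end Duality

/-! ### Poisson bivector fields in charts. -/

section Charts

variable {E : Type*} [NormedAddCommGroup E] [NormedSpace ℝ E]
  {M : Type*} [TopologicalSpace M] [ChartedSpace E M]
  {φ : OpenPartialHomeomorph M E}

/-- A locally defined smooth function agrees near a given point with a globally defined one. -/
lemma exists_contMDiff_eventuallyEq [FiniteDimensional ℝ E] [T2Space M] [IsManifold 𝓘(ℝ, E) ∞ M]
    {f : M → ℝ} {U : Set M} {x : M} (hU : U ∈ 𝓝 x) (hf : ∀ y ∈ U, SmoothAt E ℝ f y) :
    ∃ g : M → ℝ, ContMDiff 𝓘(ℝ, E) 𝓘(ℝ, ℝ) ∞ g ∧ g =ᶠ[𝓝 x] f := by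
  obtain ⟨ρ, -, hρ⟩ := (SmoothBumpFunction.nhds_basis_tsupport (I := 𝓘(ℝ, E)) x).mem_iff.1 hU
  refine ⟨fun y ↦ ρ y • f y, contMDiff_of_tsupport fun y hy ↦ ?_, ?_⟩
  · have h1 : y ∈ U := hρ (closure_mono (Function.support_smul_subset_left _ _) hy)
    exact ρ.contMDiffAt.smul (hf y h1)
  · filter_upwards [ρ.eventuallyEq_one] with y hy
    simp [hy]

lemma smoothAt_clm_chart (hφ : φ ∈ IsManifold.maximalAtlas 𝓘(ℝ, E) ∞ M) {F : Type*}
    [NormedAddCommGroup F] [NormedSpace ℝ F] (c : E →L[ℝ] F) {x : M} (hx : x ∈ φ.source) :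
    SmoothAt E F (fun y ↦ c (φ y)) x ∧ tmap E F (fun y ↦ c (φ y)) x = c.comp (tmap E E φ x) := by
  have h1 : SmoothAt E F c (φ x) := ContDiffAt.contMDiffAt c.contDiff.contDiffAt
  refine ⟨ContMDiffAt.comp x h1 (smoothAt_chart hφ hx), ?_⟩
  ext v
  rw [tmap_comp_apply h1 (smoothAt_chart hφ hx), tmap_eq_fderiv, ContinuousLinearMap.fderiv]
  rfl

variable [IsManifold 𝓘(ℝ, E) ∞ M]

/-- The expression of a bivector field in a chart. -/
def Bivector.chartSharp (P : Bivector E M) (φ : OpenPartialHomeomorph M E) (x : E) :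
    (E →L[ℝ] ℝ) →L[ℝ] E :=
  (tmap E E φ (φ.symm x)).comp ((P.sh (φ.symm x)).comp
    ((ContinuousLinearMap.compL ℝ E E ℝ).flip (tmap E E φ (φ.symm x))))

lemma Bivector.chartSharp_apply (P : Bivector E M) (x : E) (c : E →L[ℝ] ℝ) :
    P.chartSharp φ x c =
      tmap E E φ (φ.symm x) (P.sh (φ.symm x) (c.comp (tmap E E φ (φ.symm x)))) := rfl

lemma Bivector.apply_chartSharp_comm (P : Bivector E M) (x : E) (b c : E →L[ℝ] ℝ) :
    b (P.chartSharp φ x c) = -c (P.chartSharp φ x b) :=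
  P.apply_sh_comm (φ.symm x) (b.comp (tmap E E φ (φ.symm x))) (c.comp (tmap E E φ (φ.symm x)))

lemma Bivector.contDiffAt_chartSharp [FiniteDimensional ℝ E] (P : Bivector E M)
    (hφ : φ ∈ IsManifold.maximalAtlas 𝓘(ℝ, E) ∞ M) {x : E} (hx : x ∈ φ.target) :
    ContDiffAt ℝ ∞ (P.chartSharp φ) x := by
  have : CompleteSpace E := FiniteDimensional.complete ℝ E
  refine ContDiffOn.contDiffAt ?_ (φ.open_target.mem_nhds hx)
  refine contDiffOn_clm_apply.2 fun c y hy ↦ ?_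
  have h1 : SmoothFormAt (fun z ↦ (tmap E ℝ (fun y ↦ c (φ y)) z : E →L[ℝ] ℝ)) (φ.symm y) := by
    refine smoothFormAt_of_param (f := fun _ z ↦ c (φ z)) ?_
    exact ContMDiffAt.comp (f := Prod.snd) (φ.symm y, φ.symm y)
      (smoothAt_clm_chart hφ c (φ.map_target hy)).1 contMDiffAt_snd
  have h2 := (P.smoothFieldAt_sharp h1).contDiffAt_chartField hφ hy
  refine (h2.congr_of_eventuallyEq ?_).contDiffWithinAt
  filter_upwards [φ.open_target.mem_nhds hy] with z hz
  rw [P.chartSharp_apply, ← (smoothAt_clm_chart hφ c (φ.map_target hz)).2]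
  rfl

/-- The Jacobi identity of a Poisson bivector field, in a chart. -/
lemma Bivector.IsPoisson.jacobi_chartSharp [FiniteDimensional ℝ E] [T2Space M] {P : Bivector E M}
    (hP : P.IsPoisson) (hφ : φ ∈ IsManifold.maximalAtlas 𝓘(ℝ, E) ∞ M) {x : E} (hx : x ∈ φ.target)
    (a b c : E →L[ℝ] ℝ) :
    b (fderiv ℝ (P.chartSharp φ) x (P.chartSharp φ x a) c) +
      c (fderiv ℝ (P.chartSharp φ) x (P.chartSharp φ x b) a) +
      a (fderiv ℝ (P.chartSharp φ) x (P.chartSharp φ x c) b) = 0 := by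
  have hy := φ.map_target hx
  set y := φ.symm x with hyx
  have hxy : φ y = x := φ.right_inv hx
  -- The Jacobi identity is available for globally smooth functions only, so linear chart
  -- coordinates are extended by a cutoff.
  have hex : ∀ a : E →L[ℝ] ℝ, ∃ f : M → ℝ, ContMDiff 𝓘(ℝ, E) 𝓘(ℝ, ℝ) ∞ f ∧
      ∀ᶠ z in 𝓝 y, tmap E ℝ f z = a.comp (tmap E E φ z) := by
    intro a
    obtain ⟨f, hf, hfe⟩ := exists_contMDiff_eventuallyEq (φ.open_source.mem_nhds hy)
      (fun z hz ↦ (smoothAt_clm_chart hφ a hz).1)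
    refine ⟨f, hf, ?_⟩
    filter_upwards [hfe.eventuallyEq_nhds, φ.open_source.mem_nhds hy] with z hz hzs
    rw [tmap_congr hz, (smoothAt_clm_chart hφ a hzs).2]
  have hd : DifferentiableAt ℝ (P.chartSharp φ) x :=
    (P.contDiffAt_chartSharp hφ hx).differentiableAt (by simp)
  -- The differentials of chart coordinates are constant in the chart, so differentiating `{g, h}`
  -- only differentiates the bivector. The sign comes from skew-symmetry, which makes `π♯ df` the
  -- direction of differentiation.
  have key : ∀ a b c : E →L[ℝ] ℝ, ∀ f g h : M → ℝ,
      (∀ᶠ z in 𝓝 y, tmap E ℝ f z = a.comp (tmap E E φ z)) →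
      (∀ᶠ z in 𝓝 y, tmap E ℝ g z = b.comp (tmap E E φ z)) →
      (∀ᶠ z in 𝓝 y, tmap E ℝ h z = c.comp (tmap E E φ z)) →
      P.bracket f (P.bracket g h) y =
        -b (fderiv ℝ (P.chartSharp φ) x (P.chartSharp φ x a) c) := by
    intro a b c f g h hf hg hh
    have h1 : P.bracket g h =ᶠ[𝓝 y] fun z ↦ b (P.chartSharp φ (φ z) c) := by
      filter_upwards [hg, hh, φ.open_source.mem_nhds hy] with z hg hh hz
      have e1 : P.bracket g h z = tmap E ℝ g z (P.sh z (tmap E ℝ h z)) := rfl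
      rw [e1, hg, hh, P.chartSharp_apply, φ.left_inv hz]
      rfl
    have h2 : HasFDerivAt (fun z ↦ b (P.chartSharp φ z c))
        (b.comp ((fderiv ℝ (P.chartSharp φ) x).flip c)) x := by
      have := b.hasFDerivAt.comp x (hd.hasFDerivAt.clm_apply (hasFDerivAt_const c x))
      refine this.congr_fderiv ?_
      ext v; simp
    have h3 : SmoothAt E ℝ (fun z ↦ b (P.chartSharp φ z c)) (φ y) := by
      rw [hxy]
      exact ContDiffAt.contMDiffAt (b.contDiff.contDiffAt.comp x
        ((P.contDiffAt_chartSharp hφ hx).clm_apply contDiffAt_const))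
    have h4 : ∀ v : E, tmap E ℝ (P.bracket g h) y v =
        b (fderiv ℝ (P.chartSharp φ) x (tmap E E φ y v) c) := by
      intro v
      rw [tmap_congr h1, tmap_comp_apply h3 (smoothAt_chart hφ hy), hxy, tmap_eq_fderiv, h2.fderiv]
      rfl
    have e2 : P.bracket f (P.bracket g h) y =
        tmap E ℝ f y (P.sh y (tmap E ℝ (P.bracket g h) y)) := rfl
    rw [e2, P.apply_sh_comm, h4, hf.self_of_nhds]
    rfl
  obtain ⟨f, hf, hfe⟩ := hex a
  obtain ⟨g, hg, hge⟩ := hex b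
  obtain ⟨h, hh, hhe⟩ := hex c
  have := hP f g h hf hg hh y
  rw [key a b c f g h hfe hge hhe, key b c a g h f hge hhe hfe, key c a b h f g hhe hfe hge] at this
  linarith

end Charts

/-! ### The linear algebra behind the bracket of dressing fields. -/

section Algebra

variable {V : Type*} [NormedAddCommGroup V] [NormedSpace ℝ V]

/-- The infinitesimal computation behind the bracket of the dressing vector fields. -/
lemma lieBracket_eq_of_jacobi {L R : V → V →L[ℝ] V} {A : V →L[ℝ] V →L[ℝ] V}
    {p q : V → (V →L[ℝ] ℝ) →L[ℝ] V} {Θ : (V →L[ℝ] ℝ) →L[ℝ] V} {x₀ : V}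
    (hL : HasFDerivAt L A x₀) (hR : HasFDerivAt R (-A.flip) x₀)
    (hL0 : L x₀ = .id ℝ V) (hR0 : R x₀ = .id ℝ V)
    (hp : DifferentiableAt ℝ p x₀) (hp0 : p x₀ = 0)
    (hpc : ∀ (v : V) (b c : V →L[ℝ] ℝ), b (fderiv ℝ p x₀ v c) = -c (fderiv ℝ p x₀ v b))
    (hΘ : ∀ b c : V →L[ℝ] ℝ, b (Θ c) = -c (Θ b)) (hq : DifferentiableAt ℝ q x₀)
    (hqe : ∀ᶠ x in 𝓝 x₀, ∀ c, q x c = L x (Θ (c.comp (L x))) + p x c)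
    (hJ : ∀ a b c : V →L[ℝ] ℝ, b (fderiv ℝ q x₀ (q x₀ a) c) + c (fderiv ℝ q x₀ (q x₀ b) a) +
      a (fderiv ℝ q x₀ (q x₀ c) b) = 0)
    {X Y Z : V →L[ℝ] ℝ} (hZ : ∀ v, X (fderiv ℝ p x₀ v Y) = Z v) :
    VectorField.lieBracket ℝ (fun x ↦ q x (X.comp (R x))) (fun x ↦ q x (Y.comp (R x))) x₀ =
      -q x₀ Z := by
  -- In the application, `q x` is the bivector at `δγ`, `p x` at `δ` and `Θ` at `γ`, where `δ` has
  -- coordinate `x`. Then `hqe` is multiplicativity, `L` is left translation by `δ`, and `R` is the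
  -- right trivialization at `δ`.
  have hq0 : q x₀ = Θ := by
    ext c
    rw [hqe.self_of_nhds c, hL0, hp0]
    simp
  have hcomp : ∀ (c : V →L[ℝ] ℝ) (T : V → V →L[ℝ] V) (B : V →L[ℝ] V →L[ℝ] V),
      HasFDerivAt T B x₀ → HasFDerivAt (fun x ↦ c.comp (T x))
        ((ContinuousLinearMap.compL ℝ V V ℝ c).comp B) x₀ := fun c T B hT ↦
    (ContinuousLinearMap.compL ℝ V V ℝ c).hasFDerivAt.comp x₀ hT
  have hQ : ∀ (v : V) (c : V →L[ℝ] ℝ), fderiv ℝ q x₀ v c = A v (Θ c) + Θ (c.comp (A v)) + fderiv ℝ p x₀ v c := by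
    intro v c
    have h1 : HasFDerivAt (fun x ↦ q x c) ((fderiv ℝ q x₀).flip c) x₀ := by
      refine (hq.hasFDerivAt.clm_apply (hasFDerivAt_const c x₀)).congr_fderiv ?_
      ext v; simp
    have h2 := (hL.clm_apply (Θ.hasFDerivAt.comp x₀ (hcomp c L A hL))).add
      (hp.hasFDerivAt.clm_apply (hasFDerivAt_const c x₀))
    have h3 := (h2.congr_of_eventuallyEq (hqe.mono fun x hx ↦ hx c)).unique h1
    have h4 := congrArg (fun T : V →L[ℝ] V ↦ T v) h3
    simp [hL0] at h4
    rw [← h4]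
    abel
  have hS : ∀ (X : V →L[ℝ] ℝ) (v : V), fderiv ℝ (fun x ↦ q x (X.comp (R x))) x₀ v =
      fderiv ℝ q x₀ v X - Θ (X.comp (A.flip v)) := by
    intro X v
    have h1 := hq.hasFDerivAt.clm_apply (hcomp X R _ hR)
    rw [h1.fderiv]
    simp [hR0, hq0]
    abel
  refine (SeparatingDual.eq_iff_forall_dual_eq (R := ℝ)).2 fun W ↦ ?_
  rw [VectorField.lieBracket, hS, hS, hR0]
  -- With the skew-symmetry of the derivative of `q`, this instance turns the bracket paired with
  -- `W` into `X (q'(Θ W) Y)` plus the contributions of `R`. In the expansion by `hQ` the terms in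
  -- `A` cancel those contributions, because `R` has derivative `-A.flip`. What remains is `X (p'(Θ
  -- W) Y) = Z (Θ W) = -W (Θ Z)`.
  have hJ' := hJ X W Y
  have h5 : ∀ (v : V) (b c : V →L[ℝ] ℝ), b (A v (Θ c)) = -c (Θ (b.comp (A v))) := fun v b c ↦ by
    rw [← hΘ]; rfl
  simp only [hq0, ContinuousLinearMap.comp_id, hQ, map_sub, map_add, map_neg] at hJ' ⊢
  have e1 := hΘ W (X.comp (A.flip (Θ Y)))
  have e2 := hΘ W (Y.comp (A.flip (Θ X)))
  have e3 := hΘ W Z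
  have e4 := hZ (Θ W)
  have e5 := hpc (Θ Y) X W
  have e6 := hpc (Θ W) X Y
  have e7 := h5 (Θ Y) X W
  have e8 := h5 (Θ Y) W X
  have e9 := h5 (Θ W) X Y
  have e10 := h5 (Θ W) Y X
  simp only [ContinuousLinearMap.comp_apply, ContinuousLinearMap.flip_apply] at *
  linarith

end Algebra

/-! ### The bracket of dressing fields on a Poisson Lie group. -/

section GroupChart

variable {E : Type*} [NormedAddCommGroup E] [NormedSpace ℝ E]
  {M : Type*} [TopologicalSpace M] [ChartedSpace E M]

lemma chartField_apply {φ : OpenPartialHomeomorph M E} {x : M} (hx : x ∈ φ.source) (v : M → E) :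
    chartField φ v (φ x) = tmap E E φ x (v x) := by
  rw [chartField, φ.left_inv hx]

/-- The tangent space at `x` is identified with the model space through this very chart, so no
linear change of coordinates appears at the unit. -/
lemma tmap_chartAt_self [IsManifold 𝓘(ℝ, E) ∞ M] (x : M) :
    tmap E E (chartAt E x) x = .id ℝ E := by
  ext v
  have : IsManifold 𝓘(ℝ, E) 1 M := IsManifold.of_le (n := ∞) (by simp)
  have h1 := mfderiv_chartAt_eq_tangentCoordChange (I := 𝓘(ℝ, E)) (mem_chart_source E x)
  have h2 := tangentCoordChange_self (I := 𝓘(ℝ, E)) (x := x) (v := v) (mem_extChartAt_source x)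
  refine Eq.trans ?_ h2
  rw [← h1]
  rfl

variable {G : Type*} [TopologicalSpace G] [ChartedSpace E G] [Group G] [LieGroup 𝓘(ℝ, E) ∞ G]
  {φ : OpenPartialHomeomorph G E}

/-- The translate of a chart of a Lie group. -/
lemma exists_translated_chart (hφ : φ ∈ IsManifold.maximalAtlas 𝓘(ℝ, E) ∞ G) (γ : G) :
    ∃ θ ∈ IsManifold.maximalAtlas 𝓘(ℝ, E) ∞ G, (∀ y, θ y = φ (y * γ⁻¹)) ∧
      (∀ x, θ.symm x = φ.symm x * γ) ∧ (∀ y, y ∈ θ.source ↔ y * γ⁻¹ ∈ φ.source) ∧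
      θ.target = φ.target := by
  have := topologicalGroup_of_lieGroup 𝓘(ℝ, E) ∞ (G := G)
  let θ := (Homeomorph.mulRight γ⁻¹).toOpenPartialHomeomorph.trans φ
  have h1 : ∀ y, θ y = φ (y * γ⁻¹) := fun y ↦ rfl
  have h2 : ∀ x, θ.symm x = φ.symm x * γ := fun x ↦ by
    have : θ.symm x = φ.symm x * (γ⁻¹)⁻¹ := rfl
    rw [this, inv_inv]
  have h3 : ∀ y, y ∈ θ.source ↔ y * γ⁻¹ ∈ φ.source := fun y ↦ by simp [θ]
  have h4 : θ.target = φ.target := by simp [θ]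
  refine ⟨θ, OpenPartialHomeomorph.mem_maximalAtlas_of_contMDiffOn _ (fun y hy ↦ ?_)
    (fun x hx ↦ ?_), h1, h2, h3, h4⟩
  · exact (ContMDiffAt.comp y (smoothAt_chart hφ ((h3 y).1 hy))
      (smoothAt_mul_right y γ⁻¹)).contMDiffWithinAt
  · have h5 : SmoothAt E E (fun x ↦ φ.symm x * γ) x :=
      ContMDiffAt.comp x (smoothAt_mul_right (φ.symm x) γ) (smoothAt_chart_symm hφ (h4 ▸ hx))
    exact ContMDiffAt.contMDiffWithinAt (h5.congr_of_eventuallyEq (.of_eq (funext h2)))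

/-- The multiplication in a chart at the unit, and the derivatives at the unit of the translations
in this chart. -/
lemma exists_hasFDerivAt_translations [CompleteSpace E]
    (hφ : φ ∈ IsManifold.maximalAtlas 𝓘(ℝ, E) ∞ G) (h1 : (1 : G) ∈ φ.source)
    (hφ1 : tmap E E φ 1 = .id ℝ E) : ∃ A : E →L[ℝ] E →L[ℝ] E,
      HasFDerivAt (fun x ↦ tmap E E (fun z ↦ φ (φ.symm x * z)) 1) A (φ 1) ∧
      HasFDerivAt (fun x ↦ (rOne E (φ.symm x)).comp (tmap E E φ.symm x)) (-A.flip) (φ 1) := by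
  set x₀ := φ 1 with hx₀
  have hx₀t : x₀ ∈ φ.target := φ.map_source h1
  have hs₀ : φ.symm x₀ = 1 := φ.left_inv h1
  have hφ1' : ∀ v, tmap E E φ.symm x₀ v = v := fun v ↦ by
    have := tmap_symm_tmap hφ h1 v
    rw [hφ1] at this
    exact this
  set m : E × E → E := fun u ↦ φ (φ.symm u.1 * φ.symm u.2) with hmdef
  have hm : ∀ u : E × E, u.1 ∈ φ.target → u.2 ∈ φ.target → φ.symm u.1 * φ.symm u.2 ∈ φ.source →
      ContDiffAt ℝ ∞ m u := by
    intro u hu1 hu2 hu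
    have e1 : SmoothAt (E × E) E (fun u : E × E ↦ φ.symm u.1) u :=
      ContMDiffAt.comp (g := φ.symm) u (smoothAt_chart_symm hφ hu1)
        (ContDiffAt.contMDiffAt contDiffAt_fst)
    have e2 : SmoothAt (E × E) E (fun u : E × E ↦ φ.symm u.2) u :=
      ContMDiffAt.comp (g := φ.symm) u (smoothAt_chart_symm hφ hu2)
        (ContDiffAt.contMDiffAt contDiffAt_snd)
    exact contMDiffAt_iff_contDiffAt.1 (ContMDiffAt.comp u (smoothAt_chart hφ hu) (e1.mul e2))
  have hml : ∀ x ∈ φ.target, ContDiffAt ℝ ∞ m (x, x₀) := fun x hx ↦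
    hm _ hx hx₀t (by simpa [hs₀] using φ.map_target hx)
  have hmr : ∀ x ∈ φ.target, ContDiffAt ℝ ∞ m (x₀, x) := fun x hx ↦
    hm _ hx₀t hx (by simpa [hs₀] using φ.map_target hx)
  have hml' : ∀ x ∈ φ.target, HasFDerivAt (fun y ↦ m (x, y))
      ((fderiv ℝ m (x, x₀)).comp (.inr ℝ E E)) x₀ := fun x hx ↦
    ((hml x hx).differentiableAt (by simp)).hasFDerivAt.comp x₀ (hasFDerivAt_prodMk_right x x₀)
  have hmr' : ∀ x ∈ φ.target, HasFDerivAt (fun y ↦ m (y, x))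
      ((fderiv ℝ m (x₀, x)).comp (.inl ℝ E E)) x₀ := fun x hx ↦
    HasFDerivAt.comp (f := fun y ↦ (y, x)) x₀ ((hmr x hx).differentiableAt (by simp)).hasFDerivAt
      (hasFDerivAt_prodMk_left x₀ x)
  set D2 := fderiv ℝ (fderiv ℝ m) (x₀, x₀)
  have hD2 : HasFDerivAt (fderiv ℝ m) D2 (x₀, x₀) :=
    (((hml x₀ hx₀t).fderiv_right (m := 1) (by norm_num; exact two_le_infty)).differentiableAt
      (by simp)).hasFDerivAt
  have hsymm : IsSymmSndFDerivAt ℝ m (x₀, x₀) :=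
    (hml x₀ hx₀t).isSymmSndFDerivAt (by simpa using two_le_infty)
  -- `A v w` is the mixed second derivative of the multiplication, `v` in the first factor and `w`
  -- in the second. Symmetry of second derivatives then gives `A.flip` for right translations.
  set A : E →L[ℝ] E →L[ℝ] E :=
    ((ContinuousLinearMap.compL ℝ E (E × E) E).flip (.inr ℝ E E)).comp (D2.comp (.inl ℝ E E))
  have hA : HasFDerivAt (fun x ↦ (fderiv ℝ m (x, x₀)).comp (.inr ℝ E E)) A x₀ :=
    ((ContinuousLinearMap.compL ℝ E (E × E) E).flip (.inr ℝ E E)).hasFDerivAt.comp x₀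
      (HasFDerivAt.comp (f := fun y ↦ (y, x₀)) x₀ hD2 (hasFDerivAt_prodMk_left x₀ x₀))
  have hAf : HasFDerivAt (fun x ↦ (fderiv ℝ m (x₀, x)).comp (.inl ℝ E E)) A.flip x₀ := by
    refine (((ContinuousLinearMap.compL ℝ E (E × E) E).flip (.inl ℝ E E)).hasFDerivAt.comp x₀
      (hD2.comp x₀ (hasFDerivAt_prodMk_right x₀ x₀))).congr_fderiv ?_
    ext v w
    exact hsymm (0, v) (w, 0)
  refine ⟨A, hA.congr_of_eventuallyEq ?_, ?_⟩
  · filter_upwards [φ.open_target.mem_nhds hx₀t] with x hx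
    ext v
    have e1 : (fun z ↦ φ (φ.symm x * z)) =ᶠ[𝓝 1] fun z ↦ m (x, φ z) := by
      filter_upwards [φ.open_source.mem_nhds h1] with z hz
      simp only [hmdef, φ.left_inv hz]
    have e2 : SmoothAt E E (fun y ↦ m (x, y)) (φ 1) :=
      ContDiffAt.contMDiffAt ((hml x hx).comp x₀ (contDiffAt_const.prodMk contDiffAt_id))
    rw [tmap_congr e1, tmap_comp_apply e2 (smoothAt_chart hφ h1), hφ1, tmap_eq_fderiv,
      (hml' x hx).fderiv]
    rfl
  · have hRr : ∀ x ∈ φ.target, ∀ v, (fderiv ℝ m (x₀, x)).comp (.inl ℝ E E) v =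
        tmap E E φ (φ.symm x) (tmap E E (fun z ↦ z * φ.symm x) 1 v) := by
      intro x hx v
      rw [← (hmr' x hx).fderiv, ← tmap_eq_fderiv]
      have e3 : SmoothAt E E φ (1 * φ.symm x) := by
        rw [one_mul]; exact smoothAt_chart hφ (φ.map_target hx)
      have e1 : SmoothAt E E (fun z ↦ φ (z * φ.symm x)) (φ.symm x₀) := by
        rw [hs₀]
        exact ContMDiffAt.comp (g := φ) (1 : G) e3 (smoothAt_mul_right 1 (φ.symm x))
      refine (tmap_comp_apply e1 (smoothAt_chart_symm hφ hx₀t) v).trans ?_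
      rw [hφ1', hs₀, tmap_comp_apply (f := fun z ↦ z * φ.symm x) e3 (smoothAt_mul_right _ _), one_mul]
    -- The right trivialization inverts the tangent map of right translation. Since inversion of
    -- operators has derivative `-id` at the identity, the derivative sought is `-A.flip`.
    have hinv : ∀ x ∈ φ.target, (rOne E (φ.symm x)).comp (tmap E E φ.symm x) =
        Ring.inverse ((fderiv ℝ m (x₀, x)).comp (.inl ℝ E E)) := by
      intro x hx
      let u : (E →L[ℝ] E)ˣ := ⟨(fderiv ℝ m (x₀, x)).comp (.inl ℝ E E),
        (rOne E (φ.symm x)).comp (tmap E E φ.symm x), by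
          ext v
          refine (hRr x hx _).trans ?_
          refine (congrArg _ (rightT_rOne (φ.symm x) _)).trans ?_
          exact tmap_tmap_symm hφ hx v, by
          ext v
          refine (congrArg ((rOne E (φ.symm x)).comp (tmap E E φ.symm x)) (hRr x hx v)).trans ?_
          have := tmap_symm_tmap hφ (φ.map_target hx) (tmap E E (fun z ↦ z * φ.symm x) 1 v)
          rw [φ.right_inv hx] at this
          refine (congrArg (rOne E (φ.symm x)) this).trans ?_
          exact rOne_rightT_one (φ.symm x) v⟩
      exact (Ring.inverse_unit u).symm
    have hR1 : (fderiv ℝ m (x₀, x₀)).comp (.inl ℝ E E) = ((1 : (E →L[ℝ] E)ˣ) : E →L[ℝ] E) := by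
      ext v
      rw [hRr x₀ hx₀t, hs₀, hφ1]
      simp only [mul_one]
      rw [tmap_id]
      rfl
    have h2 := hasFDerivAt_ringInverse (𝕜 := ℝ) (1 : (E →L[ℝ] E)ˣ)
    rw [← hR1] at h2
    refine ((h2.comp x₀ hAf).congr_fderiv ?_).congr_of_eventuallyEq ?_
    · ext v w
      simp
    · filter_upwards [φ.open_target.mem_nhds hx₀t] with x hx using hinv x hx

/-- The bracket of two dressing vector fields. -/
lemma Bivector.IsPoissonLie.mlieBracket_sharp_rightCovector [FiniteDimensional ℝ E] [T2Space G]
    {P : Bivector E G} (hP : P.IsPoissonLie) {X Y Z : E →L[ℝ] ℝ}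
    (hZ : tmap E ℝ (P.rtriv X Y) 1 = Z) (γ : G) :
    VectorField.mlieBracket 𝓘(ℝ, E) (fun g ↦ P.sharp g (rightCovector (E := E) X g))
      (fun g ↦ P.sharp g (rightCovector (E := E) Y g)) γ =
    -P.sharp γ (rightCovector (E := E) Z γ) := by
  have : CompleteSpace E := FiniteDimensional.complete ℝ E
  have hφ := IsManifold.chart_mem_maximalAtlas (I := 𝓘(ℝ, E)) (n := ∞) (1 : G)
  have h1 := mem_chart_source E (1 : G)
  have hφ1 := tmap_chartAt_self (E := E) (1 : G)
  set φ := chartAt E (1 : G)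
  obtain ⟨A, hL, hR⟩ := exists_hasFDerivAt_translations hφ h1 hφ1
  -- The chart `θ` gives `δγ` the coordinate that `φ` gives `δ`, so right translation by `γ` becomes
  -- the identity in coordinates.
  obtain ⟨θ, hθ, hθa, hθs, hθsrc, hθt⟩ := exists_translated_chart hφ γ
  set x₀ := φ 1 with hx₀
  have hx₀t : x₀ ∈ φ.target := φ.map_source h1
  have hs₀ : φ.symm x₀ = 1 := φ.left_inv h1
  have hγ : γ ∈ θ.source := by rw [hθsrc, mul_inv_cancel]; exact h1
  have hθγ : θ γ = x₀ := by rw [hθa, mul_inv_cancel]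
  have hx₀θ : x₀ ∈ θ.target := hθt ▸ hx₀t
  set L := fun x ↦ tmap E E (fun z ↦ φ (φ.symm x * z)) 1 with hLdef
  set R := fun x ↦ (rOne E (φ.symm x)).comp (tmap E E φ.symm x) with hRdef
  have hφ1' : ∀ v, tmap E E φ.symm x₀ v = v := fun v ↦ by
    have := tmap_symm_tmap hφ h1 v
    rw [hφ1] at this
    exact this
  have hrOne1 : rOne E (1 : G) = .id ℝ E := by
    rw [rOne]; simp only [inv_one, mul_one]; exact tmap_id
  have hL0 : L x₀ = .id ℝ E := by
    simp only [hLdef, hs₀, one_mul]; exact hφ1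
  have hR0 : R x₀ = .id ℝ E := by
    ext v; simp [hRdef, hs₀, hrOne1, hφ1']
  -- The bivector at `γ`, right-translated to the unit.
  let Θ : (E →L[ℝ] ℝ) →L[ℝ] E :=
    (rOne E γ).comp ((P.sh γ).comp ((ContinuousLinearMap.compL ℝ E E ℝ).flip (rOne E γ)))
  have hθtmap : ∀ y ∈ θ.source, ∀ v, tmap E E θ y v =
      tmap E E φ (y * γ⁻¹) (tmap E E (fun z ↦ z * γ⁻¹) y v) := by
    intro y hy v
    rw [← tmap_comp_apply (f := fun z ↦ z * γ⁻¹) (smoothAt_chart hφ ((hθsrc y).1 hy))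
      (smoothAt_mul_right y γ⁻¹)]
    exact congrArg (fun f : G → E ↦ tmap E E f y v) (funext hθa)
  have hq : ∀ x ∈ θ.target, ∀ c : E →L[ℝ] ℝ, P.chartSharp θ x c =
      L x (Θ (c.comp (L x))) + P.chartSharp φ x c := by
    intro x hx c
    have hxφ : x ∈ φ.target := hθt ▸ hx
    have hsrc := φ.map_target hxφ
    have hy := θ.map_target hx
    rw [P.chartSharp_apply]
    rw [hθs] at hy ⊢
    set δ := φ.symm x with hδ
    have e1 : ∀ v, tmap E E θ (δ * γ) (tmap E E (fun z ↦ z * γ) δ v) = tmap E E φ δ v := by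
      intro v
      rw [← tmap_comp_apply (f := fun z ↦ z * γ) (smoothAt_chart hθ hy) (smoothAt_mul_right _ _)]
      simp only [hθa, mul_inv_cancel_right]
    have e2 : ∀ v, tmap E E θ (δ * γ) (tmap E E (fun z ↦ δ * z) γ v) = L x (rOne E γ v) := by
      intro v
      have e3 : SmoothAt E E (fun z ↦ φ (δ * z)) (γ * γ⁻¹) := by
        rw [mul_inv_cancel]
        exact ContMDiffAt.comp (g := φ) (1 : G) (smoothAt_chart hφ (by rwa [mul_one]))
          (smoothAt_mul_left δ 1)
      have e4 : tmap E E (fun z ↦ φ (δ * (z * γ⁻¹))) γ v = tmap E E (fun z ↦ φ (δ * z)) (γ * γ⁻¹)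
          (tmap E E (fun z ↦ z * γ⁻¹) γ v) :=
        tmap_comp_apply (f := fun z ↦ z * γ⁻¹) e3 (smoothAt_mul_right _ _) v
      rw [mul_inv_cancel] at e4
      rw [← tmap_comp_apply (smoothAt_chart hθ hy) (smoothAt_mul_left _ _)]
      simp only [hθa, mul_assoc]
      exact e4
    rw [hP.sh_mul, map_add, e1, e2]
    have e5 : (c.comp (tmap E E θ (δ * γ))).comp (tmap E E (fun z ↦ δ * z) γ) =
        (c.comp (L x)).comp (rOne E γ) := by
      ext v; exact congrArg c (e2 v)
    have e6 : (c.comp (tmap E E θ (δ * γ))).comp (tmap E E (fun z ↦ z * γ) δ) =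
        c.comp (tmap E E φ δ) := by
      ext v; exact congrArg c (e1 v)
    rw [e5, e6]
    rfl
  have hS : ∀ X : E →L[ℝ] ℝ, ∀ x ∈ θ.target,
      chartField θ (fun g ↦ P.sh g (X.comp (rOne E g))) x = P.chartSharp θ x (X.comp (R x)) := by
    intro X x hx
    have hxφ : x ∈ φ.target := hθt ▸ hx
    have hy := θ.map_target hx
    rw [P.chartSharp_apply, chartField]
    have e1 : X.comp (rOne E (θ.symm x)) = (X.comp (R x)).comp (tmap E E θ (θ.symm x)) := by
      ext v
      refine congrArg X ?_
      have e2 : θ.symm x * γ⁻¹ = φ.symm x := by rw [hθs, mul_inv_cancel_right]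
      have e3 : R x (tmap E E θ (θ.symm x) v) =
          rOne E (φ.symm x) (tmap E E (fun z ↦ z * γ⁻¹) (θ.symm x) v) := by
        rw [hθtmap _ hy, e2]
        refine congrArg (rOne E (φ.symm x)) ?_
        have := tmap_symm_tmap hφ (φ.map_target hxφ) (tmap E E (fun z ↦ z * γ⁻¹) (θ.symm x) v)
        rwa [φ.right_inv hxφ] at this
      refine Eq.trans ?_ e3.symm
      have e4 := rOne_rightT (E := E) (θ.symm x) γ⁻¹ v
      rw [e2] at e4
      exact e4.symm
    rw [e1]
  have hpd : DifferentiableAt ℝ (P.chartSharp φ) x₀ :=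
    (P.contDiffAt_chartSharp hφ hx₀t).differentiableAt (by simp)
  have hpc : ∀ (v : E) (b c : E →L[ℝ] ℝ), b (fderiv ℝ (P.chartSharp φ) x₀ v c) =
      -c (fderiv ℝ (P.chartSharp φ) x₀ v b) := by
    have e1 : ∀ b c : E →L[ℝ] ℝ, HasFDerivAt (fun x ↦ b (P.chartSharp φ x c))
        (b.comp ((fderiv ℝ (P.chartSharp φ) x₀).flip c)) x₀ := by
      intro b c
      have := b.hasFDerivAt.comp x₀ (hpd.hasFDerivAt.clm_apply (hasFDerivAt_const c x₀))
      refine this.congr_fderiv ?_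
      ext v; simp
    intro v b c
    have e2 := (e1 c b).neg
    have e3 := (e1 b c).unique (e2.congr_of_eventuallyEq
      (.of_forall fun x ↦ P.apply_chartSharp_comm x b c))
    exact congrArg (fun T : E →L[ℝ] ℝ ↦ T v) e3
  have hp0 : P.chartSharp φ x₀ = 0 := by
    ext c
    rw [P.chartSharp_apply, hs₀, hP.sh_one, map_zero]
    rfl
  -- Since the bivector vanishes at the unit, the derivatives of `R` do not contribute: the
  -- differential of `rtriv` at `1` is that of the bivector alone.
  have hZ' : ∀ v, X (fderiv ℝ (P.chartSharp φ) x₀ v Y) = Z v := by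
    intro v
    have e1 : (fun x ↦ P.rtriv X Y (φ.symm x)) =ᶠ[𝓝 x₀]
        fun x ↦ X (R x (P.chartSharp φ x (Y.comp (R x)))) := by
      filter_upwards [φ.open_target.mem_nhds hx₀t] with x hx
      have e2 : ∀ w, R x (tmap E E φ (φ.symm x) w) = rOne E (φ.symm x) w := by
        intro w
        refine congrArg (rOne E (φ.symm x)) ?_
        have := tmap_symm_tmap hφ (φ.map_target hx) w
        rwa [φ.right_inv hx] at this
      have e3 : (Y.comp (R x)).comp (tmap E E φ (φ.symm x)) = Y.comp (rOne E (φ.symm x)) := by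
        ext w; exact congrArg Y (e2 w)
      rw [P.chartSharp_apply, e2, e3, P.rtriv_eq]
    have e4 := hR.clm_apply (hpd.hasFDerivAt.clm_apply
      ((ContinuousLinearMap.compL ℝ E E ℝ Y).hasFDerivAt.comp x₀ hR))
    have e5 := (X.hasFDerivAt.comp x₀ e4).congr_of_eventuallyEq e1
    have e6 : SmoothAt E ℝ (P.rtriv X Y) (φ.symm x₀) := P.smoothAt_rtriv X Y _
    have e7 := tmap_comp_apply e6 (smoothAt_chart_symm hφ hx₀t) v
    rw [tmap_eq_fderiv, e5.fderiv, hs₀, hφ1', hZ] at e7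
    rw [← e7]
    simp [hp0, hR0]
  have hbr := lieBracket_eq_of_jacobi hL hR hL0 hR0 hpd hp0 hpc
    (Θ := Θ) (fun b c ↦ P.apply_sh_comm γ (b.comp (rOne E γ)) (c.comp (rOne E γ)))
    ((P.contDiffAt_chartSharp hθ hx₀θ).differentiableAt (by simp))
    (by filter_upwards [θ.open_target.mem_nhds hx₀θ] with x hx using hq x hx)
    (hP.isPoisson.jacobi_chartSharp hθ hx₀θ) hZ'
  have hev : ∀ X : E →L[ℝ] ℝ, chartField θ (fun g ↦ P.sh g (X.comp (rOne E g))) =ᶠ[𝓝 x₀]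
      fun x ↦ P.chartSharp θ x (X.comp (R x)) := fun X ↦ by
    filter_upwards [θ.open_target.mem_nhds hx₀θ] with x hx using hS X x hx
  rw [← (hev X).lieBracket_vectorField_eq (hev Y)] at hbr
  have hsm : ∀ X : E →L[ℝ] ℝ, SmoothFieldAt (fun g ↦ P.sharp g (rightCovector (E := E) X g))
      (θ.symm x₀) := fun X ↦ P.smoothFieldAt_sharp (smoothFormAt_rightCovector (E := E) X _)
  have hbr2 := (lieBracket_chartField hθ hx₀θ (hsm X).mdifferentiableAt
    (hsm Y).mdifferentiableAt).symm.trans hbr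
  have hZ0 : P.chartSharp θ x₀ Z = tmap E E θ γ (P.sh γ (Z.comp (rOne E γ))) := by
    have e1 := hS Z x₀ hx₀θ
    rw [hR0, ContinuousLinearMap.comp_id] at e1
    rw [← e1, ← hθγ, chartField_apply hγ]
  rw [hZ0, ← hθγ] at hbr2
  have hbr3 := (chartField_apply hγ _).symm.trans hbr2
  have hbr4 := congrArg (tmap E E θ.symm (θ γ)) hbr3
  rw [map_neg, tmap_symm_tmap hθ hγ] at hbr4
  exact (tmap_symm_tmap hθ hγ _).symm.trans hbr4

end GroupChart

/-! ### Differential equations: variation of initial values and linear control. -/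

section DifferentialEquations

open Metric NNReal

/-- Existence of a solution that stays in the ball on which the vector field is controlled. -/
lemma IsPicardLindelof.exists_mem_closedBall {W : Type*} [NormedAddCommGroup W] [NormedSpace ℝ W]
    [CompleteSpace W] {F : ℝ → W → W} {tmin tmax : ℝ} {t₀ : Icc tmin tmax} {x₀ x : W}
    {a r L K : ℝ≥0} (hF : IsPicardLindelof F t₀ x₀ a r L K) (hx : x ∈ closedBall x₀ r) :
    ∃ y : ℝ → W, y t₀ = x ∧ ∀ t ∈ Icc tmin tmax, y t ∈ closedBall x₀ a ∧
      HasDerivWithinAt y (F t (y t)) (Icc tmin tmax) t := by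
  obtain ⟨y, hy⟩ := ODE.FunSpace.exists_isFixedPt_next hF hx
  refine ⟨y.compProj, by rw [ODE.FunSpace.compProj_val, ← hy, ODE.FunSpace.next_apply₀],
    fun t ht ↦ ⟨y.compProj_mem_closedBall hF.mul_max_le, ?_⟩⟩
  refine (ODE.hasDerivWithinAt_picard_Icc t₀.2 hF.continuousOn_uncurry
    y.continuous_compProj.continuousOn (fun _ _ ↦ y.compProj_mem_closedBall hF.mul_max_le)
    x ht).congr_of_mem (fun t' ht' ↦ ?_) ht
  nth_rw 1 [← hy]
  rw [ODE.FunSpace.compProj_of_mem ht', ODE.FunSpace.next_apply]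

/-- A twice continuously differentiable map has bounded and Lipschitz derivative on a small ball. -/
lemma exists_closedBall_lipschitz_fderiv {W W' : Type*} [NormedAddCommGroup W] [NormedSpace ℝ W]
    [NormedAddCommGroup W'] [NormedSpace ℝ W'] {F : W → W'} {z₀ : W} (hF : ContDiffAt ℝ 2 F z₀)
    {N : Set W} (hN : N ∈ 𝓝 z₀) : ∃ ρ > 0, ∃ K > 0, ∃ C > 0, closedBall z₀ ρ ⊆ N ∧
      ∀ z ∈ closedBall z₀ ρ, HasFDerivAt F (fderiv ℝ F z) z ∧ ‖fderiv ℝ F z‖ ≤ K ∧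
        ∀ z' ∈ closedBall z₀ ρ, ‖fderiv ℝ F z - fderiv ℝ F z'‖ ≤ C * ‖z - z'‖ := by
  have h1 : ContDiffAt ℝ 1 (fderiv ℝ F) z₀ := hF.fderiv_right (by norm_num)
  obtain ⟨C, A, hA, hC⟩ := h1.exists_lipschitzOnWith
  have h2 : ∀ᶠ z in 𝓝 z₀, ‖fderiv ℝ F z‖ < ‖fderiv ℝ F z₀‖ + 1 :=
    h1.continuousAt.norm.eventually_lt_const (by simp)
  have h3 : ∀ᶠ z in 𝓝 z₀, ContDiffAt ℝ 2 F z := hF.eventually (by norm_num)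
  obtain ⟨ρ, hρ, hball⟩ := nhds_basis_closedBall.mem_iff.1
    (inter_mem (inter_mem hA hN) (inter_mem h2 h3))
  -- The added `1` in the Lipschitz constant only serves to make it positive.
  refine ⟨ρ, hρ, ‖fderiv ℝ F z₀‖ + 1, by positivity, C + 1, by positivity,
    fun z hz ↦ (hball hz).1.2, fun z hz ↦ ⟨?_, (hball hz).2.1.le, fun z' hz' ↦ ?_⟩⟩
  · have h4 : ContDiffAt ℝ 2 F z := (hball hz).2.2
    exact (h4.differentiableAt (by norm_num)).hasFDerivAt
  · refine (hC.norm_sub_le (hball hz).1.1 (hball hz').1.1).trans ?_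
    gcongr
    simp

/-- Differentiability of the endpoint of a solution of an autonomous differential equation, for a
family of solutions with differentiable initial values. -/
lemma hasDerivWithinAt_of_family {W : Type*} [NormedAddCommGroup W] [NormedSpace ℝ W] {F : W → W}
    {F' : W → W →L[ℝ] W} {B : Set W} (hB : Convex ℝ B) {K C : ℝ} (hK : 0 < K)
    (hF : ∀ z ∈ B, HasFDerivAt F (F' z) z) (hFK : ∀ z ∈ B, ‖F' z‖ ≤ K)
    (hFC : ∀ z ∈ B, ∀ z' ∈ B, ‖F' z - F' z'‖ ≤ C * ‖z - z'‖) {J : Set ℝ} {τ : ℝ} (hτ : τ ∈ J)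
    {y : ℝ → ℝ → W} (hyB : ∀ t ∈ J, ∀ s ∈ Icc (0 : ℝ) 1, y t s ∈ B)
    (hy : ∀ t ∈ J, ∀ s ∈ Icc (0 : ℝ) 1, HasDerivWithinAt (y t) (F (y t s)) (Icc 0 1) s)
    {w : ℝ → W} (hw0 : HasDerivWithinAt (fun t ↦ y t 0) (w 0) J τ)
    (hw : ∀ s ∈ Icc (0 : ℝ) 1, HasDerivWithinAt w (F' (y τ s) (w s)) (Icc 0 1) s) :
    HasDerivWithinAt (fun t ↦ y t 1) (w 1) J τ := by
  have hIci : ∀ s ∈ Ico (0 : ℝ) 1, ∀ {g : ℝ → W} {g' : W}, HasDerivWithinAt g g' (Icc 0 1) s →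
      HasDerivWithinAt g g' (Ici s) s := fun s hs g g' h ↦
    h.mono_of_mem_nhdsWithin (mem_of_superset (Icc_mem_nhdsGE hs.2) (Icc_subset_Icc_left hs.1))
  have hlip : LipschitzOnWith K.toNNReal F B :=
    hB.lipschitzOnWith_of_nnnorm_hasFDerivWithin_le (fun z hz ↦ (hF z hz).hasFDerivWithinAt)
      (fun z hz ↦ by
        rw [← NNReal.coe_le_coe, Real.coe_toNNReal _ hK.le]
        exact hFK z hz)
  -- Grönwall: two solutions separate at most by the factor `exp K` over unit time.
  have h1 : ∀ t ∈ J, ∀ s ∈ Icc (0 : ℝ) 1,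
      ‖y t s - y τ s‖ ≤ Real.exp K * ‖y t 0 - y τ 0‖ := by
    intro t ht s hs
    have e1 := dist_le_of_trajectories_ODE_of_mem (v := fun _ ↦ F) (s := fun _ ↦ B)
      (δ := ‖y t 0 - y τ 0‖) (fun _ _ ↦ hlip)
      (fun s hs ↦ (hy t ht s hs).continuousWithinAt)
      (fun s hs ↦ hIci s hs (hy t ht s (Ico_subset_Icc_self hs)))
      (fun s hs ↦ hyB t ht s (Ico_subset_Icc_self hs))
      (fun s hs ↦ (hy τ hτ s hs).continuousWithinAt)
      (fun s hs ↦ hIci s hs (hy τ hτ s (Ico_subset_Icc_self hs)))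
      (fun s hs ↦ hyB τ hτ s (Ico_subset_Icc_self hs)) (dist_eq_norm _ _).le s hs
    rw [dist_eq_norm, Real.coe_toNNReal _ hK.le] at e1
    refine e1.trans ?_
    rw [mul_comm]
    gcongr
    have := mul_le_mul_of_nonneg_left hs.2 hK.le
    linarith
  -- First-order Taylor remainder, quadratic because `F'` is Lipschitz on the convex set `B`.
  have h2 : ∀ z ∈ B, ∀ z' ∈ B, ‖F z' - F z - F' z (z' - z)‖ ≤ C * ‖z' - z‖ * ‖z' - z‖ := by
    intro z hz z' hz'
    have hseg : segment ℝ z z' ⊆ B := hB.segment_subset hz hz'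
    have hC : ∀ u ∈ segment ℝ z z', ‖F' u - F' z‖ ≤ C * ‖z' - z‖ := by
      intro u hu
      rcases eq_or_ne z z' with rfl | hne
      · rw [segment_same] at hu
        obtain rfl : u = z := hu
        simp
      · have hC0 : 0 ≤ C := by
          have := (norm_nonneg _).trans (hFC z hz z' hz')
          by_contra hneg
          have h3 : 0 < ‖z - z'‖ := norm_sub_pos_iff.2 hne
          nlinarith
        refine (hFC u (hseg hu) z hz).trans ?_
        gcongr
        have := norm_sub_le_of_mem_segment hu
        rwa [norm_sub_rev z' z, norm_sub_rev u z] at *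
    exact (convex_segment z z').norm_image_sub_le_of_norm_hasFDerivWithin_le'
      (fun u hu ↦ (hF u (hseg hu)).hasFDerivWithinAt) hC (left_mem_segment ℝ z z')
      (right_mem_segment ℝ z z')
  -- The error `y t s - y τ s - (t - τ) • w s` satisfies the linearized equation up to a forcing
  -- term quadratic in the initial separation, so Grönwall applies a second time.
  have h3 : ∀ t ∈ J, ‖y t 1 - y τ 1 - (t - τ) • w 1‖ ≤
      Real.exp K * ‖y t 0 - y τ 0 - (t - τ) • w 0‖ +
      |C| * Real.exp K ^ 2 / K * (Real.exp K - 1) * ‖y t 0 - y τ 0‖ ^ 2 := by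
    intro t ht
    have e1 : ∀ s ∈ Icc (0 : ℝ) 1, HasDerivWithinAt (fun s ↦ y t s - y τ s - (t - τ) • w s)
        (F (y t s) - F (y τ s) - (t - τ) • F' (y τ s) (w s)) (Icc 0 1) s := fun s hs ↦
      ((hy t ht s hs).sub (hy τ hτ s hs)).sub ((hw s hs).const_smul (t - τ))
    have e2 := norm_le_gronwallBound_of_norm_deriv_right_le (K := K)
      (ε := |C| * (Real.exp K * ‖y t 0 - y τ 0‖) ^ 2) (f := fun s ↦ y t s - y τ s - (t - τ) • w s)
      (fun s hs ↦ (e1 s hs).continuousWithinAt)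
      (fun s hs ↦ hIci s hs (e1 s (Ico_subset_Icc_self hs))) le_rfl
      (fun s hs ↦ ?_) 1 (by simp)
    · rw [gronwallBound_of_K_ne_0 hK.ne'] at e2
      refine e2.trans (le_of_eq ?_)
      simp only [sub_zero, mul_one]
      ring
    · have hs' := Ico_subset_Icc_self hs
      have e3 : F (y t s) - F (y τ s) - (t - τ) • F' (y τ s) (w s) =
          (F (y t s) - F (y τ s) - F' (y τ s) (y t s - y τ s)) +
          F' (y τ s) (y t s - y τ s - (t - τ) • w s) := by
        rw [map_sub _ _ ((t - τ) • w s), map_smul]; abel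
      rw [e3, add_comm (K * _)]
      refine (norm_add_le _ _).trans (add_le_add ?_ ?_)
      · refine (h2 _ (hyB τ hτ s hs') _ (hyB t ht s hs')).trans ?_
        rw [mul_assoc, ← sq]
        have := h1 t ht s hs'
        gcongr
        exact le_abs_self C
      · exact ((F' (y τ s)).le_opNorm _).trans (by gcongr; exact hFK _ (hyB τ hτ s hs'))
  rw [hasDerivWithinAt_iff_isLittleO] at hw0 ⊢
  have h4 : (fun t ↦ y t 0 - y τ 0) =O[𝓝[J] τ] fun t ↦ t - τ := by
    have e1 := hw0.isBigO.add (Asymptotics.isBigO_of_le' (c := ‖w 0‖) (𝓝[J] τ)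
      (f := fun t ↦ (t - τ) • w 0) (g := fun t ↦ t - τ)
      (fun t ↦ by rw [norm_smul, mul_comm]))
    simpa using e1
  have h5 : (fun t ↦ ‖y t 0 - y τ 0‖ ^ 2) =o[𝓝[J] τ] fun t ↦ t - τ := by
    refine (h4.norm_left.pow 2).trans_isLittleO ?_
    have e1 : Tendsto (fun t : ℝ ↦ t - τ) (𝓝[J] τ) (𝓝 0) := by
      have : ContinuousAt (fun t : ℝ ↦ t - τ) τ := by fun_prop
      simpa [ContinuousAt] using this.tendsto.mono_left (nhdsWithin_le_nhds (s := J))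
    have e2 : (fun t : ℝ ↦ (t - τ) * (t - τ)) =o[𝓝[J] τ] fun t ↦ 1 * (t - τ) :=
      ((Asymptotics.isLittleO_one_iff ℝ).2 e1).mul_isBigO (Asymptotics.isBigO_refl _ _)
    simpa [sq] using e2
  refine Asymptotics.IsBigO.trans_isLittleO (g := fun t ↦
      Real.exp K * ‖y t 0 - y τ 0 - (t - τ) • w 0‖ +
      |C| * Real.exp K ^ 2 / K * (Real.exp K - 1) * ‖y t 0 - y τ 0‖ ^ 2) ?_
    ((hw0.norm_left.const_mul_left _).add (h5.const_mul_left _))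
  refine Asymptotics.IsBigO.of_bound 1 ?_
  filter_upwards [self_mem_nhdsWithin] with t ht
  rw [one_mul]
  exact (h3 t ht).trans (le_abs_self _)

/-- The linear differential equation `Y' = Z - β(U, Y)`: for small `U`, its solution with initial
value `0` can be steered to a prescribed endpoint. -/
lemma exists_lipschitz_control {V : Type*} [NormedAddCommGroup V] [NormedSpace ℝ V]
    [CompleteSpace V] (β : V →L[ℝ] V →L[ℝ] V) :
    ∃ R : V → V →L[ℝ] V, ∃ r > 0, ∃ (C : ℝ≥0) (K : ℝ≥0), LipschitzOnWith C R (closedBall 0 r) ∧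
      (∀ U ∈ closedBall (0 : V) r, ‖R U‖ ≤ K) ∧ ∀ U ∈ closedBall (0 : V) r, ∀ v : V,
        ∃ Y : ℝ → V, Y 0 = 0 ∧ Y 1 = v ∧ ∀ s, HasDerivAt Y (R U v - β U (Y s)) s := by
  -- The equation becomes homogeneous after adjoining the constant `Z` as a variable: `N U` sends
  -- `(Y, Z)` to `(Z - β(U, Y), 0)`, and its exponential solves the system.
  let N : V → (V × V) →L[ℝ] (V × V) := fun U ↦
    ContinuousLinearMap.prod (.snd ℝ V V - (β U).comp (.fst ℝ V V)) 0
  have hNs : ContDiff ℝ 1 N := by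
    have e1 : N = fun U ↦ ContinuousLinearMap.prod (.snd ℝ V V) 0 -
        (ContinuousLinearMap.inl ℝ V V).comp ((β U).comp (.fst ℝ V V)) := by
      funext U
      ext v <;> simp [N]
    rw [e1]
    exact contDiff_const.sub (contDiff_const.clm_comp (β.contDiff.clm_comp contDiff_const))
  -- `T U` sends the constant `Z` to the endpoint `Y(1)` of the solution with `Y(0) = 0`. As `T 0 =
  -- id`, it is invertible for small `U`, and the required control is `R U = (T U)⁻¹`.
  let T : V → V →L[ℝ] V := fun U ↦
    (ContinuousLinearMap.fst ℝ V V).comp ((NormedSpace.exp (N U)).comp (.inr ℝ V V))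
  have hTs : ContDiff ℝ 1 T := by
    have e1 : ContDiff ℝ 1 (NormedSpace.exp : ((V × V) →L[ℝ] (V × V)) → _) :=
      contDiff_iff_contDiffAt.2 fun x ↦ (NormedSpace.exp_analytic (𝕂 := ℝ) x).contDiffAt
    exact contDiff_const.clm_comp ((e1.comp hNs).clm_comp contDiff_const)
  have hT0 : T 0 = ((1 : (V →L[ℝ] V)ˣ) : V →L[ℝ] V) := by
    -- `N 0` has square zero, so its exponential series stops after the linear term.
    have e1 : ∀ n ∉ Finset.range 2, ((n.factorial : ℝ)⁻¹) • N 0 ^ n = 0 := by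
      intro n hn
      obtain ⟨k, rfl⟩ : ∃ k, n = 2 + k := ⟨n - 2, by simp at hn; omega⟩
      have e2 : N 0 ^ 2 = 0 := by
        ext v <;> simp [N, sq]
      rw [pow_add, e2, zero_mul, smul_zero]
    ext v
    simp only [T, ContinuousLinearMap.comp_apply, Units.val_one]
    rw [NormedSpace.exp_eq_tsum ℝ]
    simp only
    rw [tsum_eq_sum e1]
    simp [Finset.sum_range_succ, N]
  have hRs : ContDiffAt ℝ 1 (fun U ↦ Ring.inverse (T U)) 0 := by
    have e1 := contDiffAt_ringInverse ℝ (n := 1) (1 : (V →L[ℝ] V)ˣ)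
    rw [← hT0] at e1
    exact e1.comp 0 hTs.contDiffAt
  obtain ⟨C, A, hA, hC⟩ := hRs.exists_lipschitzOnWith
  have h2 : ∀ᶠ U in 𝓝 (0 : V), ‖Ring.inverse (T U)‖ < ‖Ring.inverse (T 0)‖ + 1 :=
    hRs.continuousAt.norm.eventually_lt_const (by simp)
  have h3 : ∀ᶠ U in 𝓝 (0 : V), IsUnit (T U) := by
    refine hTs.continuous.continuousAt.eventually (p := IsUnit) ?_
    rw [hT0]
    exact Units.isOpen.mem_nhds (Units.isUnit 1)
  obtain ⟨r, hr, hball⟩ := nhds_basis_closedBall.mem_iff.1 (inter_mem hA (inter_mem h2 h3))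
  refine ⟨fun U ↦ Ring.inverse (T U), r, hr, C, .mk (‖Ring.inverse (T 0)‖ + 1) (by positivity),
    hC.mono fun U hU ↦ (hball hU).1, fun U hU ↦ (hball hU).2.1.le, fun U hU v ↦ ?_⟩
  set Z := Ring.inverse (T U) v with hZ
  have hcurve : ∀ s : ℝ, HasDerivAt (fun s : ℝ ↦ NormedSpace.exp (s • N U) (0, Z))
      (N U (NormedSpace.exp (s • N U) (0, Z))) s := by
    intro s
    exact ((hasDerivAt_exp_smul_const' (𝕂 := ℝ) (N U) s).clm_apply
      (hasDerivAt_const s ((0 : V), Z))).congr_deriv (by simp)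
  have hsnd : ∀ s : ℝ, (NormedSpace.exp (s • N U) ((0 : V), Z)).2 = Z := by
    intro s
    have e1 : ∀ s : ℝ, HasDerivAt (fun s : ℝ ↦ (NormedSpace.exp (s • N U) ((0 : V), Z)).2) 0 s :=
      fun s ↦ ((ContinuousLinearMap.snd ℝ V V).hasFDerivAt.comp_hasDerivAt s
        (hcurve s)).congr_deriv (by simp [N])
    have e2 := is_const_of_deriv_eq_zero (fun s ↦ (e1 s).differentiableAt)
      (fun s ↦ (e1 s).deriv) s 0
    rw [e2]
    simp
  refine ⟨fun s ↦ (NormedSpace.exp (s • N U) ((0 : V), Z)).1, by simp, ?_, fun s ↦ ?_⟩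
  · have e1 : T U (Ring.inverse (T U) v) = v :=
      congrArg (fun L : V →L[ℝ] V ↦ L v) (Ring.mul_inverse_cancel _ (hball hU).2.2)
    simpa [T] using e1
  · refine ((ContinuousLinearMap.fst ℝ V V).hasFDerivAt.comp_hasDerivAt s
      (hcurve s)).congr_deriv ?_
    have := hsnd s
    simp [N, this]

end DifferentialEquations

/-! ### Trajectories of time-dependent combinations of a Lie algebra of fields. -/

section Control

open Metric NNReal

/-- Let `S` be a family of vector fields, linear in a parameter and closed under the Lie bracket.
A trajectory of a time-dependent combination of these fields can locally be reached along
trajectories of the fields themselves. -/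
theorem eventually_exists_integralCurve {V E : Type*} [NormedAddCommGroup V] [NormedSpace ℝ V]
    [CompleteSpace V] [NormedAddCommGroup E] [NormedSpace ℝ E] [CompleteSpace E]
    {S : E → V →L[ℝ] E} {β : V →L[ℝ] V →L[ℝ] V} {p : E} {Ω : Set E} (hΩ : Ω ∈ 𝓝 p)
    (hS : ContDiffAt ℝ 2 S p)
    (hbr : ∀ x ∈ Ω, ∀ X Y, fderiv ℝ S x (S x X) Y - fderiv ℝ S x (S x Y) X = S x (β X Y))
    {a b t₀ : ℝ} (ht₀ : t₀ ∈ Icc a b) {f : ℝ → V} (hf : ContinuousOn f (Icc a b)) {c : ℝ → E}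
    (hc0 : c t₀ = p) (hcc : ContinuousWithinAt c (Icc a b) t₀)
    (hc : ∀ᶠ t in 𝓝[Icc a b] t₀, HasDerivWithinAt c (S (c t) (f t)) (Icc a b) t) :
    ∀ᶠ t in 𝓝[Icc a b] t₀, ∃ (U : V) (x : ℝ → E), x 0 = p ∧ x 1 = c t ∧
      ∀ s ∈ Icc (0 : ℝ) 1, x s ∈ Ω ∧ HasDerivWithinAt x (S (x s) U) (Icc 0 1) s := by
  obtain ⟨ρ₁, hρ₁, K₁, hK₁, C₁, hC₁, hΩ₁, hS₁⟩ := exists_closedBall_lipschitz_fderiv hS hΩ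
  have hSlip : ∀ x ∈ closedBall p ρ₁, ∀ y ∈ closedBall p ρ₁, ‖S x - S y‖ ≤ K₁ * ‖x - y‖ :=
    fun x hx y hy ↦ (convex_closedBall p ρ₁).norm_image_sub_le_of_norm_hasFDerivWithin_le
      (fun z hz ↦ (hS₁ z hz).1.hasFDerivWithinAt) (fun z hz ↦ (hS₁ z hz).2.1) hy hx
  set M := ‖S p‖ + 1 with hM
  have hM0 : 0 < M := by positivity
  have hSM : ∀ᶠ x in 𝓝 p, ‖S x‖ < M := hS.continuousAt.norm.eventually_lt_const (by simp [hM])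
  -- The parameter `U` becomes a constant coordinate, so dependence on the parameter is a case of
  -- dependence on initial values.
  set F : V × E → V × E := fun z ↦ (0, S z.2 z.1) with hFdef
  have hF2 : ContDiffAt ℝ 2 F (0, p) :=
    contDiffAt_const.prodMk ((ContDiffAt.comp (g := S) ((0 : V), p) hS contDiffAt_snd).clm_apply
      contDiffAt_fst)
  have hN : ∀ᶠ z in 𝓝 ((0 : V), p), z.2 ∈ closedBall p ρ₁ ∧ ‖S z.2‖ < M :=
    (continuous_snd.continuousAt (x := ((0 : V), p))).eventually
      (Filter.Eventually.and (closedBall_mem_nhds p hρ₁) hSM)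
  obtain ⟨ρ, hρ, K, hK, C, hC, hN', hFB⟩ := exists_closedBall_lipschitz_fderiv hF2 hN
  rw [← closedBall_prod_same] at hN' hFB
  have hρsub : ∀ x ∈ closedBall p ρ, x ∈ closedBall p ρ₁ ∧ ‖S x‖ < M := fun x hx ↦
    hN' (a := (0, x)) ⟨mem_closedBall_self hρ.le, hx⟩
  have hFd : ∀ U ∈ closedBall (0 : V) ρ, ∀ x ∈ closedBall p ρ, ∀ A B,
      fderiv ℝ F (U, x) (A, B) = (0, S x A + fderiv ℝ S x B U) := by
    intro U hU x hx A B
    have e1 : HasFDerivAt (fun z : V × E ↦ S z.2) ((fderiv ℝ S x).comp (.snd ℝ V E)) (U, x) :=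
      HasFDerivAt.comp (f := Prod.snd) (U, x) (hS₁ x (hρsub x hx).1).1 hasFDerivAt_snd
    have e2 : HasFDerivAt F _ (U, x) :=
      (hasFDerivAt_const (0 : V) (U, x)).prodMk (e1.clm_apply hasFDerivAt_fst)
    rw [e2.fderiv]
    simp
  obtain ⟨R, r₀, hr₀, CR, KR, hRlip, hRb, hRY⟩ := exists_lipschitz_control β
  -- The bound `ρ / M` limits the speed `‖S x U‖` by `ρ`, so integral curves from `p` stay in the
  -- `ρ`-ball throughout `[0, 1]`.
  set r := min r₀ (min ρ (ρ / M)) with hr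
  have hr0 : 0 < r := lt_min hr₀ (lt_min hρ (by positivity))
  have hrr₀ : closedBall (0 : V) r ⊆ closedBall 0 r₀ := closedBall_subset_closedBall (min_le_left _ _)
  have hrρ : closedBall (0 : V) r ⊆ closedBall 0 ρ :=
    closedBall_subset_closedBall ((min_le_right _ _).trans (min_le_left _ _))
  have hrM : r * M ≤ ρ := by
    rw [← le_div_iff₀ hM0]
    exact (min_le_right _ _).trans (min_le_right _ _)
  have hflow : ∀ U : V, ∃ x : ℝ → E, U ∈ closedBall (0 : V) r → x 0 = p ∧ ∀ s ∈ Icc (0 : ℝ) 1,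
      x s ∈ closedBall p ρ ∧ HasDerivWithinAt x (S (x s) U) (Icc 0 1) s := by
    intro U
    by_cases hU : U ∈ closedBall (0 : V) r
    · have hUr : ‖U‖ ≤ r := by simpa using hU
      have hPL : IsPicardLindelof (fun _ x ↦ S x U) (tmin := 0) (tmax := 1) ⟨0, by simp⟩ p
          (.mk ρ hρ.le) 0 (.mk ρ hρ.le) (.mk (K₁ * ‖U‖) (by positivity)) := by
        refine .of_time_independent (fun x hx ↦ ?_) (LipschitzOnWith.of_dist_le_mul
          fun x hx y hy ↦ ?_) (by simp)
        · refine ((S x).le_opNorm U).trans (le_trans ?_ hrM)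
          rw [mul_comm]
          gcongr
          exact (hρsub x hx).2.le
        · rw [dist_eq_norm, dist_eq_norm, ← sub_apply]
          refine ((S x - S y).le_opNorm U).trans ?_
          have := hSlip x (hρsub x hx).1 y (hρsub y hy).1
          calc ‖S x - S y‖ * ‖U‖ ≤ K₁ * ‖x - y‖ * ‖U‖ := by gcongr
            _ = K₁ * ‖U‖ * ‖x - y‖ := by ring
      obtain ⟨x, hx0, hx⟩ := hPL.exists_mem_closedBall (x := p) (by simp)
      exact ⟨x, fun _ ↦ ⟨hx0, hx⟩⟩
    · exact ⟨0, fun h ↦ absurd h hU⟩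
  choose x hx using hflow
  obtain ⟨B, hB⟩ := isCompact_Icc.exists_bound_of_continuousOn hf
  have hB0 : 0 ≤ B := (norm_nonneg _).trans (hB t₀ ht₀)
  obtain ⟨η₁, hη₁, hcη⟩ := Metric.mem_nhdsWithin_iff.1
    (hc.and (hcc.eventually (by rw [hc0]; exact closedBall_mem_nhds p hρ₁)))
  -- The first bound keeps the times within reach of `hcη`. The second gives `KR * B * η ≤ r`, so
  -- that the solution `U` stays in the `r`-ball.
  set η := min (η₁ / 2) (r / (KR * B + 1)) with hη
  have hη0 : 0 < η := lt_min (by positivity) (by positivity)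
  set J := Icc (max a (t₀ - η)) (min b (t₀ + η)) with hJ
  have ht₀J : t₀ ∈ J := ⟨max_le ht₀.1 (by linarith), le_min ht₀.2 (by linarith)⟩
  have hJab : J ⊆ Icc a b := Icc_subset_Icc (le_max_left _ _) (min_le_left _ _)
  have hJη : ∀ t ∈ J, |t - t₀| ≤ η := fun t ht ↦ by
    rw [abs_le]
    constructor
    · linarith [ht.1, le_max_right a (t₀ - η)]
    · linarith [ht.2, min_le_right b (t₀ + η)]
  have hcJ : ∀ t ∈ J, HasDerivWithinAt c (S (c t) (f t)) J t ∧ c t ∈ closedBall p ρ₁ := by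
    intro t ht
    have e1 : t ∈ ball t₀ η₁ ∩ Icc a b := by
      refine ⟨?_, hJab ht⟩
      rw [mem_ball, Real.dist_eq]
      have := (hJη t ht).trans (min_le_left _ _)
      linarith
    exact ⟨(hcη e1).1.mono hJab, (hcη e1).2⟩
  -- The controlling equation `U' = R(U) f(t)`, `U(t₀) = 0`: it is designed so that the time-one
  -- point of the integral curve of `S · (U t)` follows the trajectory `c`.
  have hPL : IsPicardLindelof (fun t U ↦ R U (f t)) (tmin := max a (t₀ - η))
      (tmax := min b (t₀ + η)) ⟨t₀, ht₀J⟩ 0 (.mk r hr0.le) 0 (KR * .mk B hB0) (CR * .mk B hB0) := by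
    refine ⟨fun t ht ↦ LipschitzOnWith.of_dist_le_mul fun U hU U' hU' ↦ ?_, fun U hU ↦
      (R U).continuous.comp_continuousOn (hf.mono hJab), fun t ht U hU ↦ ?_, ?_⟩
    · rw [dist_eq_norm (R U (f t)), ← sub_apply]
      refine ((R U - R U').le_opNorm _).trans ?_
      have e1 := hRlip.dist_le_mul U (hrr₀ hU) U' (hrr₀ hU')
      rw [dist_eq_norm] at e1
      calc ‖R U - R U'‖ * ‖f t‖ ≤ (CR * dist U U') * B := by
            gcongr
            exact hB t (hJab ht)
        _ = _ := by push_cast; ring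
    · refine ((R U).le_opNorm _).trans ?_
      push_cast
      gcongr
      · exact hRb U (hrr₀ hU)
      · exact hB t (hJab ht)
    · have e1 : max (min b (t₀ + η) - t₀) (t₀ - max a (t₀ - η)) ≤ r / (KR * B + 1) := by
        refine le_trans ?_ (min_le_right (η₁ / 2) _)
        refine max_le ?_ ?_
        · linarith [min_le_right b (t₀ + η)]
        · linarith [le_max_right a (t₀ - η)]
      have e2 : (KR : ℝ) * B * (r / (KR * B + 1)) ≤ r := by
        rw [← mul_div_assoc, div_le_iff₀ (by positivity)]
        nlinarith
      push_cast
      rw [sub_zero]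
      exact (mul_le_mul_of_nonneg_left e1 (by positivity)).trans e2
  obtain ⟨U, hU0, hU⟩ := hPL.exists_mem_closedBall (x := 0) (by simp)
  have hxU : ∀ t ∈ J, x (U t) 0 = p ∧ ∀ s ∈ Icc (0 : ℝ) 1, x (U t) s ∈ closedBall p ρ ∧
      HasDerivWithinAt (x (U t)) (S (x (U t) s) (U t)) (Icc 0 1) s := fun t ht ↦
    hx (U t) (hU t ht).1
  -- The time-one point satisfies the same differential equation as `c`: its variation field is
  -- `S(x) Y`, with `Y` steered from `0` to `f τ`.
  have hend : ∀ τ ∈ J, HasDerivWithinAt (fun t ↦ x (U t) 1) (S (x (U τ) 1) (f τ)) J τ := by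
    intro τ hτ
    obtain ⟨Y, hY0, hY1, hY⟩ := hRY (U τ) (hrr₀ (hU τ hτ).1) (f τ)
    have e1 := hasDerivWithinAt_of_family (F := F) (F' := fderiv ℝ F)
      (B := closedBall (0 : V) ρ ×ˢ closedBall p ρ)
      ((convex_closedBall _ _).prod (convex_closedBall _ _)) hK (fun z hz ↦ (hFB z hz).1)
      (fun z hz ↦ (hFB z hz).2.1) (fun z hz ↦ (hFB z hz).2.2) hτ
      (y := fun t s ↦ (U t, x (U t) s))
      (fun t ht s hs ↦ ⟨hrρ (hU t ht).1, ((hxU t ht).2 s hs).1⟩)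
      (fun t ht s hs ↦ (hasDerivWithinAt_const s (Icc 0 1) (U t)).prodMk ((hxU t ht).2 s hs).2)
      (w := fun s ↦ (R (U τ) (f τ), S (x (U τ) s) (Y s))) ?_ ?_
    · have e2 := (ContinuousLinearMap.snd ℝ V E).hasFDerivAt.comp_hasDerivWithinAt τ e1
      simpa [hY1, Function.comp_def] using e2
    · have e2 : HasDerivWithinAt (fun t ↦ (U t, p)) (R (U τ) (f τ), (0 : E)) J τ :=
        (hU τ hτ).2.prodMk (hasDerivWithinAt_const τ J p)
      refine (e2.congr_of_mem (fun t ht ↦ ?_) hτ).congr_deriv (by simp [hY0])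
      rw [(hxU t ht).1]
    · intro s hs
      obtain ⟨hxs, hxd⟩ := (hxU τ hτ).2 s hs
      have e2 : HasDerivWithinAt (fun s ↦ S (x (U τ) s))
          (fderiv ℝ S (x (U τ) s) (S (x (U τ) s) (U τ))) (Icc 0 1) s :=
        (hS₁ _ (hρsub _ hxs).1).1.comp_hasDerivWithinAt s hxd
      refine ((hasDerivWithinAt_const s (Icc 0 1) (R (U τ) (f τ))).prodMk
        (e2.clm_apply (hY s).hasDerivWithinAt)).congr_deriv ?_
      rw [hFd _ (hrρ (hU τ hτ).1) _ hxs]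
      -- The bracket relation exchanges `S'(S U) Y` for `S'(S Y) U + S(β(U, Y))`, and the last term
      -- cancels the `-β(U, Y)` in `Y'`. Hence `S(x) Y` solves the linearized flow equation.
      have e3 := hbr _ (hΩ₁ (hρsub _ hxs).1) (U τ) (Y s)
      rw [sub_eq_iff_eq_add] at e3
      rw [e3, map_sub]
      congr 1
      abel
  have hconst : x (U t₀) 1 = p := by
    have hU0' : U t₀ = 0 := hU0
    have e1 := eq_zero_of_norm_deriv_le_mul_norm (K := 0) (ordConnected_Icc (a := (0 : ℝ)) (b := 1))
      (g := fun s ↦ x (U t₀) s - p) (g' := fun _ ↦ 0)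
      (fun s hs ↦ (((hxU t₀ ht₀J).2 s hs).2.sub_const p).congr_deriv (by simp [hU0']))
      (fun s hs ↦ by simp) (t := 0) (by simp) (by simp [(hxU t₀ ht₀J).1]) (s := 1) (by simp)
    exact sub_eq_zero.1 e1
  -- Both curves solve `x' = S(x) f(t)` and start at `p`, so Grönwall identifies them.
  have hcx : ∀ t ∈ J, x (U t) 1 = c t := by
    intro t ht
    refine sub_eq_zero.1 (eq_zero_of_norm_deriv_le_mul_norm (K := K₁ * B)
      (ordConnected_Icc (a := max a (t₀ - η)) (b := min b (t₀ + η)))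
      (g := fun t ↦ x (U t) 1 - c t)
      (fun t ht ↦ (hend t ht).sub (hcJ t ht).1) (fun t ht ↦ ?_) ht₀J ?_ ht)
    · rw [← sub_apply]
      refine ((S (x (U t) 1) - S (c t)).le_opNorm _).trans ?_
      have e1 := hSlip _ (hρsub _ ((hxU t ht).2 1 (by simp)).1).1 _ (hcJ t ht).2
      calc _ ≤ K₁ * ‖x (U t) 1 - c t‖ * B := by
            gcongr
            exact hB t (hJab ht)
        _ = _ := by ring
    · simp [hconst, hc0]
  have hJmem : J ∈ 𝓝[Icc a b] t₀ := by
    filter_upwards [inter_mem_nhdsWithin (Icc a b) (Metric.ball_mem_nhds t₀ hη0)] with t ht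
    have e1 := abs_lt.1 (by simpa [Real.dist_eq] using ht.2 : |t - t₀| < η)
    exact ⟨max_le ht.1.1 (by linarith [e1.1]), le_min ht.1.2 (by linarith [e1.2])⟩
  filter_upwards [hJmem] with t ht
  exact ⟨U t, x (U t), (hxU t ht).1, hcx t ht, fun s hs ↦
    ⟨hΩ₁ (hρsub _ ((hxU t ht).2 s hs).1).1, ((hxU t ht).2 s hs).2⟩⟩

end Control

/-! ### Smoothness of right-invariant fields. -/

section RightInvariant

variable {E : Type*} [NormedAddCommGroup E] [NormedSpace ℝ E]
  {G : Type*} [TopologicalSpace G] [ChartedSpace E G] [Group G] [LieGroup 𝓘(ℝ, E) ∞ G]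

open Bundle in
/-- Right-invariant vector fields are smooth. -/
lemma smoothFieldAt_rightInvariant (ξ : E) (x₀ : G) :
    SmoothFieldAt (fun x ↦ (tmap E E (fun y : G ↦ y * x) 1 ξ : E)) x₀ := by
  let F₁ : G → TangentBundle 𝓘(ℝ, E) G × TangentBundle 𝓘(ℝ, E) G := fun g ↦
    (TotalSpace.mk' E 1 (ξ : TangentSpace 𝓘(ℝ, E) (1 : G)), TotalSpace.mk' E g 0)
  have S₁ : ContMDiff 𝓘(ℝ, E) (𝓘(ℝ, E).tangent.prod 𝓘(ℝ, E).tangent) ∞ F₁ :=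
    contMDiff_const.prodMk (contMDiff_zeroSection _ _)
  have S₂ : ContMDiff _ _ ∞ (equivTangentBundleProd 𝓘(ℝ, E) G 𝓘(ℝ, E) G).symm :=
    contMDiff_equivTangentBundleProd_symm
  have S₃ : ContMDiff _ _ ∞ (tangentMap (𝓘(ℝ, E).prod 𝓘(ℝ, E)) 𝓘(ℝ, E)
      (fun p : G × G ↦ p.1 * p.2)) :=
    ContMDiff.contMDiff_tangentMap (contMDiff_mul 𝓘(ℝ, E) ∞) (m := ∞) (by simp)
  have S := (S₃.comp S₂).comp S₁
  refine (S x₀).congr_of_eventuallyEq (.of_eq (funext fun x ↦ ?_))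
  have h1 : HasMFDerivAt 𝓘(ℝ, E) (𝓘(ℝ, E).prod 𝓘(ℝ, E)) (fun y : G ↦ (y, x)) 1
      (ContinuousLinearMap.inl ℝ E E) :=
    (hasMFDerivAt_id (I := 𝓘(ℝ, E)) (1 : G)).prodMk (hasMFDerivAt_const (I := 𝓘(ℝ, E)) (I' := 𝓘(ℝ, E)) x (1 : G))
  have h2 : MDifferentiableAt (𝓘(ℝ, E).prod 𝓘(ℝ, E)) 𝓘(ℝ, E) (fun p : G × G ↦ p.1 * p.2) (1, x) :=
    (contMDiff_mul 𝓘(ℝ, E) ∞).mdifferentiableAt (by simp)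
  have h3 := (HasMFDerivAt.comp (1 : G) h2.hasMFDerivAt h1).mfderiv
  refine Bundle.TotalSpace.ext (one_mul x).symm (heq_of_eq ?_)
  exact congrArg (fun T : E →L[ℝ] E ↦ T ξ) h3

end RightInvariant

/-! ### Returning integral curves from a chart to the manifold. -/

section IntegralCurves

variable {E : Type*} [NormedAddCommGroup E] [NormedSpace ℝ E]
  {M : Type*} [TopologicalSpace M] [ChartedSpace E M]

lemma isMIntegralCurveOn_chart_symm {φ : OpenPartialHomeomorph M E}
    (hφ : φ ∈ IsManifold.maximalAtlas 𝓘(ℝ, E) ∞ M) {v : ∀ x : M, TangentSpace 𝓘(ℝ, E) x}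
    {x : ℝ → E} {J : Set ℝ} (hx : ∀ s ∈ J, x s ∈ φ.target ∧
      HasDerivWithinAt x (chartField φ v (x s)) J s) :
    IsMIntegralCurveOn (fun s ↦ φ.symm (x s)) v J := by
  intro s hs
  obtain ⟨h1, h2⟩ := hx s hs
  have h3 := (smoothAt_chart_symm hφ h1).hasMFDerivAt.comp_hasMFDerivWithinAt s
    h2.hasFDerivWithinAt.hasMFDerivWithinAt
  refine h3.congr_mfderiv ?_
  refine ContinuousLinearMap.ext_ring ?_
  have h4 := tmap_symm_tmap hφ (φ.map_target h1) (v (φ.symm (x s)))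
  rw [φ.right_inv h1] at h4
  have h5 : ∀ u : E, (1 : ℝ →L[ℝ] ℝ).smulRight u 1 = u := fun u ↦ by simp
  have h6 : ∀ u : E, (ContinuousLinearMap.toSpanSingleton ℝ u) 1 = u := fun u ↦ by simp
  refine Eq.trans ?_ (h5 (v (φ.symm (x s)))).symm
  exact (congrArg (tmap E E φ.symm (x s)) (h6 (chartField φ v (x s)))).trans h4

end IntegralCurves

/-! ### Dressing orbits and coisotropic leaves. -/

section Leaves

variable {E : Type*} [NormedAddCommGroup E] [NormedSpace ℝ E] [FiniteDimensional ℝ E]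
  {G : Type*} [TopologicalSpace G] [ChartedSpace E G] [Group G]
  {E' : Type*} [NormedAddCommGroup E'] [NormedSpace ℝ E']
  {Gs : Type*} [TopologicalSpace Gs] [ChartedSpace E' Gs] [Group Gs]

/-- The identification of `Lie G` with the dual of `Lie Gs`. -/
lemma exists_evalEquiv [FiniteDimensional ℝ E']
    (e : GroupLieAlgebra 𝓘(ℝ, E') Gs ≃L[ℝ] Cotangent E (1 : G)) :
    ∃ ε : E ≃L[ℝ] (E' →L[ℝ] ℝ), ∀ X, ε X = evalForm e X := by
  let l : E →L[ℝ] (E' →L[ℝ] ℝ) := (dualMap e : E' →L[ℝ] (E →L[ℝ] ℝ)).flip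
  have hl : ∀ X, l X = evalForm e X := fun X ↦ by ext ξ; rfl
  have hinj : Function.Injective l.toLinearMap := by
    refine (injective_iff_map_eq_zero _).2 fun X hX ↦ ?_
    refine (SeparatingDual.eq_zero_iff_forall_dual_eq_zero (R := ℝ) X).2 fun f ↦ ?_
    have h1 : l X ((dualMap e).symm f) = 0 := by
      rw [show l X = 0 from hX]
      rfl
    have h2 : l X ((dualMap e).symm f) = dualMap e ((dualMap e).symm f) X := rfl
    rw [h2, ContinuousLinearEquiv.apply_symm_apply] at h1
    exact h1
  have hsurj : Function.Surjective l.toLinearMap := fun ζ ↦ by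
    obtain ⟨X, hX⟩ := exists_evalForm_eq e ζ
    exact ⟨X, (hl X).trans hX⟩
  exact ⟨(LinearEquiv.ofBijective l.toLinearMap ⟨hinj, hsurj⟩).toContinuousLinearEquiv, hl⟩

variable [LieGroup 𝓘(ℝ, E) ∞ G]

/-- The Lie bracket on a subalgebra of the Lie algebra of `G`, as a bilinear map. -/
lemma exists_bilinear_lie (T : Submodule ℝ E)
    (hT : ∀ X Y : GroupLieAlgebra 𝓘(ℝ, E) G, X ∈ T → Y ∈ T → ⁅X, Y⁆ ∈ T) :
    ∃ β : T →L[ℝ] T →L[ℝ] T, ∀ X Y : T,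
      (β X Y : E) = (fun A B : GroupLieAlgebra 𝓘(ℝ, E) G ↦ ⁅A, B⁆) X.1 Y.1 := by
  have : CompleteSpace E := FiniteDimensional.complete ℝ E
  let b : T →ₗ[ℝ] T →ₗ[ℝ] T := LinearMap.mk₂ ℝ (fun X Y ↦ ⟨_, hT X.1 Y.1 X.2 Y.2⟩)
    (fun X X' Y ↦ Subtype.ext (add_lie (L := GroupLieAlgebra 𝓘(ℝ, E) G)
      (M := GroupLieAlgebra 𝓘(ℝ, E) G) X.1 X'.1 Y.1))
    (fun r X Y ↦ Subtype.ext (smul_lie (L := GroupLieAlgebra 𝓘(ℝ, E) G)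
      (M := GroupLieAlgebra 𝓘(ℝ, E) G) r X.1 Y.1))
    (fun X Y Y' ↦ Subtype.ext (lie_add (L := GroupLieAlgebra 𝓘(ℝ, E) G)
      (M := GroupLieAlgebra 𝓘(ℝ, E) G) X.1 Y.1 Y'.1))
    (fun r X Y ↦ Subtype.ext (lie_smul (L := GroupLieAlgebra 𝓘(ℝ, E) G)
      (M := GroupLieAlgebra 𝓘(ℝ, E) G) r X.1 Y.1))
  exact ⟨b.toContinuousBilinearMap, fun X Y ↦ rfl⟩

variable [LieGroup 𝓘(ℝ, E') ∞ Gs] [FiniteDimensional ℝ E']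
  {P : Bivector E G} {Ps : Bivector E' Gs}
  {e : GroupLieAlgebra 𝓘(ℝ, E') Gs ≃L[ℝ] Cotangent E (1 : G)}
  {H : Subgroup G} {Hp : Subgroup Gs}

namespace DualSubgroups

/-- Duality identifies the differential at the unit of the right-trivialized bivector with the form
defined by `[X, Y]`. The dressing fields of a subalgebra are therefore closed under the bracket. -/
lemma mlieBracket_leftDressing [T2Space Gs] (D : DualSubgroups P Ps e H Hp)
    (X Y : GroupLieAlgebra 𝓘(ℝ, E) G) (γ : Gs) :
    VectorField.mlieBracket 𝓘(ℝ, E') (leftDressing Ps e X) (leftDressing Ps e Y) γ =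
      -leftDressing Ps e ⁅X, Y⁆ γ := by
  refine D.poissonLie.mlieBracket_sharp_rightCovector (X := evalForm e X) (Y := evalForm e Y)
    (Z := evalForm e (show GroupLieAlgebra 𝓘(ℝ, E) G from ⁅X, Y⁆)) ?_ γ
  ext ξ
  exact (D.dual.bracket X Y ξ).symm

/-- A trajectory of a conormal field stays, locally, in the orbit of the dressing action. -/
lemma eventually_joinedByTrajectory [T2Space Gs] (D : DualSubgroups P Ps e H Hp) {U : Set Gs}
    {α : ∀ z : Gs, Cotangent E' z} (hU : IsOpen U) (hα : SmoothFormOn α U)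
    (hcon : ∀ z ∈ U ∩ Hp, α z ∈ conormalSet (E := E') (Hp : Set Gs) z) {c : ℝ → Gs} {a b : ℝ}
    (hc : IsMIntegralCurveOn c (fun z ↦ Ps.sharp z (α z)) (Icc a b))
    (hcU : ∀ t ∈ Icc a b, c t ∈ U ∩ Hp) {t₀ : ℝ} (ht₀ : t₀ ∈ Icc a b) :
    ∀ᶠ t in 𝓝[Icc a b] t₀, ∃ v ∈ leftDressing Ps e '' lieAlg E H,
      JoinedByTrajectory v univ (c t₀) (c t) := by
  have : CompleteSpace E := FiniteDimensional.complete ℝ E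
  have : CompleteSpace E' := FiniteDimensional.complete ℝ E'
  obtain ⟨T, hT⟩ := exists_submodule_eq_tanSet D.sub H.one_mem
  have hTl : ∀ X Y : GroupLieAlgebra 𝓘(ℝ, E) G, X ∈ T → Y ∈ T → ⁅X, Y⁆ ∈ T := fun X Y hX hY ↦
    (hT _).1 (lie_mem_tanSet D.sub ((hT X).2 hX) ((hT Y).2 hY))
  obtain ⟨β, hβ⟩ := exists_bilinear_lie T hTl
  obtain ⟨ε, hε⟩ := exists_evalEquiv e
  obtain ⟨π, hπ⟩ := T.subtype.exists_leftInverse_of_injective T.ker_subtype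
  have hπ' : ∀ X : E, X ∈ T → (π X : E) = X := fun X hX ↦
    congrArg Subtype.val (LinearMap.congr_fun hπ ⟨X, hX⟩)
  have hφ := IsManifold.chart_mem_maximalAtlas (I := 𝓘(ℝ, E')) (n := ∞) (c t₀)
  have hsrc := mem_chart_source E' (c t₀)
  set φ := chartAt E' (c t₀)
  have htgt := φ.map_source hsrc
  let S : E' → T →L[ℝ] E' := fun x ↦ (tmap E' E' φ (φ.symm x)).comp ((Ps.sh (φ.symm x)).comp
    (((ContinuousLinearMap.compL ℝ E' E' ℝ).flip (rOne E' (φ.symm x))).comp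
      ((ε : E →L[ℝ] (E' →L[ℝ] ℝ)).comp T.subtypeL)))
  have hSX : ∀ x (X : T), S x X = chartField φ (leftDressing Ps e (X : E)) x := by
    intro x X
    change tmap E' E' φ (φ.symm x) (Ps.sh (φ.symm x) ((ε (X : E)).comp (rOne E' (φ.symm x)))) = _
    rw [hε]
    rfl
  have hSd : ∀ x ∈ φ.target, ContDiffAt ℝ ∞ S x := by
    intro x hx
    refine ContDiffOn.contDiffAt ?_ (φ.open_target.mem_nhds hx)
    refine contDiffOn_clm_apply.2 fun X y hy ↦ ?_
    exact (((smoothFieldAt_leftDressing Ps e (X : E) _).contDiffAt_chartField hφ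
      hy).congr_of_eventuallyEq (.of_forall fun z ↦ hSX z X)).contDiffWithinAt
  have hbr : ∀ x ∈ φ.target, ∀ X Y : T,
      fderiv ℝ S x (S x X) Y - fderiv ℝ S x (S x Y) X = S x ((-β) X Y) := by
    intro x hx X Y
    have h1 : ∀ X : T, HasFDerivAt (chartField φ (leftDressing Ps e (X : E)))
        ((fderiv ℝ S x).flip X) x := by
      intro X
      have h2 := ((hSd x hx).differentiableAt (by simp)).hasFDerivAt.clm_apply
        (hasFDerivAt_const X x)
      refine (h2.congr_fderiv ?_).congr_of_eventuallyEq (.of_forall fun z ↦ (hSX z X).symm)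
      ext v; simp
    have h3 := lieBracket_chartField hφ hx
      (smoothFieldAt_leftDressing Ps e (X : E) (φ.symm x)).mdifferentiableAt
      (smoothFieldAt_leftDressing Ps e (Y : E) (φ.symm x)).mdifferentiableAt
    rw [VectorField.lieBracket, (h1 X).fderiv, (h1 Y).fderiv, ← hSX, ← hSX] at h3
    have h4 : S x ((-β) X Y) = -chartField φ (leftDressing Ps e (β X Y : E)) x := by
      rw [← hSX, ← map_neg]; rfl
    rw [h4, hβ]
    refine h3.trans ?_
    have h5 := D.mlieBracket_leftDressing (X : E) (Y : E) (φ.symm x)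
    exact (congrArg (tmap E' E' φ (φ.symm x)) h5).trans (map_neg _ _)
  -- The conormal form along `c`, right-translated to the unit. Under `ε` it is the curve in `𝔥`
  -- whose dressing fields drive the trajectory.
  let ρ : ℝ → E' →L[ℝ] ℝ := fun t ↦
    ContinuousLinearMap.comp (α (c t) : E' →L[ℝ] ℝ) (tmap E' E' (fun y : Gs ↦ y * c t) 1)
  have hρ : ContinuousOn ρ (Icc a b) := by
    refine continuousOn_clm_apply.2 fun ξ t ht ↦ ?_
    have h1 : SmoothFormAt α (c t) := (hα _ (hcU t ht).1).contMDiffAt (hU.mem_nhds (hcU t ht).1)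
    have h2 := h1.apply (smoothFieldAt_rightInvariant ξ (c t))
    exact ContinuousAt.comp_continuousWithinAt (f := c) h2.continuousAt (hc.continuousWithinAt ht)
  have hf : ∀ t ∈ Icc a b, ε.symm (ρ t) ∈ T ∧
      Ps.sharp (c t) (α (c t)) = leftDressing Ps e (ε.symm (ρ t)) (c t) := by
    intro t ht
    obtain ⟨X, hX, hXα⟩ := (D.mem_conormalSet_iff (hcU t ht).2).1 (hcon _ (hcU t ht))
    have h1 : ε.symm (ρ t) = X := by
      rw [ContinuousLinearEquiv.symm_apply_eq, hε]
      ext ξ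
      have h2 : ρ t ξ = ((evalForm e X).comp (rOne E' (c t)))
          (tmap E' E' (fun y : Gs ↦ y * c t) 1 ξ) := by rw [hXα]; rfl
      rw [h2]
      exact congrArg (evalForm e X) (rOne_rightT_one (c t) ξ)
    rw [h1]
    exact ⟨(hT X).1 hX, congrArg (Ps.sh (c t)) hXα.symm⟩
  have hcc : ContinuousWithinAt c (Icc a b) t₀ := hc.continuousWithinAt ht₀
  have hsrc' : ∀ᶠ t in 𝓝[Icc a b] t₀, c t ∈ φ.source := hcc (φ.open_source.mem_nhds hsrc)
  -- The structure map is `-β`, since the dressing fields reverse the bracket of `𝔥`. The projection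
  -- `π` makes the coefficient curve `T`-valued at all times; on `[a, b]` it changes nothing.
  have key := eventually_exists_integralCurve (φ.open_target.mem_nhds htgt)
    ((hSd _ htgt).of_le two_le_infty) hbr ht₀
    (f := fun t ↦ LinearMap.toContinuousLinearMap π (ε.symm (ρ t)))
    ((LinearMap.toContinuousLinearMap π).continuous.comp_continuousOn
      (ε.symm.continuous.comp_continuousOn hρ)) (c := fun t ↦ φ (c t)) rfl
    ((φ.continuousAt hsrc).comp_continuousWithinAt hcc) (by
      filter_upwards [hsrc', self_mem_nhdsWithin] with t ht htI
      refine (hc.hasDerivWithinAt_chart hφ htI ht).congr_deriv ?_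
      rw [hSX]
      have h1 : ((LinearMap.toContinuousLinearMap π (ε.symm (ρ t)) : T) : E) = ε.symm (ρ t) :=
        hπ' _ (hf t htI).1
      rw [h1]
      exact (chartField_apply ht _).trans ((congrArg (tmap E' E' φ (c t)) (hf t htI).2).trans
        (chartField_apply ht _).symm))
  filter_upwards [key, hsrc'] with t ht hts
  obtain ⟨X, x, hx0, hx1, hx⟩ := ht
  refine ⟨leftDressing Ps e (X : E), ⟨(X : E), (hT _).2 X.2, rfl⟩, fun s ↦ φ.symm (x s), 0, 1,
    zero_le_one, isMIntegralCurveOn_chart_symm hφ fun s hs ↦ ⟨(hx s hs).1, ?_⟩,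
    fun _ _ ↦ mem_univ _, ?_, ?_⟩
  · rw [← hSX]
    exact (hx s hs).2
  · simp only [hx0, φ.left_inv hsrc]
  · simp only [hx1, φ.left_inv hts]

/-- The orbits of the dressing action on `Hp` are the coisotropic leaves. -/
lemma orbit_eq_coisotropicLeaf [T2Space Gs] (D : DualSubgroups P Ps e H Hp) {γ : Gs}
    (hγ : γ ∈ Hp) : orbit (leftDressing Ps e '' lieAlg E H) γ =
      Ps.coisotropicLeaf (Hp : Set Gs) γ := by
  ext δ
  constructor
  · intro h
    -- The orbit relation is symmetrized, so the induction has to carry membership in `Hp` in both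
    -- directions.
    suffices hQ : (γ ∈ Hp ↔ δ ∈ Hp) ∧ (γ ∈ Hp → δ ∈ Ps.coisotropicLeaf (Hp : Set Gs) γ) from
      hQ.2 hγ
    change Relation.EqvGen _ γ δ at h
    clear hγ
    induction h with
    | rel x y hxy =>
      obtain ⟨_, ⟨X, hX, rfl⟩, c, a, b, hab, hc, -, rfl, rfl⟩ := hxy
      have ha : a ∈ Icc a b := left_mem_Icc.2 hab
      have hb : b ∈ Icc a b := right_mem_Icc.2 hab
      have hmem : ∀ s ∈ Icc a b, c s ∈ Hp → ∀ t ∈ Icc a b, c t ∈ Hp := fun s hs h t ht ↦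
        D.integralCurve_mem hX ordConnected_Icc hc hs h ht
      refine ⟨⟨fun h ↦ hmem a ha h b hb, fun h ↦ hmem b hb h a ha⟩, fun h ↦ .rel _ _ ?_⟩
      refine ⟨univ, rightCovector (evalAt e X), isOpen_univ,
        fun z _ ↦ ContMDiffAt.contMDiffWithinAt
          (smoothFormAt_rightCovector (E := E') (evalAt e X) z),
        fun z hz ↦ (D.mem_conormalSet_iff hz.2).2 ⟨X, hX, rfl⟩,
        c, a, b, hab, hc, fun t ht ↦ ⟨mem_univ _, hmem a ha h t ht⟩, rfl, rfl⟩
    | refl x => exact ⟨Iff.rfl, fun _ ↦ .refl x⟩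
    | symm x y _ ih => exact ⟨ih.1.symm, fun h ↦ .symm _ _ (ih.2 (ih.1.2 h))⟩
    | trans x y z _ _ ih₁ ih₂ =>
      exact ⟨ih₁.1.trans ih₂.1, fun h ↦ .trans _ _ _ (ih₁.2 h) (ih₂.2 (ih₁.1.1 h))⟩
  · intro h
    change Relation.EqvGen _ γ δ at h
    clear hγ
    induction h with
    | rel x y hxy =>
      obtain ⟨U, α, hU, hα, hcon, c, a, b, hab, hc, hcU, rfl, rfl⟩ := hxy
      -- Being in the same orbit is an equivalence relation on times which holds locally, hence on
      -- the whole connected interval.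
      refine isPreconnected_Icc.induction₂
        (fun s t ↦ c t ∈ orbit (leftDressing Ps e '' lieAlg E H) (c s)) (fun t ht ↦ ?_)
        (fun r s t _ _ _ h₁ h₂ ↦ .trans _ _ _ h₁ h₂) (fun s t _ _ h ↦ .symm _ _ h)
        (left_mem_Icc.2 hab) (right_mem_Icc.2 hab)
      filter_upwards [D.eventually_joinedByTrajectory hU hα hcon hc hcU ht] with s hs
      exact .rel _ _ hs
    | refl x => exact .refl x
    | symm x y _ ih => exact .symm _ _ ih
    | trans x y z _ _ ih₁ ih₂ => exact .trans _ _ _ ih₁ ih₂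

end DualSubgroups

end Leaves

end

end PoissonLie

theorem mainTheorem8
    {E : Type*} [NormedAddCommGroup E] [NormedSpace ℝ E] [FiniteDimensional ℝ E]
    {G : Type*} [TopologicalSpace G] [T2Space G] [ChartedSpace E G] [Group G]
    [LieGroup 𝓘(ℝ, E) ∞ G]
    {E' : Type*} [NormedAddCommGroup E'] [NormedSpace ℝ E'] [FiniteDimensional ℝ E']
    {Gs : Type*} [TopologicalSpace Gs] [T2Space Gs] [ChartedSpace E' Gs] [Group Gs]
    [LieGroup 𝓘(ℝ, E') ∞ Gs] [SimplyConnectedSpace Gs]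
    (P : Bivector E G) (hP : P.IsPoissonLie)
    (Ps : Bivector E' Gs) (hPs : Ps.IsPoissonLie)
    (e : GroupLieAlgebra 𝓘(ℝ, E') Gs ≃L[ℝ] Cotangent E (1 : G)) (he : IsDual P Ps e)
    (H : Subgroup G) (hH : IsConnectedClosedLieSubgroup E H)
    (hHcois : P.IsCoisotropic (H : Set G))
    (Hp : Subgroup Gs) (hHp : IsConnectedClosedLieSubgroup E' Hp)
    (hHpLie : lieAlg E' Hp = annihilator e (lieAlg E H)) :
    -- the dressing vector fields of `Lie H` are tangent to the coisotropic submanifold `Hp`,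
    -- and `Hp` is invariant under their flows
    Ps.IsCoisotropic (Hp : Set Gs) ∧
    (∀ X ∈ lieAlg E H, ∀ γ ∈ Hp, leftDressing Ps e X γ ∈ tangentSet E' (Hp : Set Gs) γ) ∧
    (∀ X ∈ lieAlg E H, ∀ (c : ℝ → Gs) (J : Set ℝ), J.OrdConnected →
      IsMIntegralCurveOn c (leftDressing Ps e X) J →
      ∀ t₀ ∈ J, c t₀ ∈ Hp → ∀ t ∈ J, c t ∈ Hp) ∧
    -- they span the coisotropic distribution, and the orbits are the coisotropic leaves
    (∀ γ ∈ Hp, (fun X ↦ leftDressing Ps e X γ) '' lieAlg E H =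
      Ps.coisotropicDistribution (Hp : Set Gs) γ) ∧
    (∀ γ ∈ Hp, orbit (leftDressing Ps e '' lieAlg E H) γ =
      Ps.coisotropicLeaf (Hp : Set Gs) γ) ∧
    -- if `H` is a Poisson subgroup, then the dressing action of `Hp` on `H` is trivial
    (P.IsPoissonSubmanifold (H : Set G) →
      (∀ ξ ∈ lieAlg E' Hp, ∀ h ∈ H, rightDressing P e ξ h = 0) ∧
      (∀ ξ ∈ lieAlg E' Hp, ∀ (c : ℝ → G) (J : Set ℝ), J.OrdConnected →
        IsMIntegralCurveOn c (rightDressing P e ξ) J →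
        ∀ t₀ ∈ J, c t₀ ∈ H → ∀ t ∈ J, c t = c t₀)) := by
  have D : DualSubgroups P Ps e H Hp := ⟨hPs, he, hH.isEmbeddedSubmanifold, hHp, hHpLie⟩
  exact ⟨D.isCoisotropic, fun X hX γ hγ ↦ D.leftDressing_mem_tangentSet hX hγ,
    fun X hX c J hJ hc t₀ ht₀ h0 t ht ↦ D.integralCurve_mem hX hJ hc ht₀ h0 ht,
    fun γ hγ ↦ D.image_leftDressing hγ, fun γ hγ ↦ D.orbit_eq_coisotropicLeaf hγ,
    fun hHP ↦ ⟨fun ξ hξ h hh ↦ D.rightDressing_eq_zero hHP hξ hh,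
      fun ξ hξ c J hJ hc t₀ ht₀ h0 t ht ↦ D.rightDressing_integralCurve hHP hξ hJ hc ht₀ h0 ht⟩⟩
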